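/- Let $M=(M^{ab})$ be a symmetric real $n\times n$ matrix (for instance a positive definite inverse mass matrix), let $V:\mathbb R^n\to\mathbb R$ be smooth ($C^\infty$), and sum over repeated indices. Write $\partial_a=\partial/\partial q^a$, $\partial^a=M^{ab}\partial_b$, $p^a = M^{ab}p_b$, $P^a=M^{ab}P_b$ and, for operators acting on functions of $q$ with $p$ and $P$ held fixed, $$D=p_a\partial^a,\qquad \mathcal D=P_a\partial^a,\qquad \bar D=(\partial_aV)\,\partial^a .$$ Put $T_0=\tfrac12 p^ap_a$ and $$T_2=-\tfrac1{12}D^2V,\qquad T_4=\tfrac1{720}\left(D^4-9\bar DD^2+3D\bar DD\right)V,$$ $$T_6=-\tfrac1{60480}\left(2D^6-40\bar DD^4+46D\bar DD^3-15D^2\bar DD^2+54\bar D^2D^2-9\bar DD\bar DD-42D\bar D^2D+12D^2\bar D^2\right)V .$$ For $m\in\{0,1,2,3\}$ let $$T_{\rm eff}(q,p;\tau)=\sum_{j=0}^m\tau^{2j}T_{2j}(q,p)+\tau^{2m+2}S(\tau,q,p)$$ with an arbitrary smooth function $S$ (the terms of higher order; $S=0$ is allowed). The move step over the time $\tau$ is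 the time-$\tau$ flow of $$\dot q^a=\frac{\partial T_{\rm eff}}{\partial p_a},\qquad \dot p_a=-\frac{\partial T_{\rm eff}}{\partial q^a},\qquad\text{with the parameter }\tau\text{ in }T_{\rm eff}\text{ held fixed.}$$ Define functions of $(q,P)$ by $$G_0=q^aP_a,\quad G_1=\tfrac12P^aP_a,\quad G_2=0,\quad G_3=-\tfrac1{12}\mathcal D^2V,\quad G_4=-\tfrac1{24}\mathcal D^3V,$$ $$G_5=-\tfrac1{240}\left(3\mathcal D^4+3\bar D\mathcal D^2-\mathcal D\bar D\mathcal D\right)V,\qquad G_6=-\tfrac1{720}\left(2\mathcal D^5+8\bar D\mathcal D^3-5\mathcal D\bar D\mathcal D^2\right)V,$$ $$G_7=-\tfrac1{20160}\left(10\mathcal D^6+10\bar D\mathcal D^4+90\mathcal D\bar D\mathcal D^3-75\mathcal D^2\bar D\mathcal D^2+18\bar D^2\mathcal D^2-3\bar D\mathcal D\bar D\mathcal D-14\mathcal D\bar D^2\mathcal D+4\mathcal D^2\bar D^2\right)V,$$ $$\begin{aligned}G_8=-\tfrac1{40320}\big(&3\mathcal D^7-87\bar D\mathcal D^5+231\mathcal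 D\bar D\mathcal D^4-133\mathcal D^2\bar D\mathcal D^3+63\bar D^2\mathcal D^3-3\mathcal D\bar D^2\mathcal D^2\\&-21\mathcal D^2\bar D^2\mathcal D+4\mathcal D^3\bar D^2-63\bar D\mathcal D\bar D\mathcal D^2+25\mathcal D\bar D\mathcal D\bar D\mathcal D\big)V.\end{aligned}$$ Say that a smooth function $G(q,P;\tau)$ *realizes the move step to order $N$* if for every compact set $K\subset\mathbb R^{2n}$ and every $R>0$ there are an open $W\supseteq K$ and constants $\tau_0>0$ and $C$ such that for $|\tau|<\tau_0$ and $(q,p)\in W$: 1. the equations $$p_a=\frac{\partial G}{\partial q^a}(q,P;\tau),\qquad Q^a=\frac{\partial G}{\partial P_a}(q,P;\tau)$$ have exactly one solution $(Q,P)=\Phi_\tau(q,p)$ with $\|P-p\|<R$, and $\Phi_\tau(q,p)$ is a smooth function of $(\tau,q,p)\in(-\tau_0,\tau_0)\times W$; 2. $\Phi_\tau$ is exactly symplectic on $W$, i.e. it preserves $\sum_a dq^a\wedge dp_a$; 3. the move step starting at $(q,p)$ exists up to time $\tau$, and its end point differs from $\Phi_\tau(q,p)$ by at most $C|\tau|^{N+1}$.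 Let $N\le 2m+2$ (so $N\le 8$ for $m=3$). Then: (i) For every smooth $S'(\tau,q,P)$, in particular for $S'=0$, the function $$G(q,P;\tau)=\sum_{k=0}^{N}\tau^kG_k(q,P)+\tau^{N+1}S'(\tau,q,P)$$ realizes the move step to order $N$. (ii) These coefficients are the only ones: if $A_0,\dots,A_N$ and $S'$ are smooth and $\sum_{k=0}^{N}\tau^kA_k(q,P)+\tau^{N+1}S'(\tau,q,P)$ realizes the move step to order $N$, then $A_k-G_k$ is constant for every $k\le N$. -/

import Mathlib

open scoped ContDiff

noncomputable section

namespace MoveStep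

/-- Positions `q`, or momenta `p`, of a system with `n` degrees of freedom. -/
abbrev Coord (n : ℕ) : Type := Fin n → ℝ

/-- Phase space, with points `(q, p)`. -/
abbrev Phase (n : ℕ) : Type := Coord n × Coord n

variable {n : ℕ}

/-- The partial derivative `∂f/∂xᵃ` at `x`. -/
def pd (a : Fin n) (f : Coord n → ℝ) (x : Coord n) : ℝ :=
  fderiv ℝ f x (Pi.single a 1)

/-- The operator `p_a ∂ᵃ = p_a Mᵃᵇ ∂/∂qᵇ` on functions of `q`, with `p` held fixed.
It is `D` when applied with the momentum `p`, and `𝒟` when applied with `P`. -/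
def opD (M : Matrix (Fin n) (Fin n) ℝ) (p : Coord n) (f : Coord n → ℝ) : Coord n → ℝ :=
  fun q => ∑ a, ∑ b, p a * M a b * pd b f q

/-- The operator `D̄ = (∂_a V) ∂ᵃ = (∂_a V) Mᵃᵇ ∂/∂qᵇ` on functions of `q`. -/
def opB (M : Matrix (Fin n) (Fin n) ℝ) (V : Coord n → ℝ) (f : Coord n → ℝ) : Coord n → ℝ :=
  fun q => ∑ a, ∑ b, pd a V q * M a b * pd b f q

/-- The quadratic form `½ pᵀ M p`. -/
def kinetic (M : Matrix (Fin n) (Fin n) ℝ) (p : Coord n) : ℝ :=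
  (1 / 2) * ∑ a, ∑ b, p a * M a b * p b

/-- `Tcoeff M V j q p` is the term `T_{2j}(q, p)` of the effective kinetic energy, `j ≤ 3`
(with `T_0 = T`). -/
def Tcoeff (M : Matrix (Fin n) (Fin n) ℝ) (V : Coord n → ℝ) (j : ℕ) (q p : Coord n) : ℝ :=
  let D := opD M p
  let B := opB M V
  match j with
  | 0 => kinetic M p
  | 1 => -(1 / 12) * D (D V) q
  | 2 => (1 / 720) * ((D^[4] V) q - 9 * B (D (D V)) q + 3 * D (B (D V)) q)
  | 3 => -(1 / 60480) * (2 * (D^[6] V) q - 40 * B (D^[4] V) q + 46 * D (B (D^[3] V)) q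
      - 15 * D (D (B (D (D V)))) q + 54 * B (B (D (D V))) q - 9 * B (D (B (D V))) q
      - 42 * D (B (B (D V))) q + 12 * D (D (B (B V))) q)
  | _ => 0

/-- `Gcoeff M V k q P` is the coefficient `G_k(q, P)` of the generating function, `k ≤ 8`. -/
def Gcoeff (M : Matrix (Fin n) (Fin n) ℝ) (V : Coord n → ℝ) (k : ℕ) (q P : Coord n) : ℝ :=
  let D := opD M P
  let B := opB M V
  match k with
  | 0 => ∑ a, q a * P a
  | 1 => kinetic M P
  | 2 => 0
  | 3 => -(1 / 12) * D (D V) q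
  | 4 => -(1 / 24) * D (D (D V)) q
  | 5 => -(1 / 240) * (3 * (D^[4] V) q + 3 * B (D (D V)) q - D (B (D V)) q)
  | 6 => -(1 / 720) * (2 * (D^[5] V) q + 8 * B (D^[3] V) q - 5 * D (B (D (D V))) q)
  | 7 => -(1 / 20160) * (10 * (D^[6] V) q + 10 * B (D^[4] V) q + 90 * D (B (D^[3] V)) q
      - 75 * D (D (B (D (D V)))) q + 18 * B (B (D (D V))) q - 3 * B (D (B (D V))) q
      - 14 * D (B (B (D V))) q + 4 * D (D (B (B V))) q)
  | 8 => -(1 / 40320) * (3 * (D^[7] V) q - 87 * B (D^[5] V) q + 231 * D (B (D^[4] V)) q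
      - 133 * D (D (B (D^[3] V))) q + 63 * B (B (D^[3] V)) q - 3 * D (B (B (D (D V)))) q
      - 21 * D (D (B (B (D V)))) q + 4 * D (D (D (B (B V)))) q
      - 63 * B (D (B (D (D V)))) q + 25 * D (B (D (B (D V)))) q)
  | _ => 0

/-- A function of `(τ, x, y)` is smooth, jointly in all variables. -/
def SmoothParam (S : ℝ → Coord n → Coord n → ℝ) : Prop :=
  ContDiff ℝ ∞ (fun x : ℝ × Coord n × Coord n => S x.1 x.2.1 x.2.2)

/-- A function of `(x, y)` is smooth, jointly in both variables. -/
def Smooth (A : Coord n → Coord n → ℝ) : Prop :=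
  ContDiff ℝ ∞ (fun x : Coord n × Coord n => A x.1 x.2)

/-- The effective kinetic energy
`T_eff(q, p; τ) = T + τ² T_2 + ⋯ + τ^{2m} T_{2m} + τ^{2m+2} S(τ, q, p)`,
where `S` stands for all terms of higher order. -/
def Teff (M : Matrix (Fin n) (Fin n) ℝ) (V : Coord n → ℝ) (m : ℕ)
    (S : ℝ → Coord n → Coord n → ℝ) (τ : ℝ) (q p : Coord n) : ℝ :=
  ∑ j ∈ Finset.range (m + 1), τ ^ (2 * j) * Tcoeff M V j q p + τ ^ (2 * m + 2) * S τ q p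

/-- The function `G(q, P; τ) = ∑_{k ≤ N} τᵏ A_k(q, P) + τ^{N+1} S(τ, q, P)`,
where `S` stands for all terms of higher order. -/
def genFun (A : ℕ → Coord n → Coord n → ℝ) (N : ℕ) (S : ℝ → Coord n → Coord n → ℝ)
    (τ : ℝ) (q P : Coord n) : ℝ :=
  ∑ k ∈ Finset.range (N + 1), τ ^ k * A k q P + τ ^ (N + 1) * S τ q P

/-- The Hamiltonian vector field `(∂H/∂p, -∂H/∂q)`. -/
def hamField (H : Coord n → Coord n → ℝ) (z : Phase n) : Phase n :=
  (fun a => pd a (fun p => H z.1 p) z.2, fun a => -pd a (fun q => H q z.2) z.1)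

/-- `γ` solves the Hamilton equations of `H` on the time interval between `0` and `τ`,
starting at `z`. -/
def IsHamSolution (H : Coord n → Coord n → ℝ) (τ : ℝ) (z : Phase n) (γ : ℝ → Phase n) : Prop :=
  γ 0 = z ∧ ∀ t ∈ Set.uIcc 0 τ, HasDerivWithinAt γ (hamField H (γ t)) (Set.uIcc 0 τ) t

/-- The relations `p = ∂g/∂q (q, P)`, `Q = ∂g/∂P (q, P)` between `z = (q, p)` and `w = (Q, P)`
given by a generating function `g` of type 2. -/
def Generates (g : Coord n → Coord n → ℝ) (z w : Phase n) : Prop :=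
  (∀ a, z.2 a = pd a (fun q => g q w.2) z.1) ∧ (∀ a, w.1 a = pd a (fun P => g z.1 P) w.2)

/-- The symplectic form `∑ dqᵃ ∧ dp_a`. -/
def sympForm (u v : Phase n) : ℝ := ∑ a, (u.1 a * v.2 a - v.1 a * u.2 a)

/-- `φ` preserves the symplectic form at every point of `W`. -/
def IsSymplecticOn (φ : Phase n → Phase n) (W : Set (Phase n)) : Prop :=
  ∀ z ∈ W, DifferentiableAt ℝ φ z ∧
    ∀ u v, sympForm (fderiv ℝ φ z u) (fderiv ℝ φ z v) = sympForm u v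

/-- The family `G(q, P; τ)` generates, for small `τ`, an exactly symplectic map that agrees, up to
an error `O(τ^{N+1})` that is uniform on compact sets, with the time `τ` flow of the Hamiltonian
`H(q, p; τ)`.

Near every compact set `K` of phase space and for all small `|τ|` it is required that
* the relations `p = ∂G/∂q`, `Q = ∂G/∂P` have exactly one solution `(Q, P)` with `‖P - p‖ < R`
  (for any prescribed `R`), namely `Φ τ (q, p)`, which is a smooth function of `(τ, q, p)`;
* `Φ τ` is symplectic;
* the Hamilton equations have a solution up to time `τ`, and every such solution ends within
  `C |τ|^{N+1}` of `Φ τ (q, p)`. -/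
def RealizesFlow (H : ℝ → Coord n → Coord n → ℝ) (G : ℝ → Coord n → Coord n → ℝ) (N : ℕ) : Prop :=
  ∀ K : Set (Phase n), IsCompact K → ∀ R : ℝ, 0 < R →
    ∃ (W : Set (Phase n)) (τ₀ C : ℝ) (Φ : ℝ → Phase n → Phase n),
      IsOpen W ∧ K ⊆ W ∧ 0 < τ₀ ∧
      ContDiffOn ℝ ∞ (fun x : ℝ × Phase n => Φ x.1 x.2) (Set.Ioo (-τ₀) τ₀ ×ˢ W) ∧
      ∀ τ : ℝ, |τ| < τ₀ →
        (∀ z ∈ W, ∀ w : Phase n,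
          (Generates (G τ) z w ∧ ‖w.2 - z.2‖ < R) ↔ w = Φ τ z) ∧
        IsSymplecticOn (Φ τ) W ∧
        (∀ z ∈ W, (∃ γ, IsHamSolution (H τ) τ z γ) ∧
          ∀ γ, IsHamSolution (H τ) τ z γ → ‖Φ τ z - γ τ‖ ≤ C * |τ| ^ (N + 1))

end MoveStep

end

/-! With `τ` frozen in T_eff, the move step is an autonomous Hamiltonian flow, which can be run over
the fraction θ ∈ [0, 1] of the step. A type 2 generating function F(τ, θ, q, P) of this family
equals q·P at θ = 0 and solves the Hamilton–Jacobi equation ∂F/∂θ = τ T_eff(q, ∂F/∂q; τ). The proof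
builds a truncated power series solution, shows that a small residual means a small error of the
map, and reads off G at θ = 1.

Series. Put F = q·P + θτ·½PᵃP_a + f. The kinetic energy is quadratic, so the equation becomes f' =
τ(Df + ½⟨f, f⟩ + Σ τ²ʲ T_{2j}(q, P + ∂f/∂q)), with ⟨f, g⟩ = ∂_a f ∂ᵃg. Since f = O(τ³), below order
τ⁹ only the first Taylor term of T_2 and T_4 in the momentum shift matters, and none of T_6. What
remains is a finite recursion. It is pure algebra (`BracketData`): D is a derivation of a symmetric
bracket, and the momentum derivatives that occur can be written as brackets. `G_five` to `G_eight`
identify its solution at θ = 1 with the given G_k; `sol_isBigO` and `residual_interpF_isBigO` bound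
the residual. The arbitrary higher terms of T_eff and G contribute only O(τ^{N+1}) to it.

Error. In `realizesFlow_of_residual`, u(s) is the map generated at fraction 1 - s applied to the
point reached by the flow after the fraction s. It joins the generated map (s = 0) to the exact flow
(s = 1). Its derivative involves only the gradient of the residual, so it is O(τ^{N+1}) on compact
sets. Solvability of p = ∂G/∂q is a contraction argument (`exists_smooth_solution`), and
symplecticity is the symmetry of the Hessian of F (`genMap_symplectic`).

Uniqueness. Two functions realizing the same flow generate maps that differ by O(τ^{N+1}), hence
have gradients that close along a curve converging to any prescribed point. Comparing powers of `τ`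
there makes all first derivatives of A_k - G_k vanish (`coeff_unique`). -/

noncomputable section

open Filter Topology Asymptotics

namespace MoveStep

/-! ### Smooth functions that vanish to a given order in the parameter -/

section

theorem two_le_infty : (2 : WithTop ℕ∞) ≤ ∞ := by
  exact WithTop.coe_le_coe.2 (le_top : (2 : ℕ∞) ≤ ⊤)

/-- By strong induction the Taylor polynomial of degree j reduces to its leading term. Both ψ and
the Taylor remainder are o(t^j), so this term is too, and its coefficient must vanish. -/
theorem iteratedDeriv_eq_zero_of_isBigO {ψ : ℝ → ℝ} (hψ : ContDiff ℝ ∞ ψ) {k : ℕ}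
    (h : ψ =O[𝓝 0] fun t => t ^ k) : ∀ j < k, iteratedDeriv j ψ 0 = 0 := by
  intro j
  induction j using Nat.strong_induction_on with
  | _ j ih =>
    intro hj
    have h1 := taylor_isLittleO_univ (n := j) (x₀ := 0) (hψ.of_le (mod_cast le_top))
    have h2 : ∀ x, taylorWithinEval ψ j Set.univ 0 x = ((j.factorial : ℝ)⁻¹ * x ^ j) * iteratedDeriv j ψ 0 := by
      intro x
      rw [taylor_within_apply, Finset.sum_range_succ, Finset.sum_eq_zero]
      · simp
      · intro i hi
        rw [Finset.mem_range] at hi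
        simp [ih i hi (hi.trans hj)]
    simp only [h2, sub_zero] at h1
    have h3 : ψ =o[𝓝 0] fun t : ℝ => t ^ j := h.trans_isLittleO (isLittleO_pow_pow hj)
    have h4 := h3.sub h1
    simp only [sub_sub_cancel] at h4
    by_contra hne
    have h5 : (fun t : ℝ => t ^ j) =o[𝓝 0] fun t : ℝ => t ^ j := by
      have h6 := h4.const_mul_left ((j.factorial : ℝ) * (iteratedDeriv j ψ 0)⁻¹)
      refine h6.congr_left fun t => ?_
      have : (j.factorial : ℝ) ≠ 0 := by positivity
      field_simp
    have h7 : ∃ᶠ t in 𝓝 (0 : ℝ), t ^ j ≠ 0 := by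
      have h8 : ∀ᶠ t in 𝓝[≠] (0 : ℝ), t ^ j ≠ 0 :=
        eventually_mem_nhdsWithin.mono fun t ht => pow_ne_zero j ht
      exact h8.frequently.filter_mono nhdsWithin_le_nhds
    exact (isLittleO_irrefl h7) h5

section
variable {Z : Type*} [NormedAddCommGroup Z] [NormedSpace ℝ Z]

/-- The derivative of `f` in the constant direction `v`. -/
def dirD {W : Type*} [NormedAddCommGroup W] [NormedSpace ℝ W] (v : W) (f : W → ℝ) : W → ℝ :=
  fun x => fderiv ℝ f x v

theorem contDiff_dirD {W : Type*} [NormedAddCommGroup W] [NormedSpace ℝ W] (v : W) {f : W → ℝ}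
    (hf : ContDiff ℝ ∞ f) : ContDiff ℝ ∞ (dirD v f) :=
  (hf.fderiv_right (m := ∞) (by simp)).clm_apply contDiff_const

theorem dirD_comm {W : Type*} [NormedAddCommGroup W] [NormedSpace ℝ W] (v w : W) {f : W → ℝ}
    (hf : ContDiff ℝ ∞ f) : dirD v (dirD w f) = dirD w (dirD v f) := by
  have key : ∀ v w : W, ∀ x, dirD v (dirD w f) x = fderiv ℝ (fderiv ℝ f) x v w := by
    intro v w x
    have hd : DifferentiableAt ℝ (fderiv ℝ f) x :=
      ((hf.fderiv_right (m := ∞) (by simp)).differentiable (by simp)) x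
    have h := (hd.hasFDerivAt.clm_apply (hasFDerivAt_const w x)).fderiv
    unfold dirD
    rw [h]
    simp
  funext x
  rw [key, key]
  exact (hf.contDiffAt.isSymmSndFDerivAt (by simpa using two_le_infty)).eq v w

theorem contDiff_dirD_iterate {W : Type*} [NormedAddCommGroup W] [NormedSpace ℝ W] (v : W)
    {f : W → ℝ} (hf : ContDiff ℝ ∞ f) (j : ℕ) : ContDiff ℝ ∞ ((dirD v)^[j] f) := by
  induction j with
  | zero => exact hf
  | succ j ih => rw [Function.iterate_succ_apply']; exact contDiff_dirD v ih

theorem hasDerivAt_dirD_fst {f : ℝ × Z → ℝ} (hf : ContDiff ℝ ∞ f) (t : ℝ) (z : Z) :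
    HasDerivAt (fun s => f (s, z)) (dirD ((1 : ℝ), (0 : Z)) f (t, z)) t := by
  have h1 : HasFDerivAt f (fderiv ℝ f (t, z)) (t, z) :=
    (hf.differentiable (by simp) (t, z)).hasFDerivAt
  have h2 : HasDerivAt (fun s : ℝ => (s, z)) ((1 : ℝ), (0 : Z)) t :=
    (hasDerivAt_id t).prodMk (hasDerivAt_const t z)
  exact h1.comp_hasDerivAt t h2

theorem iteratedDeriv_slice {f : ℝ × Z → ℝ} (hf : ContDiff ℝ ∞ f) (z : Z) (j : ℕ) :
    iteratedDeriv j (fun s => f (s, z)) = fun s => (dirD ((1 : ℝ), (0 : Z)))^[j] f (s, z) := by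
  induction j with
  | zero => simp
  | succ j ih =>
    rw [iteratedDeriv_succ, ih]
    funext s
    rw [Function.iterate_succ_apply']
    exact (hasDerivAt_dirD_fst (contDiff_dirD_iterate _ hf j) s z).deriv

/-- Induction on k: the parameter derivative of f vanishes to one order less, and the mean value
inequality between 0 and t returns a factor |t|. Compactness makes the constant uniform. -/
theorem exists_bound_of_vanish {C : Set Z} (hC : IsCompact C) (k : ℕ) :
    ∀ {f : ℝ × Z → ℝ}, ContDiff ℝ ∞ f →
      (∀ j < k, ∀ z, (dirD ((1 : ℝ), (0 : Z)))^[j] f (0, z) = 0) →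
      ∃ c : ℝ, 0 ≤ c ∧ ∀ t z, |t| ≤ 1 → z ∈ C → |f (t, z)| ≤ c * |t| ^ k := by
  induction k with
  | zero =>
    intro f hf _
    have hK : IsCompact (Set.Icc (-1 : ℝ) 1 ×ˢ C) := isCompact_Icc.prod hC
    obtain ⟨c, hc⟩ := hK.exists_bound_of_continuousOn hf.continuous.continuousOn
    refine ⟨max c 0, le_max_right _ _, fun t z ht hz => ?_⟩
    rw [pow_zero, mul_one]
    exact (hc (t, z) ⟨abs_le.1 ht, hz⟩).trans (le_max_left _ _)
  | succ k ih =>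
    intro f hf h
    obtain ⟨c, hc0, hc⟩ := ih (contDiff_dirD ((1 : ℝ), (0 : Z)) hf) (fun j hj z => by
      rw [← Function.iterate_succ_apply]
      exact h (j + 1) (by omega) z)
    refine ⟨c, hc0, fun t z ht hz => ?_⟩
    have h0 : f (0, z) = 0 := h 0 (by omega) z
    have hconv : Convex ℝ (Set.uIcc 0 t) := convex_uIcc 0 t
    have hb : ∀ x ∈ Set.uIcc 0 t, ‖dirD ((1 : ℝ), (0 : Z)) f (x, z)‖ ≤ c * |t| ^ k := by
      intro x hx
      have hx' : |x| ≤ |t| := by simpa using Set.abs_sub_left_of_mem_uIcc hx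
      exact (hc x z (hx'.trans ht) hz).trans (by gcongr)
    have := hconv.norm_image_sub_le_of_norm_hasDerivWithin_le
      (f := fun s => f (s, z)) (fun x _ => (hasDerivAt_dirD_fst hf x z).hasDerivWithinAt)
      hb Set.left_mem_uIcc Set.right_mem_uIcc
    simp only [h0, sub_zero, Real.norm_eq_abs] at this
    rw [pow_succ, ← mul_assoc]
    exact this

/-- If a smooth function of `(τ, z)` is `O(τᵏ)` for every fixed `z`, then so are its derivatives
in the directions of `z`, uniformly on compact sets. -/
theorem exists_bound_dirD_of_isBigO {C : Set Z} (hC : IsCompact C) {k : ℕ} {f : ℝ × Z → ℝ}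
    (hf : ContDiff ℝ ∞ f) (h : ∀ z, (fun t => f (t, z)) =O[𝓝 0] fun t => t ^ k) (v : Z) :
    ∃ c : ℝ, 0 ≤ c ∧ ∀ t z, |t| ≤ 1 → z ∈ C →
      |dirD ((0 : ℝ), v) f (t, z)| ≤ c * |t| ^ k := by
  refine exists_bound_of_vanish hC k (contDiff_dirD _ hf) fun j hj z => ?_
  -- The hypothesis is only pointwise in z. It makes the parameter derivatives of order below k
  -- vanish at `τ = 0` for every z, so their z-derivatives vanish there as well, and commuting the
  -- two derivatives gives what `exists_bound_of_vanish` needs.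
  have hcomm : ∀ j, (dirD ((1 : ℝ), (0 : Z)))^[j] (dirD ((0 : ℝ), v) f)
      = dirD ((0 : ℝ), v) ((dirD ((1 : ℝ), (0 : Z)))^[j] f) := by
    intro j
    induction j with
    | zero => rfl
    | succ j ih =>
      rw [Function.iterate_succ_apply', ih, Function.iterate_succ_apply',
        dirD_comm _ _ (contDiff_dirD_iterate _ hf j)]
  have hv : ∀ z, (dirD ((1 : ℝ), (0 : Z)))^[j] f (0, z) = 0 := by
    intro z
    have hs : ContDiff ℝ ∞ fun s => f (s, z) := hf.comp (contDiff_id.prodMk contDiff_const)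
    have := iteratedDeriv_eq_zero_of_isBigO hs (h z) j hj
    rwa [iteratedDeriv_slice hf] at this
  rw [hcomm]
  set g := (dirD ((1 : ℝ), (0 : Z)))^[j] f with hg
  have hgs : ContDiff ℝ ∞ g := contDiff_dirD_iterate _ hf j
  have h1 : HasFDerivAt g (fderiv ℝ g (0, z)) (0, z) :=
    (hgs.differentiable (by simp) _).hasFDerivAt
  have h2 : HasFDerivAt (fun y : Z => ((0 : ℝ), y)) (ContinuousLinearMap.inr ℝ ℝ Z) z :=
    (ContinuousLinearMap.inr ℝ ℝ Z).hasFDerivAt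
  have h3 := HasFDerivAt.comp z h1 h2
  have h4 : (g ∘ fun y : Z => ((0 : ℝ), y)) = fun _ => 0 := funext hv
  rw [h4] at h3
  have h5 := h3.unique (hasFDerivAt_const (0 : ℝ) z)
  have := congrArg (fun L => L v) h5
  simpa [dirD] using this

end

end

/-! ### Solving the implicit relation for the new momentum -/

section

theorem exists_norm_fderiv_le {Y F : Type*} [NormedAddCommGroup Y] [NormedSpace ℝ Y]
    [NormedAddCommGroup F] [NormedSpace ℝ F] {f : Y → F} (hf : ContDiff ℝ ∞ f) {C : Set Y}
    (hC : IsCompact C) :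
    ∃ L : ℝ, 0 ≤ L ∧ ∀ x ∈ C, ‖f x‖ ≤ L ∧ ‖fderiv ℝ f x‖ ≤ L := by
  obtain ⟨a, ha⟩ := hC.exists_bound_of_continuousOn hf.continuous.continuousOn
  obtain ⟨b, hb⟩ := hC.exists_bound_of_continuousOn (hf.continuous_fderiv (by simp)).continuousOn
  refine ⟨max 0 (max a b), le_max_left _ _, fun x hx => ⟨(ha x hx).trans ?_, (hb x hx).trans ?_⟩⟩
  · exact (le_max_left _ _).trans (le_max_right _ _)
  · exact (le_max_right _ _).trans (le_max_right _ _)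

theorem fderiv_slice_right {A E : Type*} [NormedAddCommGroup A] [NormedSpace ℝ A]
    [NormedAddCommGroup E] [NormedSpace ℝ E] {h : ℝ × A × E → E} (hh : ContDiff ℝ ∞ h) (τ : ℝ) (a : A) (P v : E) :
    fderiv ℝ (fun P => h (τ, a, P)) P v = fderiv ℝ h (τ, a, P) (0, 0, v) := by
  have h1 : HasFDerivAt h (fderiv ℝ h (τ, a, P)) (τ, a, P) :=
    (hh.differentiable (by simp) _).hasFDerivAt
  have h2 : HasFDerivAt (fun P : E => (τ, a, P))
      ((0 : E →L[ℝ] ℝ).prod ((0 : E →L[ℝ] A).prod (ContinuousLinearMap.id ℝ E))) P :=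
    (hasFDerivAt_const _ _).prodMk ((hasFDerivAt_const _ _).prodMk (hasFDerivAt_id P))
  have := (HasFDerivAt.comp P h1 h2).fderiv
  rw [Function.comp_def] at this
  rw [this]
  simp

section
variable {A E : Type*} [NormedAddCommGroup A] [NormedSpace ℝ A] [FiniteDimensional ℝ A]
  [NormedAddCommGroup E] [NormedSpace ℝ E] [FiniteDimensional ℝ E]

/-- The equation `P + τ h(τ, a, P) = p` has, for small `τ`, a unique solution `P` close to `p`,
and this solution is a smooth function of `(τ, a, p)`. -/
theorem exists_smooth_solution {h : ℝ × A × E → E} (hh : ContDiff ℝ ∞ h) {K : Set (A × E)}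
    (hK : IsCompact K) {R : ℝ} (hR : 0 < R) :
    ∃ (τ₀ : ℝ) (π : ℝ × A × E → E), 0 < τ₀ ∧ τ₀ ≤ 1 ∧
      ContDiffOn ℝ ∞ π (Set.Ioo (-τ₀) τ₀ ×ˢ interior K) ∧
      (∀ τ : ℝ, |τ| < τ₀ → ∀ a p, (a, p) ∈ K → ∀ P,
        (P + τ • h (τ, a, P) = p ∧ ‖P - p‖ < R) ↔ P = π (τ, a, p)) ∧
      (∀ τ : ℝ, |τ| < τ₀ → ∀ a p, (a, p) ∈ K → ∀ P, ‖P - p‖ < R → ∀ v : E,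
        ‖v‖ ≤ 2 * ‖v + τ • fderiv ℝ h (τ, a, P) (0, 0, v)‖) := by
  -- a compact set that contains all the points at which `h` is used
  obtain ⟨r, hr⟩ := hK.isBounded.subset_closedBall 0
  set ρ : ℝ := max 1 (r + R) with hρ
  have hρ1 : 1 ≤ ρ := le_max_left _ _
  have hρ2 : r + R ≤ ρ := le_max_right _ _
  have hC : IsCompact (Metric.closedBall (0 : ℝ × A × E) ρ) := isCompact_closedBall _ _
  obtain ⟨L, hL0, hL⟩ := exists_norm_fderiv_le hh hC
  have hmem : ∀ τ : ℝ, |τ| < 1 → ∀ a p, (a, p) ∈ K → ∀ P, ‖P - p‖ ≤ R →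
      (τ, a, P) ∈ Metric.closedBall (0 : ℝ × A × E) ρ := by
    intro τ hτ a p hap P hP
    have h1 : ‖(a, p)‖ ≤ r := by simpa using hr hap
    have ha : ‖a‖ ≤ r := (norm_fst_le (a, p)).trans h1
    have hp : ‖p‖ ≤ r := (norm_snd_le (a, p)).trans h1
    have hP' : ‖P‖ ≤ r + R := by
      calc ‖P‖ = ‖p + (P - p)‖ := by abel_nf
        _ ≤ ‖p‖ + ‖P - p‖ := norm_add_le _ _
        _ ≤ r + R := by linarith
    rw [mem_closedBall_zero_iff]
    refine max_le ?_ (max_le ?_ ?_)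
    · exact (Real.norm_eq_abs τ ▸ hτ.le).trans hρ1
    · exact ha.trans (by linarith)
    · exact hP'.trans hρ2
  -- Chosen so that |τ| L ≤ 1/2, which makes the iteration a contraction, and |τ| L ≤ R/4, which
  -- keeps it in a ball of radius R/2.
  set τ₀ : ℝ := min 1 (min 1 (R / 4) / (2 * (L + 1))) with hτ₀
  have hτ₀pos : 0 < τ₀ := by positivity
  have hτ₀1 : τ₀ ≤ 1 := min_le_left _ _
  have hτL : ∀ τ : ℝ, |τ| < τ₀ → |τ| * L ≤ 1 / 2 ∧ |τ| * L ≤ R / 4 := by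
    intro τ hτ
    have h1 : |τ| ≤ min 1 (R / 4) / (2 * (L + 1)) := hτ.le.trans (min_le_right _ _)
    rw [le_div_iff₀ (by positivity)] at h1
    have h2 : min 1 (R / 4) ≤ 1 := min_le_left _ _
    have h3 : min 1 (R / 4) ≤ R / 4 := min_le_right _ _
    have h4 : 0 ≤ |τ| := abs_nonneg τ
    constructor <;> nlinarith [mul_nonneg h4 hL0]
  have hbound : ∀ τ : ℝ, |τ| < τ₀ → ∀ a p, (a, p) ∈ K → ∀ P, ‖P - p‖ ≤ R →
      ‖τ • h (τ, a, P)‖ ≤ R / 4 := by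
    intro τ hτ a p hap P hP
    have := (hL _ (hmem τ (hτ.trans_le hτ₀1) a p hap P hP)).1
    rw [norm_smul, Real.norm_eq_abs]
    exact (by gcongr : |τ| * ‖h (τ, a, P)‖ ≤ |τ| * L).trans (hτL τ hτ).2
  have hlip : ∀ τ : ℝ, |τ| < τ₀ → ∀ a p, (a, p) ∈ K → ∀ P P', ‖P - p‖ ≤ R → ‖P' - p‖ ≤ R →
      ‖τ • h (τ, a, P) - τ • h (τ, a, P')‖ ≤ 1 / 2 * ‖P - P'‖ := by
    intro τ hτ a p hap P P' hP hP'
    have hd : ∀ x ∈ Metric.closedBall p R,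
        DifferentiableAt ℝ (fun P => h (τ, a, P)) x := fun x _ =>
      ((hh.comp (contDiff_const.prodMk (contDiff_const.prodMk contDiff_id))).differentiable
        (by simp)) x
    have hb : ∀ x ∈ Metric.closedBall p R, ‖fderiv ℝ (fun P => h (τ, a, P)) x‖ ≤ L := by
      intro x hx
      refine ContinuousLinearMap.opNorm_le_bound _ hL0 fun v => ?_
      rw [fderiv_slice_right hh]
      have h1 := (hL _ (hmem τ (hτ.trans_le hτ₀1) a p hap x (by simpa [dist_eq_norm] using hx))).2
      refine (ContinuousLinearMap.le_opNorm _ _).trans ?_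
      have h2 : ‖((0 : ℝ), (0 : A), v)‖ = ‖v‖ := by simp [Prod.norm_def]
      rw [h2]
      gcongr
    have h1 := (convex_closedBall p R).norm_image_sub_le_of_norm_fderiv_le hd hb
      (x := P') (y := P) (by simpa [dist_eq_norm] using hP') (by simpa [dist_eq_norm] using hP)
    rw [← smul_sub, norm_smul, Real.norm_eq_abs]
    calc |τ| * ‖h (τ, a, P) - h (τ, a, P')‖ ≤ |τ| * (L * ‖P - P'‖) := by gcongr
      _ = (|τ| * L) * ‖P - P'‖ := by ring
      _ ≤ 1 / 2 * ‖P - P'‖ := by gcongr; exact (hτL τ hτ).1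
  have huniq : ∀ τ : ℝ, |τ| < τ₀ → ∀ a p, (a, p) ∈ K → ∀ P P', ‖P - p‖ ≤ R → ‖P' - p‖ ≤ R →
      P + τ • h (τ, a, P) = p → P' + τ • h (τ, a, P') = p → P = P' := by
    intro τ hτ a p hap P P' hP hP' h1 h2
    have h3 := hlip τ hτ a p hap P P' hP hP'
    have h4 : P - P' = -(τ • h (τ, a, P) - τ • h (τ, a, P')) := by
      have := h1.trans h2.symm
      rw [← sub_eq_zero] at this ⊢
      rw [← this]; abel
    have h5 : ‖P - P'‖ ≤ 1 / 2 * ‖P - P'‖ := by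
      conv_lhs => rw [h4, norm_neg]
      exact h3
    have : ‖P - P'‖ = 0 := by linarith [norm_nonneg (P - P')]
    exact sub_eq_zero.1 (norm_eq_zero.1 this)
  have hex : ∀ τ : ℝ, |τ| < τ₀ → ∀ a p, (a, p) ∈ K → ∃ P, ‖P - p‖ < R ∧
      P + τ • h (τ, a, P) = p := by
    intro τ hτ a p hap
    -- Solutions are the fixed points of f. The contraction principle is applied on the closed ball
    -- of radius R/2, which leaves the strict inequality ‖P - p‖ < R.
    set f : E → E := fun P => p - τ • h (τ, a, P) with hf
    have hmaps : Set.MapsTo f (Metric.closedBall p (R / 2)) (Metric.closedBall p (R / 2)) := by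
      intro x hx
      rw [mem_closedBall_iff_norm] at hx ⊢
      have := hbound τ hτ a p hap x (by linarith)
      simp only [hf, sub_sub_cancel_left, norm_neg]
      linarith
    have hcontr : ContractingWith (1 / 2) (hmaps.restrict f _ _) := by
      refine ⟨by rw [← NNReal.coe_lt_coe]; norm_num, LipschitzWith.of_dist_le_mul ?_⟩
      rintro ⟨x, hx⟩ ⟨y, hy⟩
      rw [mem_closedBall_iff_norm] at hx hy
      have h1 := hlip τ hτ a p hap x y (by linarith) (by linarith)
      rw [Subtype.dist_eq, Subtype.dist_eq]
      simp only [Set.MapsTo.val_restrict_apply, hf, dist_eq_norm, NNReal.coe_div, NNReal.coe_one,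
        NNReal.coe_ofNat, sub_sub_sub_cancel_left]
      rw [norm_sub_rev]
      exact h1
    obtain ⟨P, hP, hfix, -⟩ := hcontr.exists_fixedPoint'
      Metric.isClosed_closedBall.isComplete hmaps
      (Metric.mem_closedBall_self (by positivity)) (edist_ne_top _ _)
    rw [mem_closedBall_iff_norm] at hP
    refine ⟨P, by linarith, ?_⟩
    have : p - τ • h (τ, a, P) = P := hfix
    nth_rewrite 1 [← this]
    abel
  have hinv : ∀ τ : ℝ, |τ| < τ₀ → ∀ a p, (a, p) ∈ K → ∀ P, ‖P - p‖ < R → ∀ v : E,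
        ‖v‖ ≤ 2 * ‖v + τ • fderiv ℝ h (τ, a, P) (0, 0, v)‖ := by
    intro τ hτ a p hap P hP v
    have h1 := (hL _ (hmem τ (hτ.trans_le hτ₀1) a p hap P hP.le)).2
    have h2 : ‖((0 : ℝ), (0 : A), v)‖ = ‖v‖ := by simp [Prod.norm_def]
    have h3 : ‖τ • fderiv ℝ h (τ, a, P) (0, 0, v)‖ ≤ 1 / 2 * ‖v‖ := by
      rw [norm_smul, Real.norm_eq_abs]
      calc |τ| * ‖fderiv ℝ h (τ, a, P) (0, 0, v)‖ ≤ |τ| * (L * ‖v‖) := by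
            gcongr
            refine (ContinuousLinearMap.le_opNorm _ _).trans ?_
            rw [h2]
            gcongr
        _ = (|τ| * L) * ‖v‖ := by ring
        _ ≤ 1 / 2 * ‖v‖ := by gcongr; exact (hτL τ hτ).1
    have h4 := norm_sub_le (v + τ • fderiv ℝ h (τ, a, P) (0, 0, v))
      (τ • fderiv ℝ h (τ, a, P) (0, 0, v))
    rw [add_sub_cancel_right] at h4
    linarith
  classical
  let π : ℝ × A × E → E := fun x =>
    if hx : |x.1| < τ₀ ∧ (x.2.1, x.2.2) ∈ K then (hex x.1 hx.1 x.2.1 x.2.2 hx.2).choose else 0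
  have hπ : ∀ τ : ℝ, |τ| < τ₀ → ∀ a p, (a, p) ∈ K → ‖π (τ, a, p) - p‖ < R ∧
      π (τ, a, p) + τ • h (τ, a, π (τ, a, p)) = p := by
    intro τ hτ a p hap
    have : π (τ, a, p) = (hex τ hτ a p hap).choose := dif_pos ⟨hτ, hap⟩
    rw [this]
    exact (hex τ hτ a p hap).choose_spec
  have hiff : ∀ τ : ℝ, |τ| < τ₀ → ∀ a p, (a, p) ∈ K → ∀ P,
        (P + τ • h (τ, a, P) = p ∧ ‖P - p‖ < R) ↔ P = π (τ, a, p) := by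
    intro τ hτ a p hap P
    obtain ⟨h1, h2⟩ := hπ τ hτ a p hap
    constructor
    · rintro ⟨h3, h4⟩
      exact huniq τ hτ a p hap _ _ h4.le h1.le h3 h2
    · rintro rfl
      exact ⟨h2, h1⟩
  refine ⟨τ₀, π, hτ₀pos, hτ₀1, ?_, hiff, hinv⟩
  rintro ⟨τ, a, p⟩ ⟨hτ, hap⟩
  refine ContDiffAt.contDiffWithinAt ?_
  have hτ' : |τ| < τ₀ := abs_lt.2 hτ
  have hapK : (a, p) ∈ K := interior_subset hap
  obtain ⟨hP1, hP2⟩ := hπ τ hτ' a p hapK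
  set P := π (τ, a, p) with hPdef
  -- Keeping `τ` and a as components turns the implicit equation into an inverse function problem:
  -- the derivative of Ψ is injective by `hinv`, hence invertible in finite dimension.
  let Ψ : ℝ × A × E → ℝ × A × E := fun x => (x.1, x.2.1, x.2.2 + x.1 • h x)
  have hΨ : ContDiff ℝ ∞ Ψ := by fun_prop
  have hΨP : Ψ (τ, a, P) = (τ, a, p) := by simp only [Ψ, hP2]
  have hdΨ : HasFDerivAt Ψ (fderiv ℝ Ψ (τ, a, P)) (τ, a, P) :=
    (hΨ.differentiable (by simp) _).hasFDerivAt
  have hval : ∀ v : ℝ × A × E, fderiv ℝ Ψ (τ, a, P) v =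
      (v.1, v.2.1, v.2.2 + (τ • fderiv ℝ h (τ, a, P) v + v.1 • h (τ, a, P))) := by
    intro v
    have h1 : HasFDerivAt h (fderiv ℝ h (τ, a, P)) (τ, a, P) :=
      (hh.differentiable (by simp) _).hasFDerivAt
    have h2 : HasFDerivAt (fun x : ℝ × A × E => x.2) (ContinuousLinearMap.snd ℝ ℝ (A × E))
      (τ, a, P) := hasFDerivAt_snd
    have h3 := (hasFDerivAt_fst (𝕜 := ℝ) (p := (τ, a, P))).prodMk
      (h2.fst.prodMk (h2.snd.add ((hasFDerivAt_fst (𝕜 := ℝ) (p := (τ, a, P))).smul h1)))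
    have h4 := hdΨ.unique h3
    rw [h4]
    simp
  have hinj : Function.Injective (fderiv ℝ Ψ (τ, a, P)) := by
    rw [injective_iff_map_eq_zero]
    rintro ⟨s, b, v⟩ hv
    rw [hval] at hv
    simp only [Prod.mk_eq_zero] at hv
    obtain ⟨rfl, rfl, hv⟩ := hv
    rw [zero_smul, add_zero] at hv
    have h1 := hinv τ hτ' a p hapK P hP1 v
    rw [hv, norm_zero, mul_zero] at h1
    have : v = 0 := norm_eq_zero.1 (le_antisymm h1 (norm_nonneg _))
    simp [this]
  let e : (ℝ × A × E) ≃L[ℝ] (ℝ × A × E) :=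
    (LinearEquiv.ofInjectiveEndo (fderiv ℝ Ψ (τ, a, P)).toLinearMap hinj).toContinuousLinearEquiv
  have he : (e : (ℝ × A × E) →L[ℝ] (ℝ × A × E)) = fderiv ℝ Ψ (τ, a, P) := by
    rw [ContinuousLinearMap.ext_iff]
    intro v
    rfl
  have hdΨ' : HasFDerivAt Ψ (e : (ℝ × A × E) →L[ℝ] (ℝ × A × E)) (τ, a, P) := he ▸ hdΨ
  have hs := hΨ.contDiffAt.to_localInverse hdΨ' (by simp)
  have hst := hΨ.contDiffAt.hasStrictFDerivAt' hdΨ' (by simp)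
  rw [hΨP] at hs
  set ι := hΨ.contDiffAt.localInverse hdΨ' (by simp : (∞ : WithTop ℕ∞) ≠ 0) with hι
  have hι0 : ι (τ, a, p) = (τ, a, P) := by
    have := hΨ.contDiffAt.localInverse_apply_image hdΨ' (by simp : (∞ : WithTop ℕ∞) ≠ 0)
    rwa [hΨP] at this
  have hright : ∀ᶠ y in 𝓝 (τ, a, p), Ψ (ι y) = y := by
    have := hst.eventually_right_inverse
    rw [hΨP] at this
    exact this
  have hclose : ∀ᶠ y in 𝓝 (τ, a, p), ‖(ι y).2.2 - y.2.2‖ < R := by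
    have hc : ContinuousAt (fun y : ℝ × A × E => ‖(ι y).2.2 - y.2.2‖) (τ, a, p) := by
      have := hs.continuousAt
      fun_prop
    refine hc.eventually (gt_mem_nhds ?_)
    simp only [hι0]
    exact hP1
  have hnear : ∀ᶠ y in 𝓝 (τ, a, p), |y.1| < τ₀ ∧ (y.2.1, y.2.2) ∈ K := by
    have : Set.Ioo (-τ₀) τ₀ ×ˢ interior K ∈ 𝓝 (τ, a, p) :=
      (isOpen_Ioo.prod isOpen_interior).mem_nhds ⟨hτ, hap⟩
    filter_upwards [this] with y hy
    exact ⟨abs_lt.2 hy.1, interior_subset hy.2⟩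
  -- The local inverse solves the same equation close to p, so uniqueness identifies it with π,
  -- which thereby inherits its smoothness.
  have heq : π =ᶠ[𝓝 (τ, a, p)] fun y => (ι y).2.2 := by
    filter_upwards [hright, hclose, hnear] with y h1 h2 h3
    have h4 : (ι y).1 = y.1 := congrArg (fun w => w.1) h1
    have h5 : (ι y).2.1 = y.2.1 := congrArg (fun w => w.2.1) h1
    have h6 : (ι y).2.2 + (ι y).1 • h (ι y) = y.2.2 := congrArg (fun w => w.2.2) h1
    have h7 : ι y = (y.1, y.2.1, (ι y).2.2) := by rw [← h4, ← h5]
    symm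
    refine (hiff y.1 h3.1 y.2.1 y.2.2 h3.2 _).1 ⟨?_, h2⟩
    rw [← h7, ← h4]
    exact h6
  exact ContDiffAt.congr_of_eventuallyEq (contDiffAt_snd.comp _ (contDiffAt_snd.comp _ hs)) heq

end

end

/-! ### Short-time existence and confinement of the flow -/

section

section
variable {Y : Type*} [NormedAddCommGroup Y] [NormedSpace ℝ Y]

/-- Rescaling time to [0, 1] treats both signs of `τ` at once. -/
theorem hasDerivWithinAt_rescale {v : ℝ → Y} {γ : ℝ → Y} {τ : ℝ}
    (h : ∀ t ∈ Set.uIcc 0 τ, HasDerivWithinAt γ (v t) (Set.uIcc 0 τ) t) :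
    ∀ s ∈ Set.Icc (0 : ℝ) 1,
      HasDerivWithinAt (fun s => γ (τ * s)) (τ • v (τ * s)) (Set.Icc 0 1) s := by
  have hmaps : Set.MapsTo (fun s : ℝ => τ * s) (Set.Icc 0 1) (Set.uIcc 0 τ) := by
    intro s hs
    rcases le_total 0 τ with h0 | h0
    · rw [Set.uIcc_of_le h0]
      exact ⟨mul_nonneg h0 hs.1, mul_le_of_le_one_right h0 hs.2⟩
    · rw [Set.uIcc_of_ge h0]
      exact ⟨by nlinarith [hs.2], mul_nonpos_of_nonpos_of_nonneg h0 hs.1⟩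
  intro s hs
  have h1 : HasDerivWithinAt (fun s : ℝ => τ * s) τ (Set.Icc 0 1) s := by
    simpa using (hasDerivWithinAt_id s (Set.Icc 0 1)).const_mul τ
  exact (h (τ * s) (hmaps hs)).scomp s h1 hmaps

theorem hasDerivWithinAt_Ici_of_Icc {γ : ℝ → Y} {v : Y} {s : ℝ} (hs : s ∈ Set.Ico (0 : ℝ) 1)
    (h : HasDerivWithinAt γ v (Set.Icc 0 1) s) : HasDerivWithinAt γ v (Set.Ici s) s :=
  h.mono_of_mem_nhdsWithin (Icc_mem_nhdsGE_of_mem hs)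

/-- For small `τ`, the autonomous equation `γ' = X(τ, γ)` can be solved up to time `τ`, and its
solutions stay within distance `1` of the initial point, uniformly on compact sets. -/
theorem exists_solution_of_small [FiniteDimensional ℝ Y] {X : ℝ × Y → Y} (hX : ContDiff ℝ ∞ X)
    {K : Set Y} (hK : IsCompact K) :
    ∃ τ₀ : ℝ, 0 < τ₀ ∧ ∀ τ : ℝ, |τ| < τ₀ → ∀ z ∈ K,
      (∃ γ : ℝ → Y, γ 0 = z ∧
        ∀ t ∈ Set.uIcc 0 τ, HasDerivWithinAt γ (X (τ, γ t)) (Set.uIcc 0 τ) t) ∧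
      ∀ γ : ℝ → Y, γ 0 = z →
        (∀ t ∈ Set.uIcc 0 τ, HasDerivWithinAt γ (X (τ, γ t)) (Set.uIcc 0 τ) t) →
        ∀ s ∈ Set.Icc (0 : ℝ) 1, ‖γ (τ * s) - z‖ ≤ 1 := by
  obtain ⟨b, hb0, hb⟩ := exists_norm_fderiv_le hX
    ((isCompact_Icc (a := (-1 : ℝ)) (b := 1)).prod (hK.cthickening (r := 1)))
  lift b to NNReal using hb0
  have hb0 : (0 : ℝ) ≤ b := b.2
  -- This gives |τ| b < 1: with speed at most b, a solution cannot cover the distance 1 within the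
  -- time |τ|.
  refine ⟨min 1 (1 / (b + 1)), by positivity, fun τ hτ z hz => ?_⟩
  have hτ1 : |τ| ≤ 1 := hτ.le.trans (min_le_left _ _)
  have hτb : |τ| * (b + 1) < 1 := by
    rw [← lt_div_iff₀ (by positivity)]
    exact hτ.trans_le (min_le_right _ _)
  have hτb' : |τ| * b < 1 := by nlinarith [abs_nonneg τ]
  have hball : ∀ x ∈ Metric.closedBall z 1, ‖X (τ, x)‖ ≤ b ∧ ‖fderiv ℝ X (τ, x)‖ ≤ b :=
    fun x hx => hb (τ, x) ⟨abs_le.1 hτ1, Metric.closedBall_subset_cthickening hz 1 hx⟩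
  constructor
  · have hlip : LipschitzOnWith b (fun x => X (τ, x)) (Metric.closedBall z 1) := by
      refine (convex_closedBall z 1).lipschitzOnWith_of_nnnorm_hasFDerivWithin_le
        (f' := fun x => (fderiv ℝ X (τ, x)).comp (ContinuousLinearMap.inr ℝ ℝ Y)) ?_ ?_
      · intro x _
        have h1 : HasFDerivAt X (fderiv ℝ X (τ, x)) (τ, x) :=
          (hX.differentiable (by simp) _).hasFDerivAt
        have h2 : HasFDerivAt (fun x : Y => (τ, x)) (ContinuousLinearMap.inr ℝ ℝ Y) x :=
          hasFDerivAt_prodMk_right τ x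
        exact (h1.comp x h2).hasFDerivWithinAt
      · intro x hx
        rw [← NNReal.coe_le_coe]
        refine ContinuousLinearMap.opNorm_le_bound _ hb0 fun v => ?_
        have h2 : ‖((0 : ℝ), v)‖ = ‖v‖ := by simp [Prod.norm_def]
        have h3 := (fderiv ℝ X (τ, x)).le_opNorm (0, v)
        rw [h2] at h3
        exact h3.trans (by gcongr; exact (hball x hx).2)
    have hpl : IsPicardLindelof (fun _ x => X (τ, x))
        (⟨0, by simp⟩ : Set.Icc (-|τ|) |τ|) z 1 0 b b :=
      { lipschitzOnWith := fun _ _ => hlip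
        continuousOn := fun _ _ => continuousOn_const
        norm_le := fun _ _ x hx => (hball x hx).1
        mul_max_le := by
          simp only [sub_zero, zero_sub, neg_neg, max_self, NNReal.coe_one,
            NNReal.coe_zero]
          linarith }
    obtain ⟨γ, hγ0, hγ⟩ := hpl.exists_eq_forall_mem_Icc_hasDerivWithinAt₀
    have hsub : Set.uIcc 0 τ ⊆ Set.Icc (-|τ|) |τ| := by
      intro t ht
      have : |t| ≤ |τ| := by simpa using Set.abs_sub_left_of_mem_uIcc ht
      exact abs_le.1 this
    exact ⟨γ, hγ0, fun t ht => (hγ t (hsub ht)).mono hsub⟩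
  · intro γ hγ0 hγ
    have hres := hasDerivWithinAt_rescale hγ
    -- Barrier argument: when the distance from z equals s < 1, the point is still in the unit ball,
    -- where the rescaled speed is less than 1, the slope of the barrier.
    have hmain : ∀ s ∈ Set.Icc (0 : ℝ) 1, ‖γ (τ * s) - z‖ ≤ s := by
      refine image_norm_le_of_norm_deriv_right_lt_deriv_boundary (B := fun s => s)
        (B' := fun _ => 1) (f := fun s => γ (τ * s) - z)
        (f' := fun s => τ • X (τ, γ (τ * s))) ?_ ?_ ?_ ?_ ?_
      · exact fun s hs => ((hres s hs).continuousWithinAt).sub continuousWithinAt_const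
      · intro s hs
        exact (hasDerivWithinAt_Ici_of_Icc hs (hres s (Set.Ico_subset_Icc_self hs))).sub_const z
      · simp [hγ0]
      · exact fun x => hasDerivAt_id x
      · intro s hs hs'
        have h1 := (hball (γ (τ * s)) (by
          rw [mem_closedBall_iff_norm, hs']
          exact hs.2.le)).1
        rw [norm_smul, Real.norm_eq_abs]
        exact (by gcongr : |τ| * ‖X (τ, γ (τ * s))‖ ≤ |τ| * b).trans_lt hτb'
    exact fun s hs => (hmain s hs).trans hs.2

end

end

/-! ### Maps given by generating functions, and the Hamilton–Jacobi residual -/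

section

variable {n : ℕ}

/-- Points `(τ, (θ, q), P)`: the time step, the fraction of the step, and the two arguments of a
generating function. -/
abbrev Ext (n : ℕ) : Type := ℝ × (ℝ × Coord n) × Coord n

/-- The direction of the fraction `θ`. -/
def dirT : Ext n := (0, (1, 0), 0)

/-- A direction in the positions. -/
def dirQ (v : Coord n) : Ext n := (0, (0, v), 0)

/-- A direction in the momenta. -/
def dirP (v : Coord n) : Ext n := (0, (0, 0), v)

/-- The unit vector along a coordinate. -/
def unitV (a : Fin n) : Coord n := Pi.single a 1

/-- The gradient in the positions. -/
def gradQ (F : Ext n → ℝ) (x : Ext n) : Coord n := fun a => dirD (dirQ (unitV a)) F x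

/-- The gradient in the momenta. -/
def gradP (F : Ext n → ℝ) (x : Ext n) : Coord n := fun a => dirD (dirP (unitV a)) F x

theorem contDiff_gradQ {F : Ext n → ℝ} (hF : ContDiff ℝ ∞ F) : ContDiff ℝ ∞ (gradQ F) :=
  contDiff_pi.2 fun _ => contDiff_dirD _ hF

theorem contDiff_gradP {F : Ext n → ℝ} (hF : ContDiff ℝ ∞ F) : ContDiff ℝ ∞ (gradP F) :=
  contDiff_pi.2 fun _ => contDiff_dirD _ hF

theorem pd_eq_of_comp {W : Type*} [NormedAddCommGroup W] [NormedSpace ℝ W] {F : W → ℝ}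
    (hF : ContDiff ℝ ∞ F) {ι : Coord n → W} {L : Coord n →L[ℝ] W} {x : Coord n}
    (hι : HasFDerivAt ι L x) (a : Fin n) :
    pd a (fun q => F (ι q)) x = dirD (L (unitV a)) F (ι x) := by
  have h1 : HasFDerivAt F (fderiv ℝ F (ι x)) (ι x) :=
    (hF.differentiable (by simp) _).hasFDerivAt
  have h2 := (HasFDerivAt.comp x h1 hι).fderiv
  rw [Function.comp_def] at h2
  unfold pd
  rw [h2]
  rfl

theorem pd_slice_Q {F : Ext n → ℝ} (hF : ContDiff ℝ ∞ F) (τ θ : ℝ) (q P : Coord n) (a : Fin n) :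
    pd a (fun q => F (τ, (θ, q), P)) q = gradQ F (τ, (θ, q), P) a := by
  have h : HasFDerivAt (fun q : Coord n => (τ, (θ, q), P))
      ((0 : Coord n →L[ℝ] ℝ).prod (((0 : Coord n →L[ℝ] ℝ).prod
        (ContinuousLinearMap.id ℝ (Coord n))).prod (0 : Coord n →L[ℝ] Coord n))) q :=
    (hasFDerivAt_const _ _).prodMk
      (((hasFDerivAt_const _ _).prodMk (hasFDerivAt_id q)).prodMk (hasFDerivAt_const _ _))
  exact pd_eq_of_comp hF h a

theorem pd_slice_P {F : Ext n → ℝ} (hF : ContDiff ℝ ∞ F) (τ θ : ℝ) (q P : Coord n) (a : Fin n) :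
    pd a (fun P => F (τ, (θ, q), P)) P = gradP F (τ, (θ, q), P) a := by
  have h : HasFDerivAt (fun P : Coord n => (τ, (θ, q), P))
      ((0 : Coord n →L[ℝ] ℝ).prod (((0 : Coord n →L[ℝ] ℝ).prod
        (0 : Coord n →L[ℝ] Coord n)).prod (ContinuousLinearMap.id ℝ (Coord n)))) P :=
    (hasFDerivAt_const _ _).prodMk
      (((hasFDerivAt_const _ _).prodMk (hasFDerivAt_const _ _)).prodMk (hasFDerivAt_id P))
  exact pd_eq_of_comp hF h a

theorem pd_param_q {H : ℝ → Coord n → Coord n → ℝ} (hH : SmoothParam H) (τ : ℝ) (q p : Coord n)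
    (a : Fin n) : pd a (fun q => H τ q p) q =
      fderiv ℝ (fun x : ℝ × Coord n × Coord n => H x.1 x.2.1 x.2.2) (τ, q, p) (0, unitV a, 0) := by
  have h : HasFDerivAt (fun q : Coord n => (τ, q, p))
      ((0 : Coord n →L[ℝ] ℝ).prod ((ContinuousLinearMap.id ℝ (Coord n)).prod
        (0 : Coord n →L[ℝ] Coord n))) q :=
    (hasFDerivAt_const _ _).prodMk ((hasFDerivAt_id q).prodMk (hasFDerivAt_const _ _))
  exact pd_eq_of_comp hH h a

theorem pd_param_p {H : ℝ → Coord n → Coord n → ℝ} (hH : SmoothParam H) (τ : ℝ) (q p : Coord n)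
    (a : Fin n) : pd a (fun p => H τ q p) p =
      fderiv ℝ (fun x : ℝ × Coord n × Coord n => H x.1 x.2.1 x.2.2) (τ, q, p) (0, 0, unitV a) := by
  have h : HasFDerivAt (fun p : Coord n => (τ, q, p))
      ((0 : Coord n →L[ℝ] ℝ).prod ((0 : Coord n →L[ℝ] Coord n).prod
        (ContinuousLinearMap.id ℝ (Coord n)))) p :=
    (hasFDerivAt_const _ _).prodMk ((hasFDerivAt_const _ _).prodMk (hasFDerivAt_id p))
  exact pd_eq_of_comp hH h a

theorem contDiff_hamField {H : ℝ → Coord n → Coord n → ℝ} (hH : SmoothParam H) :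
    ContDiff ℝ ∞ fun x : ℝ × Phase n => hamField (H x.1) x.2 := by
  have hd : ContDiff ℝ ∞ (fderiv ℝ fun x : ℝ × Coord n × Coord n => H x.1 x.2.1 x.2.2) :=
    hH.fderiv_right (m := ∞) (by simp)
  refine ContDiff.prodMk (contDiff_pi.2 fun a => ?_) (contDiff_pi.2 fun a => ContDiff.neg ?_)
  · simp only [pd_param_p hH]
    exact hd.clm_apply contDiff_const
  · simp only [pd_param_q hH]
    exact hd.clm_apply contDiff_const

theorem sum_mul_apply_unitV (ℓ : Coord n →ₗ[ℝ] ℝ) (c : Coord n) :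
    ∑ a, c a * ℓ (unitV a) = ℓ c := by
  have : c = ∑ a, c a • unitV a := by
    funext b
    simp [unitV, Finset.sum_apply, Pi.single_apply]
  conv_rhs => rw [this, map_sum]
  simp

/-- The inclusion of the positions as a linear map. -/
def dirQL : Coord n →ₗ[ℝ] Ext n :=
  LinearMap.inr ℝ ℝ _ ∘ₗ LinearMap.inl ℝ _ _ ∘ₗ LinearMap.inr ℝ ℝ _

/-- The inclusion of the momenta as a linear map. -/
def dirPL : Coord n →ₗ[ℝ] Ext n :=
  LinearMap.inr ℝ ℝ _ ∘ₗ LinearMap.inr ℝ _ _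

/-- The second derivative. -/
def hess (F : Ext n → ℝ) (x : Ext n) : Ext n →L[ℝ] Ext n →L[ℝ] ℝ := fderiv ℝ (fderiv ℝ F) x

theorem hess_comm {F : Ext n → ℝ} (hF : ContDiff ℝ ∞ F) (x v w : Ext n) :
    hess F x v w = hess F x w v :=
  (hF.contDiffAt.isSymmSndFDerivAt (by simpa using two_le_infty)).eq v w

theorem sum_mul_hess_dirQ (F : Ext n → ℝ) (x v : Ext n) (c : Coord n) :
    ∑ a, c a * hess F x v (dirQ (unitV a)) = hess F x v (dirQ c) :=
  sum_mul_apply_unitV ((hess F x v).toLinearMap ∘ₗ dirQL) c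

theorem sum_mul_hess_dirP (F : Ext n → ℝ) (x v : Ext n) (c : Coord n) :
    ∑ a, c a * hess F x v (dirP (unitV a)) = hess F x v (dirP c) :=
  sum_mul_apply_unitV ((hess F x v).toLinearMap ∘ₗ dirPL) c

theorem hasFDerivAt_dirD {F : Ext n → ℝ} (hF : ContDiff ℝ ∞ F) (v x : Ext n) :
    HasFDerivAt (dirD v F) ((hess F x).flip v) x := by
  have hd : DifferentiableAt ℝ (fderiv ℝ F) x :=
    ((hF.fderiv_right (m := ∞) (by simp)).differentiable (by simp)) x
  have h := hd.hasFDerivAt.clm_apply (hasFDerivAt_const v x)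
  refine h.congr_fderiv ?_
  rw [ContinuousLinearMap.ext_iff]
  intro w
  simp [hess]

theorem hasFDerivAt_gradQ {F : Ext n → ℝ} (hF : ContDiff ℝ ∞ F) (x : Ext n) :
    HasFDerivAt (gradQ F)
      (ContinuousLinearMap.pi fun a => (hess F x).flip (dirQ (unitV a))) x :=
  hasFDerivAt_pi.2 fun _ => hasFDerivAt_dirD hF _ x

theorem hasFDerivAt_gradP {F : Ext n → ℝ} (hF : ContDiff ℝ ∞ F) (x : Ext n) :
    HasFDerivAt (gradP F)
      (ContinuousLinearMap.pi fun a => (hess F x).flip (dirP (unitV a))) x :=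
  hasFDerivAt_pi.2 fun _ => hasFDerivAt_dirD hF _ x

/-- The map given by a generating function `F` and a solution `π` of the first relation. -/
def genMap (F : Ext n → ℝ) (π : Ext n → Coord n) (y : Ext n) : Phase n :=
  (gradP F (y.1, y.2.1, π y), π y)

section
variable {F : Ext n → ℝ} {π : Ext n → Coord n} {y : Ext n}

/-- The derivative of the point at which the generating function is evaluated. -/
def graphDir (π : Ext n → Coord n) (y d : Ext n) : Ext n := (d.1, d.2.1, fderiv ℝ π y d)

theorem hasFDerivAt_graph (hπ : DifferentiableAt ℝ π y) :
    HasFDerivAt (fun y => (y.1, y.2.1, π y))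
      ((ContinuousLinearMap.fst ℝ ℝ _).prod
        (((ContinuousLinearMap.fst ℝ _ _).comp (ContinuousLinearMap.snd ℝ ℝ _)).prod
          (fderiv ℝ π y))) y :=
  hasFDerivAt_fst.prodMk ((hasFDerivAt_snd (𝕜 := ℝ) (p := y)).fst.prodMk hπ.hasFDerivAt)

/-- This is the relation ∂F/∂q = p, valid near y, differentiated in the direction d. -/
theorem momentum_deriv (hF : ContDiff ℝ ∞ F) (hπ : DifferentiableAt ℝ π y)
    (h : ∀ᶠ y in 𝓝 y, gradQ F (y.1, y.2.1, π y) = y.2.2) (d : Ext n) (a : Fin n) :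
    d.2.2 a = hess F (y.1, y.2.1, π y) (graphDir π y d) (dirQ (unitV a)) := by
  have h1 := HasFDerivAt.comp y (hasFDerivAt_gradQ hF (y.1, y.2.1, π y)) (hasFDerivAt_graph hπ)
  have h2 := (hasFDerivAt_snd (𝕜 := ℝ) (p := y)).snd.congr_of_eventuallyEq h
  have h3 := congrArg (fun L => L d a) (h1.unique h2)
  exact h3.symm

theorem hasFDerivAt_genMap (hF : ContDiff ℝ ∞ F) (hπ : DifferentiableAt ℝ π y) :
    ∃ L : Ext n →L[ℝ] Phase n, HasFDerivAt (genMap F π) L y ∧ ∀ d, L d =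
      (fun a => hess F (y.1, y.2.1, π y) (graphDir π y d) (dirP (unitV a)), fderiv ℝ π y d) :=
  ⟨_, (HasFDerivAt.comp y (hasFDerivAt_gradP hF (y.1, y.2.1, π y))
    (hasFDerivAt_graph hπ)).prodMk hπ.hasFDerivAt, fun _ => rfl⟩

/-- Let U u be the velocity of (q, P) induced by u, and B the Hessian of F. By `momentum_deriv` the
symplectic forms before and after the map are both values of B, and their equality amounts to B(U u,
U v) = B(U v, U u). -/
theorem genMap_symplectic (hF : ContDiff ℝ ∞ F) {τ θ : ℝ} {z : Phase n}
    (hπ : DifferentiableAt ℝ π (τ, (θ, z.1), z.2))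
    (h : ∀ᶠ y in 𝓝 (τ, (θ, z.1), z.2), gradQ F (y.1, y.2.1, π y) = y.2.2) :
    DifferentiableAt ℝ (fun z : Phase n => genMap F π (τ, (θ, z.1), z.2)) z ∧
    ∀ u v, sympForm (fderiv ℝ (fun z : Phase n => genMap F π (τ, (θ, z.1), z.2)) z u)
      (fderiv ℝ (fun z : Phase n => genMap F π (τ, (θ, z.1), z.2)) z v) = sympForm u v := by
  obtain ⟨L, hL, hLd⟩ := hasFDerivAt_genMap hF hπ
  have hι : HasFDerivAt (fun z : Phase n => ((τ, (θ, z.1), z.2) : Ext n))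
      ((0 : Phase n →L[ℝ] ℝ).prod (((0 : Phase n →L[ℝ] ℝ).prod
        (ContinuousLinearMap.fst ℝ _ _)).prod (ContinuousLinearMap.snd ℝ _ _))) z :=
    (hasFDerivAt_const _ _).prodMk
      (((hasFDerivAt_const _ _).prodMk hasFDerivAt_fst).prodMk hasFDerivAt_snd)
  have hc := HasFDerivAt.comp z hL hι
  rw [Function.comp_def] at hc
  refine ⟨hc.differentiableAt, fun u v => ?_⟩
  rw [hc.fderiv]
  have hval : ∀ u : Phase n, (L.comp ((0 : Phase n →L[ℝ] ℝ).prod (((0 : Phase n →L[ℝ] ℝ).prod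
        (ContinuousLinearMap.fst ℝ _ _)).prod (ContinuousLinearMap.snd ℝ _ _)))) u
        = L (0, (0, u.1), u.2) := fun _ => rfl
  rw [hval, hval, hLd, hLd]
  set B := hess F (τ, (θ, z.1), π (τ, (θ, z.1), z.2)) with hB
  set U : Phase n → Ext n := fun u => graphDir π (τ, (θ, z.1), z.2) (0, (0, u.1), u.2) with hU
  have hm : ∀ (u : Phase n) a, u.2 a = B (U u) (dirQ (unitV a)) := fun u a =>
    momentum_deriv hF hπ h (0, (0, u.1), u.2) a
  have hUdec : ∀ u : Phase n, U u = dirQ u.1 + dirP (U u).2.2 := by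
    intro u
    simp [hU, graphDir, dirQ, dirP]
  have hQ : ∀ w c, ∑ a, c a * B w (dirQ (unitV a)) = B w (dirQ c) := sum_mul_hess_dirQ F _
  have hP : ∀ w c, ∑ a, c a * B w (dirP (unitV a)) = B w (dirP c) := sum_mul_hess_dirP F _
  have hR : sympForm u v = B (U v) (dirQ u.1) - B (U u) (dirQ v.1) := by
    unfold sympForm
    rw [Finset.sum_sub_distrib, ← hQ, ← hQ]
    simp only [hm]
  have hLft : sympForm (fun a => B (U u) (dirP (unitV a)), (U u).2.2)
      (fun a => B (U v) (dirP (unitV a)), (U v).2.2)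
      = B (U u) (dirP (U v).2.2) - B (U v) (dirP (U u).2.2) := by
    unfold sympForm
    rw [Finset.sum_sub_distrib, ← hP, ← hP]
    simp only [mul_comm]
  refine Eq.trans hLft ?_
  rw [hR]
  have h1 : B (U u) (U v) = B (U u) (dirQ v.1) + B (U u) (dirP (U v).2.2) := by
    rw [← map_add, ← hUdec]
  have h2 : B (U v) (U u) = B (U v) (dirQ u.1) + B (U v) (dirP (U u).2.2) := by
    rw [← map_add, ← hUdec]
  have h3 : B (U u) (U v) = B (U v) (U u) := hess_comm hF _ _ _
  linarith

/-- The residual of the Hamilton–Jacobi equation `∂F/∂θ = τ H(q, ∂F/∂q)`. -/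
def residual (H : ℝ → Coord n → Coord n → ℝ) (F : Ext n → ℝ) (x : Ext n) : ℝ :=
  dirD dirT F x - x.1 * H x.1 x.2.1.2 (gradQ F x)

theorem contDiff_residual {H : ℝ → Coord n → Coord n → ℝ} (hH : SmoothParam H)
    (hF : ContDiff ℝ ∞ F) : ContDiff ℝ ∞ (residual H F) := by
  have h1 : ContDiff ℝ ∞ fun x : Ext n => H x.1 x.2.1.2 (gradQ F x) := by
    have h2 : ContDiff ℝ ∞ fun x : Ext n => (x.1, x.2.1.2, gradQ F x) :=
      contDiff_fst.prodMk ((contDiff_snd.fst.snd).prodMk (contDiff_gradQ hF))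
    exact ContDiff.comp hH h2
  exact (contDiff_dirD _ hF).sub (contDiff_fst.mul h1)

/-- The condition `v.1 = 0` keeps the time step fixed, so neither the factor `τ` nor the explicit
dependence of H on `τ` is differentiated. -/
theorem dirD_residual {H : ℝ → Coord n → Coord n → ℝ} (hH : SmoothParam H)
    (hF : ContDiff ℝ ∞ F) (x v : Ext n) (hv : v.1 = 0) :
    dirD v (residual H F) x = hess F x v dirT -
      x.1 * (∑ a, v.2.1.2 a * pd a (fun q => H x.1 q (gradQ F x)) x.2.1.2
        + hess F x v (dirQ fun a => pd a (fun p => H x.1 x.2.1.2 p) (gradQ F x))) := by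
  set Hu := fun x : ℝ × Coord n × Coord n => H x.1 x.2.1 x.2.2 with hHu
  have h1 : HasFDerivAt Hu (fderiv ℝ Hu (x.1, x.2.1.2, gradQ F x)) (x.1, x.2.1.2, gradQ F x) :=
    (ContDiff.differentiable hH (by simp) _).hasFDerivAt
  have h2 := HasFDerivAt.comp x h1 ((hasFDerivAt_fst (𝕜 := ℝ) (p := x)).prodMk
    ((hasFDerivAt_snd (𝕜 := ℝ) (p := x)).fst.snd.prodMk (hasFDerivAt_gradQ hF x)))
  have h3 := (hasFDerivAt_dirD hF dirT x).sub ((hasFDerivAt_fst (𝕜 := ℝ) (p := x)).mul h2)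
  have h4 : dirD v (residual H F) x = _ := congrArg (fun L => L v) h3.fderiv
  rw [h4]
  simp only [pd_param_q hH, pd_param_p hH]
  have h5 : ∑ a, v.2.1.2 a * fderiv ℝ Hu (x.1, x.2.1.2, gradQ F x) (0, unitV a, 0)
      = fderiv ℝ Hu (x.1, x.2.1.2, gradQ F x) (0, v.2.1.2, 0) :=
    sum_mul_apply_unitV ((fderiv ℝ Hu (x.1, x.2.1.2, gradQ F x)).toLinearMap ∘ₗ
      LinearMap.inr ℝ ℝ _ ∘ₗ LinearMap.inl ℝ _ _) _
  have h6 : hess F x v (dirQ fun a =>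
      fderiv ℝ Hu (x.1, x.2.1.2, gradQ F x) (0, 0, unitV a))
      = fderiv ℝ Hu (x.1, x.2.1.2, gradQ F x) (0, 0, fun a => hess F x v (dirQ (unitV a))) := by
    rw [← sum_mul_hess_dirQ]
    refine (Finset.sum_congr rfl fun _ _ => mul_comm _ _).trans ?_
    exact sum_mul_apply_unitV ((fderiv ℝ Hu (x.1, x.2.1.2, gradQ F x)).toLinearMap ∘ₗ
      LinearMap.inr ℝ ℝ _ ∘ₗ LinearMap.inr ℝ _ _) _
  rw [h5, h6, ← map_add]
  simp [hv]

/-- The derivative of the map generated by `F` along the extended flow of `H` is controlled by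
the residual of the Hamilton–Jacobi equation. -/
theorem genMap_deriv_along_flow {H : ℝ → Coord n → Coord n → ℝ} (hH : SmoothParam H)
    (hF : ContDiff ℝ ∞ F) {τ θ : ℝ} {z : Phase n}
    (hπ : DifferentiableAt ℝ π (τ, (θ, z.1), z.2))
    (h : ∀ᶠ y in 𝓝 (τ, (θ, z.1), z.2), gradQ F (y.1, y.2.1, π y) = y.2.2) :
    ∃ (L : Ext n →L[ℝ] Phase n) (η : Coord n), HasFDerivAt (genMap F π) L (τ, (θ, z.1), z.2) ∧
      (L (0, (-1, τ • (hamField (H τ) z).1), τ • (hamField (H τ) z).2)).2 = η ∧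
      (∀ a, hess F (τ, (θ, z.1), π (τ, (θ, z.1), z.2)) (dirP η) (dirQ (unitV a))
        = dirD (dirQ (unitV a)) (residual H F) (τ, (θ, z.1), π (τ, (θ, z.1), z.2))) ∧
      ∀ a, (L (0, (-1, τ • (hamField (H τ) z).1), τ • (hamField (H τ) z).2)).1 a
        = hess F (τ, (θ, z.1), π (τ, (θ, z.1), z.2)) (dirP η) (dirP (unitV a))
          - dirD (dirP (unitV a)) (residual H F) (τ, (θ, z.1), π (τ, (θ, z.1), z.2)) := by
  obtain ⟨L, hL, hLd⟩ := hasFDerivAt_genMap hF hπ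
  -- The velocity of the curve s ↦ (τ, (1 - s, q(τs)), p(τs)): the remaining fraction shrinks while
  -- the flow advances.
  set d : Ext n := (0, (-1, τ • (hamField (H τ) z).1), τ • (hamField (H τ) z).2) with hd
  set η := fderiv ℝ π (τ, (θ, z.1), z.2) d with hη
  set x : Ext n := (τ, (θ, z.1), π (τ, (θ, z.1), z.2)) with hx
  have hgr : gradQ F x = z.2 := h.self_of_nhds
  have hU : graphDir π (τ, (θ, z.1), z.2) d
      = -dirT + τ • dirQ (hamField (H τ) z).1 + dirP η := by
    simp [graphDir, hd, dirT, dirQ, dirP, hη]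
  have hm : ∀ a, τ * (hamField (H τ) z).2 a = _ := fun a =>
    momentum_deriv hF hπ h d a
  refine ⟨L, η, hL, by rw [hLd], fun a => ?_, fun a => ?_⟩
  · have h1 := hm a
    rw [hU] at h1
    rw [dirD_residual hH hF _ _ rfl]
    simp only [map_add, map_neg, map_smul, add_apply,
      neg_apply, smul_apply, smul_eq_mul] at h1
    have h2 : ∑ b, (dirQ (unitV a)).2.1.2 b * pd b (fun q => H x.1 q (gradQ F x)) x.2.1.2
        = -(hamField (H τ) z).2 a := by
      rw [hgr]
      simp [dirQ, unitV, Pi.single_apply, hamField, hx]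
    have h3 : (fun b => pd b (fun p => H x.1 x.2.1.2 p) (gradQ F x)) = (hamField (H τ) z).1 := by
      rw [hgr]
      rfl
    rw [h2, h3, hess_comm hF x _ dirT, hess_comm hF x (dirQ (unitV a))]
    change τ * _ = -hess F x _ _ + τ * hess F x _ _ + hess F x _ _ at h1
    have h4 : x.1 = τ := rfl
    rw [h4]
    linarith
  · rw [hLd, dirD_residual hH hF _ _ rfl]
    have h2 : ∑ b, (dirP (unitV a)).2.1.2 b * pd b (fun q => H x.1 q (gradQ F x)) x.2.1.2
        = 0 := by
      simp [dirP]
    have h3 : (fun b => pd b (fun p => H x.1 x.2.1.2 p) (gradQ F x)) = (hamField (H τ) z).1 := by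
      rw [hgr]
      rfl
    rw [h2, h3, hU, hess_comm hF x (dirP (unitV a)) dirT, hess_comm hF x (dirP (unitV a)) (dirQ _)]
    simp only [map_add, map_neg, map_smul, add_apply,
      neg_apply, smul_apply, smul_eq_mul]
    have h4 : x.1 = τ := rfl
    rw [h4]
    change -hess F x _ _ + τ * hess F x _ _ + hess F x _ _ = _
    ring

end

end

/-! ### From a small residual to a small error of the map -/

section

variable {n : ℕ}

theorem norm_unitV_le (a : Fin n) : ‖unitV a‖ ≤ 1 := by
  refine (pi_norm_le_iff_of_nonneg zero_le_one).2 fun b => ?_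
  by_cases h : b = a
  · subst h; simp [unitV]
  · simp [unitV, h]

theorem norm_dirP_le (v : Coord n) : ‖dirP v‖ ≤ ‖v‖ := by
  simp [dirP, Prod.norm_def]

theorem exists_norm_hess_le {F : Ext n → ℝ} (hF : ContDiff ℝ ∞ F) {C : Set (Ext n)}
    (hC : IsCompact C) : ∃ L : ℝ, 0 ≤ L ∧ ∀ x ∈ C, ‖hess F x‖ ≤ L := by
  obtain ⟨L, hL0, hL⟩ := exists_norm_fderiv_le (hF.fderiv_right (m := ∞) (by simp)) hC
  exact ⟨L, hL0, fun x hx => (hL x hx).2⟩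

/-- All derivatives of the residual are `O(τᵏ)` on compact sets if the residual is, pointwise. -/
theorem exists_bound_grad_of_isBigO {r : Ext n → ℝ} (hr : ContDiff ℝ ∞ r) {k : ℕ}
    (h : ∀ θ q P, (fun τ => r (τ, (θ, q), P)) =O[𝓝 0] fun τ => τ ^ k)
    {C : Set ((ℝ × Coord n) × Coord n)} (hC : IsCompact C) :
    ∃ c : ℝ, 0 ≤ c ∧ ∀ τ y, |τ| ≤ 1 → y ∈ C → ∀ a,
      |dirD (dirQ (unitV a)) r (τ, y)| ≤ c * |τ| ^ k ∧
      |dirD (dirP (unitV a)) r (τ, y)| ≤ c * |τ| ^ k := by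
  have hz : ∀ y : (ℝ × Coord n) × Coord n, (fun τ => r (τ, y)) =O[𝓝 0] fun τ => τ ^ k :=
    fun y => h y.1.1 y.1.2 y.2
  choose cQ hcQ0 hcQ using fun a : Fin n =>
    exists_bound_dirD_of_isBigO hC hr hz (((0 : ℝ), unitV a), (0 : Coord n))
  choose cP hcP0 hcP using fun a : Fin n =>
    exists_bound_dirD_of_isBigO hC hr hz (((0 : ℝ), (0 : Coord n)), unitV a)
  have hle : ∀ a, cQ a ≤ ∑ b, (cQ b + cP b) ∧ cP a ≤ ∑ b, (cQ b + cP b) := by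
    intro a
    have h1 := Finset.single_le_sum (f := fun b => cQ b + cP b)
      (fun b _ => add_nonneg (hcQ0 b) (hcP0 b)) (Finset.mem_univ a)
    have h2 := hcQ0 a
    have h3 := hcP0 a
    constructor <;> linarith
  refine ⟨∑ b, (cQ b + cP b), Finset.sum_nonneg fun b _ => add_nonneg (hcQ0 b) (hcP0 b),
    fun τ y hτ hy a => ⟨(hcQ a τ y hτ hy).trans ?_, (hcP a τ y hτ hy).trans ?_⟩⟩
  · gcongr; exact (hle a).1
  · gcongr; exact (hle a).2

/-- A generating function `F(τ, θ, q, P) = q P + τ g(τ, θ, q, P)` with `F = q P` at `θ = 0` that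
satisfies the Hamilton–Jacobi equation `∂F/∂θ = τ H(q, ∂F/∂q)` up to `O(τ^{N+1})` generates at
`θ = 1` the flow of `H` over the time `τ`, up to `O(τ^{N+1})`. -/
theorem realizesFlow_of_residual {H : ℝ → Coord n → Coord n → ℝ} (hH : SmoothParam H)
    {F g : Ext n → ℝ} (hg : ContDiff ℝ ∞ g)
    (hFg : ∀ x, F x = ∑ a, x.2.1.2 a * x.2.2 a + x.1 * g x)
    (hg0 : ∀ τ q P, g (τ, (0, q), P) = 0) {N : ℕ}
    (hres : ∀ θ q P, (fun τ => residual H F (τ, (θ, q), P)) =O[𝓝 0] fun τ => τ ^ (N + 1)) :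
    RealizesFlow H (fun τ q P => F (τ, (1, q), P)) N := by
  have hqP : ContDiff ℝ ∞ fun x : Ext n => ∑ a, x.2.1.2 a * x.2.2 a :=
    ContDiff.sum fun a _ => by fun_prop
  have hF : ContDiff ℝ ∞ F := by
    have : F = fun x : Ext n => ∑ a, x.2.1.2 a * x.2.2 a + x.1 * g x := funext hFg
    rw [this]
    exact hqP.add (contDiff_fst.mul hg)
  -- the gradients of `F`
  have hgradQ : ∀ x, gradQ F x = x.2.2 + x.1 • gradQ g x := by
    rintro ⟨τ, ⟨θ, q⟩, P⟩
    funext a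
    rw [← pd_slice_Q hF]
    simp only [hFg, Pi.add_apply, Pi.smul_apply, smul_eq_mul, ← pd_slice_Q hg]
    unfold pd
    have h1 : HasFDerivAt (fun q : Coord n => ∑ a, q a * P a)
        (∑ a, P a • ContinuousLinearMap.proj (R := ℝ) (φ := fun _ : Fin n => ℝ) a) q :=
      HasFDerivAt.fun_sum fun a _ => (hasFDerivAt_apply a q).mul_const (P a)
    have h2 : DifferentiableAt ℝ (fun q => g (τ, (θ, q), P)) q :=
      ((hg.comp (by fun_prop : ContDiff ℝ ∞ fun q => ((τ, (θ, q), P) : Ext n))).differentiable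
        (by simp)) q
    have h3 := (h1.add (h2.hasFDerivAt.const_mul τ)).fderiv
    rw [Pi.add_def] at h3
    rw [h3]
    simp [Pi.single_apply]
  have hgradP0 : ∀ τ q P, gradP F (τ, (0, q), P) = q := by
    intro τ q P
    funext a
    rw [← pd_slice_P hF]
    simp only [hFg, hg0, mul_zero, add_zero]
    unfold pd
    have h1 : HasFDerivAt (fun P : Coord n => ∑ a, q a * P a)
        (∑ a, q a • ContinuousLinearMap.proj (R := ℝ) (φ := fun _ : Fin n => ℝ) a) P :=
      HasFDerivAt.fun_sum fun a _ => (hasFDerivAt_apply a P).const_mul (q a)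
    rw [h1.fderiv]
    simp [Pi.single_apply]
  have hgradQ0 : ∀ τ q P, gradQ F (τ, (0, q), P) = P := by
    intro τ q P
    funext a
    rw [← pd_slice_Q hF]
    simp only [hFg, hg0, mul_zero, add_zero]
    unfold pd
    have h1 : HasFDerivAt (fun q : Coord n => ∑ a, q a * P a)
        (∑ a, P a • ContinuousLinearMap.proj (R := ℝ) (φ := fun _ : Fin n => ℝ) a) q :=
      HasFDerivAt.fun_sum fun a _ => (hasFDerivAt_apply a q).mul_const (P a)
    rw [h1.fderiv]
    simp [Pi.single_apply]
  intro K hK R hR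
  -- the solution of the first relation
  set K' : Set ((ℝ × Coord n) × Coord n) :=
    Homeomorph.prodAssoc ℝ (Coord n) (Coord n) ⁻¹' (Set.Icc (-1) 2 ×ˢ Metric.cthickening 2 K)
    with hK'
  have hK'c : IsCompact K' :=
    (Homeomorph.prodAssoc ℝ (Coord n) (Coord n)).isCompact_preimage.2
      (isCompact_Icc.prod hK.cthickening)
  have hK'i : ∀ θ (z : Phase n), θ ∈ Set.Icc (0 : ℝ) 1 → z ∈ Metric.thickening 2 K →
      ((θ, z.1), z.2) ∈ interior K' := by
    intro θ z hθ hz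
    have ho : IsOpen (Homeomorph.prodAssoc ℝ (Coord n) (Coord n) ⁻¹'
        (Set.Ioo (-1) 2 ×ˢ Metric.thickening 2 K)) :=
      (isOpen_Ioo.prod Metric.isOpen_thickening).preimage (Homeomorph.continuous _)
    refine (interior_maximal ?_ ho) ?_
    · exact Set.preimage_mono
        (Set.prod_mono Set.Ioo_subset_Icc_self (Metric.thickening_subset_cthickening 2 K))
    · have hθ' : θ ∈ Set.Ioo (-1 : ℝ) 2 := ⟨by linarith [hθ.1], by linarith [hθ.2]⟩
      exact ⟨hθ', hz⟩
  obtain ⟨τ₁, π, hτ₁, hτ₁1, hπs, hπ, hinv⟩ :=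
    exists_smooth_solution (contDiff_gradQ hg) hK'c hR
  have hiff : ∀ τ, |τ| < τ₁ → ∀ a p, (a, p) ∈ K' → ∀ P,
      (gradQ F (τ, a, P) = p ∧ ‖P - p‖ < R) ↔ P = π (τ, a, p) := by
    intro τ hτ a p hap P
    rw [hgradQ]
    exact hπ τ hτ a p hap P
  have hπat : ∀ τ, |τ| < τ₁ → ∀ θ (z : Phase n), θ ∈ Set.Icc (0 : ℝ) 1 →
      z ∈ Metric.thickening 2 K → ContDiffAt ℝ ∞ π (τ, (θ, z.1), z.2) ∧
      ∀ᶠ y in 𝓝 (τ, (θ, z.1), z.2), gradQ F (y.1, y.2.1, π y) = y.2.2 := by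
    intro τ hτ θ z hθ hz
    have hnhds : Set.Ioo (-τ₁) τ₁ ×ˢ interior K' ∈ 𝓝 ((τ, (θ, z.1), z.2) : Ext n) :=
      (isOpen_Ioo.prod isOpen_interior).mem_nhds ⟨abs_lt.1 hτ, hK'i θ z hθ hz⟩
    refine ⟨hπs.contDiffAt hnhds, ?_⟩
    filter_upwards [hnhds] with y hy
    exact ((hiff y.1 (abs_lt.2 hy.1) y.2.1 y.2.2 (interior_subset hy.2) _).2 rfl).1
  -- the flow
  obtain ⟨τ₂, hτ₂, hflow⟩ := exists_solution_of_small (contDiff_hamField hH)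
    (hK.cthickening (r := 1))
  -- bounds
  obtain ⟨r₀, hr₀⟩ := hK'c.isBounded.subset_closedBall 0
  have hCc : IsCompact (Metric.closedBall (0 : (ℝ × Coord n) × Coord n) (r₀ + R)) :=
    isCompact_closedBall _ _
  obtain ⟨c, hc0, hc⟩ := exists_bound_grad_of_isBigO (contDiff_residual hH hF) hres hCc
  obtain ⟨L₀, hL0, hL⟩ := exists_norm_hess_le hF ((isCompact_Icc (a := (-1 : ℝ)) (b := 1)).prod hCc)
  -- The momentum component of the derivative of u is at most 2c|τ|^(N+1), the position component at
  -- most (2cL₀ + c)|τ|^(N+1); C dominates both.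
  set C : ℝ := 2 * c * (1 + L₀) + c with hC
  have hmemC : ∀ a p P, (a, p) ∈ K' → ‖P - p‖ < R →
      (a, P) ∈ Metric.closedBall (0 : (ℝ × Coord n) × Coord n) (r₀ + R) := by
    intro a p P hap hP
    have h1 : ‖(a, p)‖ ≤ r₀ := by simpa using hr₀ hap
    have h2 := (norm_fst_le (a, p)).trans h1
    have h3 := (norm_snd_le (a, p)).trans h1
    rw [mem_closedBall_zero_iff]
    refine max_le (by simp only at h2 ⊢; linarith) ?_
    have h4 := norm_add_le p (P - p)
    rw [add_sub_cancel] at h4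
    simp only at h3 ⊢
    linarith
  refine ⟨Metric.thickening 1 K, min τ₁ τ₂, C, fun τ z => genMap F π (τ, (1, z.1), z.2),
    Metric.isOpen_thickening, Metric.self_subset_thickening one_pos K, lt_min hτ₁ hτ₂, ?_, ?_⟩
  · rintro ⟨τ, z⟩ ⟨hτ, hz⟩
    have hτ' : |τ| < τ₁ := (abs_lt.2 hτ).trans_le (min_le_left _ _)
    have h1 := (hπat τ hτ' 1 z (by simp) (Metric.thickening_mono one_le_two K hz)).1
    have h2 : ContDiffAt ℝ ∞ (genMap F π) (τ, (1, z.1), z.2) := by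
      refine ContDiffAt.prodMk ?_ h1
      exact (contDiff_gradP hF).contDiffAt.comp _
        (contDiffAt_fst.prodMk (contDiffAt_snd.fst.prodMk h1))
    have h3 : ContDiffAt ℝ ∞ (fun x : ℝ × Phase n => ((x.1, (1, x.2.1), x.2.2) : Ext n)) (τ, z) := by
      fun_prop
    exact (ContDiffAt.comp (τ, z) h2 h3).contDiffWithinAt
  intro τ hτ
  have hτ1 : |τ| < τ₁ := hτ.trans_le (min_le_left _ _)
  have hτ2 : |τ| < τ₂ := hτ.trans_le (min_le_right _ _)
  refine ⟨fun z hz w => ?_, fun z hz => ?_, fun z hz => ?_⟩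
  · have hzK : ((1, z.1), z.2) ∈ K' :=
      interior_subset (hK'i 1 z (by simp) (Metric.thickening_mono one_le_two K hz))
    have h1 := hiff τ hτ1 (1, z.1) z.2 hzK w.2
    simp only [Generates, pd_slice_Q hF, pd_slice_P hF]
    constructor
    · rintro ⟨⟨h2, h3⟩, h4⟩
      have h5 := h1.1 ⟨(funext h2).symm, h4⟩
      refine Prod.ext ?_ h5
      simp only [genMap, ← h5]
      exact funext h3
    · rintro rfl
      obtain ⟨h2, h3⟩ := h1.2 rfl
      exact ⟨⟨fun a => (congrFun h2 a).symm, fun a => rfl⟩, h3⟩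
  · obtain ⟨h1, h2⟩ := hπat τ hτ1 1 z (by simp) (Metric.thickening_mono one_le_two K hz)
    exact genMap_symplectic hF (h1.differentiableAt (by simp)) h2
  · obtain ⟨hex, hnear⟩ := hflow τ hτ2 z (Metric.thickening_subset_cthickening 1 K hz)
    obtain ⟨γ₀, hγ₀⟩ := hex
    refine ⟨⟨γ₀, hγ₀⟩, fun γ hγ => ?_⟩
    have hres := hasDerivWithinAt_rescale hγ.2
    have hnear' := hnear γ hγ.1 hγ.2
    have hmem2 : ∀ s ∈ Set.Icc (0 : ℝ) 1, γ (τ * s) ∈ Metric.thickening 2 K := by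
      intro s hs
      obtain ⟨k, hk, hzk⟩ := Metric.mem_thickening_iff.1 hz
      refine Metric.mem_thickening_iff.2 ⟨k, hk, ?_⟩
      have := hnear' s hs
      rw [← dist_eq_norm] at this
      linarith [dist_triangle (γ (τ * s)) z k]
    -- Follow the exact flow for the fraction s, then apply the generated map for the remaining
    -- fraction 1 - s. For an exact solution of the Hamilton–Jacobi equation u would be constant.
    set u : ℝ → Phase n := fun s => genMap F π (τ, (1 - s, (γ (τ * s)).1), (γ (τ * s)).2) with hu
    have hderiv : ∀ s ∈ Set.Icc (0 : ℝ) 1, ∃ ξ : Phase n,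
        HasDerivWithinAt u ξ (Set.Icc 0 1) s ∧ ‖ξ‖ ≤ C * |τ| ^ (N + 1) := by
      intro s hs
      set w := γ (τ * s) with hw
      have hθ : 1 - s ∈ Set.Icc (0 : ℝ) 1 := ⟨by linarith [hs.2], by linarith [hs.1]⟩
      obtain ⟨h1, h2⟩ := hπat τ hτ1 (1 - s) w hθ (hmem2 s hs)
      obtain ⟨L, η, hL1, hL2, hL3, hL4⟩ :=
        genMap_deriv_along_flow hH hF (h1.differentiableAt (by simp)) h2
      have hwK : ((1 - s, w.1), w.2) ∈ K' := interior_subset (hK'i _ w hθ (hmem2 s hs))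
      set P := π (τ, (1 - s, w.1), w.2) with hP
      have hPR : ‖P - w.2‖ < R := ((hiff τ hτ1 _ _ hwK _).2 rfl).2
      have hxC := hmemC _ _ _ hwK hPR
      have hτle : |τ| ≤ 1 := hτ1.le.trans hτ₁1
      have hpath : HasDerivWithinAt
          (fun s => ((τ, (1 - s, (γ (τ * s)).1), (γ (τ * s)).2) : Ext n))
          (0, (-1, τ • (hamField (H τ) w).1), τ • (hamField (H τ) w).2) (Set.Icc 0 1) s := by
        have h3 := hres s hs
        have h4 : HasDerivWithinAt (fun s : ℝ => 1 - s) (-1) (Set.Icc 0 1) s := by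
          simpa using (hasDerivWithinAt_id s (Set.Icc (0:ℝ) 1)).const_sub 1
        have h5 : HasDerivWithinAt (fun s => (γ (τ * s)).1) (τ • (hamField (H τ) w).1)
            (Set.Icc 0 1) s :=
          ((ContinuousLinearMap.fst ℝ (Coord n) (Coord n)).hasFDerivAt.comp_hasDerivWithinAt s h3)
        have h6 : HasDerivWithinAt (fun s => (γ (τ * s)).2) (τ • (hamField (H τ) w).2)
            (Set.Icc 0 1) s :=
          ((ContinuousLinearMap.snd ℝ (Coord n) (Coord n)).hasFDerivAt.comp_hasDerivWithinAt s h3)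
        exact (hasDerivWithinAt_const _ _ _).prodMk ((h4.prodMk h5).prodMk h6)
      have hbd := hc τ _ hτle hxC
      have hcomp := HasFDerivAt.comp_hasDerivWithinAt
        (f := fun s => ((τ, (1 - s, (γ (τ * s)).1), (γ (τ * s)).2) : Ext n)) s hL1 hpath
      refine ⟨_, hcomp, ?_⟩
      -- The mixed derivative of F in q and P is 1 + O(τ), and it maps η to the q-gradient of the
      -- residual. `hinv` inverts it at the cost of a factor 2.
      have hη : ‖η‖ ≤ 2 * c * |τ| ^ (N + 1) := by
        have h7 := hinv τ hτ1 (1 - s, w.1) w.2 hwK P hPR η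
        have h8 : η + τ • fderiv ℝ (gradQ g) (τ, (1 - s, w.1), P) (0, 0, η)
            = fun a => dirD (dirQ (unitV a)) (residual H F) (τ, (1 - s, w.1), P) := by
          have h9 : HasFDerivAt (gradQ F) _ (τ, (1 - s, w.1), P) := hasFDerivAt_gradQ hF _
          have h10 := (hasFDerivAt_snd (𝕜 := ℝ) (p := ((τ, (1 - s, w.1), P) : Ext n))).snd.add
            ((hasFDerivAt_fst (𝕜 := ℝ) (p := ((τ, (1 - s, w.1), P) : Ext n))).smul
              (((contDiff_gradQ hg).differentiable (by simp) (τ, (1 - s, w.1), P)).hasFDerivAt))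
          have h11 : gradQ F = fun x => x.2.2 + x.1 • gradQ g x := funext hgradQ
          rw [h11] at h9
          have h12 := congrArg (fun L => L (dirP η)) (h9.unique h10)
          funext a
          rw [← hL3]
          have h13 := congrFun h12 a
          simp [dirP] at h13
          exact h13.symm
        rw [h8] at h7
        refine h7.trans ?_
        rw [mul_assoc]
        gcongr
        refine (pi_norm_le_iff_of_nonneg (by positivity)).2 fun a => ?_
        exact (hbd a).1
      refine max_le ?_ ?_
      · refine (pi_norm_le_iff_of_nonneg (by positivity)).2 fun a => ?_
        have h14 : |hess F (τ, (1 - s, w.1), P) (dirP η) (dirP (unitV a))| ≤ L₀ * ‖η‖ := by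
          have h15 := (hess F (τ, (1 - s, w.1), P)).le_opNorm₂ (dirP η) (dirP (unitV a))
          have h16 := hL (τ, (1 - s, w.1), P) ⟨abs_le.1 hτle, hxC⟩
          have h17 := (norm_dirP_le (unitV a)).trans (norm_unitV_le a)
          have h18 := norm_dirP_le η
          refine (h15.trans ?_)
          calc _ ≤ L₀ * ‖η‖ * 1 := by gcongr
            _ = _ := mul_one _
        have h19 := (hbd a).2
        refine (congrArg norm (hL4 a)).le.trans ?_
        rw [Real.norm_eq_abs]
        refine (abs_sub _ _).trans ?_
        have h20 : L₀ * ‖η‖ ≤ L₀ * (2 * c * |τ| ^ (N + 1)) := by gcongr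
        have h21 : 0 ≤ c * |τ| ^ (N + 1) := by positivity
        rw [hC]
        nlinarith
      · refine (congrArg norm hL2).le.trans (hη.trans ?_)
        gcongr
        rw [hC]
        nlinarith [mul_nonneg hc0 hL0]
    choose! ξ hξ hξb using hderiv
    have hmv := (convex_Icc (0 : ℝ) 1).norm_image_sub_le_of_norm_hasDerivWithin_le
      hξ hξb (Set.right_mem_Icc.2 zero_le_one) (Set.left_mem_Icc.2 zero_le_one)
    have hu0 : u 0 = genMap F π (τ, (1, z.1), z.2) := by
      simp only [hu, mul_zero, sub_zero, hγ.1]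
    -- At fraction 0 the generating function is q·P, which generates the identity.
    have hu1 : u 1 = γ τ := by
      have h1 : ((0, (γ τ).1), (γ τ).2) ∈ K' := by
        have := hmem2 1 (by simp)
        rw [mul_one] at this
        exact interior_subset (hK'i 0 (γ τ) (by simp) this)
      have h2 : (γ τ).2 = π (τ, (0, (γ τ).1), (γ τ).2) :=
        (hiff τ hτ1 _ _ h1 _).1 ⟨hgradQ0 _ _ _, by simpa using hR⟩
      simp only [hu, mul_one, sub_self, genMap, ← h2, hgradP0]
    rw [hu0, hu1] at hmv
    simpa using hmv

end

/-! ### Bracket algebra of the Hamilton–Jacobi recursion -/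

section

/-- The algebra of the operators `D` and `⟨f, g⟩ = ∂_a f ∂ᵃ g` applied to the potential `V`, and of
the derivative `pb f g = (∂f/∂p_a) (∂g/∂q^a)`, as far as it enters the Hamilton–Jacobi
equation. -/
structure BracketData (A : Type*) [AddCommGroup A] [Module ℝ A] where
  V : A
  D : A →ₗ[ℝ] A
  br : A →ₗ[ℝ] A →ₗ[ℝ] A
  pb : A →ₗ[ℝ] A →ₗ[ℝ] A
  br_comm : ∀ f g, br f g = br g f
  D_br : ∀ f g, D (br f g) = br (D f) g + br f (D g)
  pb_V : ∀ g, pb V g = 0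
  pb_D : ∀ f g, pb (D f) g = br f g + D (pb f g) - pb f (D g)
  -- In this rule and the next, differentiating in the momentum leaves Hessians of V and DV along
  -- two gradients; the right-hand sides express them by brackets.
  pb_br_D : ∀ g, pb (br V (D V)) g = (1 / 2 : ℝ) • br g (br V V)
  pb_br_DD : ∀ g, pb (br V (D (D V))) g =
    br V (br (D V) g) + br g (br V (D V)) - br (D V) (br V g)

namespace BracketData

variable {A : Type*} [AddCommGroup A] [Module ℝ A] (Θ : BracketData A)

/-- The operator `D̄`. -/
def B : A →ₗ[ℝ] A := Θ.br Θ.V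

/-- `Dᵏ V`. -/
def v (k : ℕ) : A := Θ.D^[k] Θ.V

theorem D_v (k : ℕ) : Θ.D (Θ.v k) = Θ.v (k + 1) := (Function.iterate_succ_apply' _ _ _).symm

theorem V_eq : Θ.V = Θ.v 0 := rfl

/-- The terms `T_{2j}` of the effective kinetic energy. -/
def T (j : ℕ) : A :=
  let D := Θ.D
  let B := Θ.B
  let V := Θ.V
  match j with
  | 1 => -(1 / 12 : ℝ) • D (D V)
  | 2 => (1 / 720 : ℝ) • (D^[4] V - (9 : ℝ) • B (D (D V)) + (3 : ℝ) • D (B (D V)))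
  | 3 => -(1 / 60480 : ℝ) • ((2 : ℝ) • D^[6] V - (40 : ℝ) • B (D^[4] V)
      + (46 : ℝ) • D (B (D^[3] V)) - (15 : ℝ) • D (D (B (D (D V))))
      + (54 : ℝ) • B (B (D (D V))) - (9 : ℝ) • B (D (B (D V)))
      - (42 : ℝ) • D (B (B (D V))) + (12 : ℝ) • D (D (B (B V))))
  | _ => 0

/-- The terms `G_k`, `3 ≤ k ≤ 8`, of the generating function. -/
def G (k : ℕ) : A :=
  let D := Θ.D
  let B := Θ.B
  let V := Θ.V
  match k with
  | 3 => -(1 / 12 : ℝ) • D (D V)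
  | 4 => -(1 / 24 : ℝ) • D (D (D V))
  | 5 => -(1 / 240 : ℝ) • ((3 : ℝ) • D^[4] V + (3 : ℝ) • B (D (D V)) - D (B (D V)))
  | 6 => -(1 / 720 : ℝ) • ((2 : ℝ) • D^[5] V + (8 : ℝ) • B (D^[3] V)
      - (5 : ℝ) • D (B (D (D V))))
  | 7 => -(1 / 20160 : ℝ) • ((10 : ℝ) • D^[6] V + (10 : ℝ) • B (D^[4] V)
      + (90 : ℝ) • D (B (D^[3] V)) - (75 : ℝ) • D (D (B (D (D V))))
      + (18 : ℝ) • B (B (D (D V))) - (3 : ℝ) • B (D (B (D V)))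
      - (14 : ℝ) • D (B (B (D V))) + (4 : ℝ) • D (D (B (B V))))
  | 8 => -(1 / 40320 : ℝ) • ((3 : ℝ) • D^[7] V - (87 : ℝ) • B (D^[5] V)
      + (231 : ℝ) • D (B (D^[4] V)) - (133 : ℝ) • D (D (B (D^[3] V)))
      + (63 : ℝ) • B (B (D^[3] V)) - (3 : ℝ) • D (B (B (D (D V))))
      - (21 : ℝ) • D (D (B (B (D V)))) + (4 : ℝ) • D (D (D (B (B V))))
      - (63 : ℝ) • B (D (B (D (D V)))) + (25 : ℝ) • D (B (D (B (D V)))))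
  | _ => 0

/-- The coefficient `f 1 k` of `tᵏ ε²` in the solution of the Hamilton–Jacobi equation over
the time `t`, with the time step `ε` in the Hamiltonian. -/
def f1 : ℕ → A
  | 0 => 0
  | 1 => Θ.T 1
  -- At order ε² the equation is linear, f' = Df + T_2, so each further power of t costs one
  -- application of D.
  | k + 2 => (1 / (k + 2 : ℝ)) • Θ.D (f1 (k + 1))

/-- The coefficient `f 2 k` of `tᵏ ε⁴`; see `f1`. -/
def f2 (k : ℕ) : A :=
  -- At order ε⁴ the sources are ½⟨f, f⟩, which first enters at t³, and the shift of the momentum in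
  -- T_2. Total order at most 8 in ε and t requires only k ≤ 4 here, and k ≤ 2 at order ε⁶.
  let f21 := Θ.T 2
  let f22 := (1 / 2 : ℝ) • (Θ.D f21 + Θ.pb (Θ.T 1) (Θ.f1 1))
  let f23 := (1 / 3 : ℝ) • (Θ.D f22 + (1 / 2 : ℝ) • Θ.br (Θ.f1 1) (Θ.f1 1)
    + Θ.pb (Θ.T 1) (Θ.f1 2))
  match k with
  | 1 => f21
  | 2 => f22
  | 3 => f23
  | 4 => (1 / 4 : ℝ) • (Θ.D f23 + Θ.br (Θ.f1 1) (Θ.f1 2) + Θ.pb (Θ.T 1) (Θ.f1 3))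
  | _ => 0

/-- The coefficient `f 3 k` of `tᵏ ε⁶`; see `f1`. -/
def f3 (k : ℕ) : A :=
  match k with
  | 1 => Θ.T 3
  | 2 => (1 / 2 : ℝ) • (Θ.D (Θ.T 3) + Θ.pb (Θ.T 1) (Θ.f2 1) + Θ.pb (Θ.T 2) (Θ.f1 1))
  | _ => 0

theorem f1_one : Θ.f1 1 = -(1 / 12 : ℝ) • Θ.v 2 := rfl

theorem f1_two : Θ.f1 2 = -(1 / 24 : ℝ) • Θ.v 3 := by
  rw [f1, f1_one, map_smul, D_v]
  module

theorem f1_three : Θ.f1 3 = -(1 / 72 : ℝ) • Θ.v 4 := by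
  rw [f1, f1_two, map_smul, D_v]
  module

theorem f1_four : Θ.f1 4 = -(1 / 288 : ℝ) • Θ.v 5 := by
  rw [f1, f1_three, map_smul, D_v]
  module

theorem f1_five : Θ.f1 5 = -(1 / 1440 : ℝ) • Θ.v 6 := by
  rw [f1, f1_four, map_smul, D_v]
  module

theorem f1_six : Θ.f1 6 = -(1 / 8640 : ℝ) • Θ.v 7 := by
  rw [f1, f1_five, map_smul, D_v]
  module

/-- The first case of pb (DᵏV) g = k⟨Dᵏ⁻¹V, g⟩: each of the k momenta in DᵏV can be the one that is
differentiated. -/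
theorem pb_DV (g : A) : Θ.pb (Θ.D Θ.V) g = Θ.br Θ.V g := by
  rw [pb_D, pb_V, pb_V, map_zero, add_zero, sub_zero]

theorem pb_DDV (g : A) : Θ.pb (Θ.D (Θ.D Θ.V)) g = (2 : ℝ) • Θ.br (Θ.D Θ.V) g := by
  rw [pb_D, pb_DV, pb_DV, D_br]
  module

theorem pb_DDDV (g : A) : Θ.pb (Θ.D (Θ.D (Θ.D Θ.V))) g = (3 : ℝ) • Θ.br (Θ.D (Θ.D Θ.V)) g := by
  rw [pb_D, pb_DDV, pb_DDV, map_smul, D_br]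
  module

theorem pb_DDDDV (g : A) :
    Θ.pb (Θ.D (Θ.D (Θ.D (Θ.D Θ.V)))) g = (4 : ℝ) • Θ.br (Θ.D (Θ.D (Θ.D Θ.V))) g := by
  rw [pb_D, pb_DDDV, pb_DDDV, map_smul, D_br]
  module

theorem pb_T_one (g : A) : Θ.pb (Θ.T 1) g = -(1 / 6 : ℝ) • Θ.br (Θ.v 1) g := by
  simp only [T, map_smul, LinearMap.smul_apply, pb_DDV, v, Function.iterate_succ,
    Function.iterate_zero, Function.comp, id]
  module

/-- Since D is a derivation of the bracket, operator words become linear combinations of nested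
brackets of the DᵏV, in which identities can be compared term by term. -/
theorem T_two : Θ.T 2 = (1 / 720 : ℝ) •
    (Θ.v 4 - (6 : ℝ) • Θ.br (Θ.v 0) (Θ.v 2) + (3 : ℝ) • Θ.br (Θ.v 1) (Θ.v 1)) := by
  simp only [T, B, D_br, v, Function.iterate_succ, Function.iterate_zero, Function.comp, id]
  module

theorem T_three : Θ.T 3 = -(1 / 60480 : ℝ) • ((2 : ℝ) • Θ.D^[6] Θ.V - (40 : ℝ) • Θ.B (Θ.D^[4] Θ.V)
      + (46 : ℝ) • Θ.D (Θ.B (Θ.D^[3] Θ.V)) - (15 : ℝ) • Θ.D (Θ.D (Θ.B (Θ.D (Θ.D Θ.V))))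
      + (54 : ℝ) • Θ.B (Θ.B (Θ.D (Θ.D Θ.V))) - (9 : ℝ) • Θ.B (Θ.D (Θ.B (Θ.D Θ.V)))
      - (42 : ℝ) • Θ.D (Θ.B (Θ.B (Θ.D Θ.V))) + (12 : ℝ) • Θ.D (Θ.D (Θ.B (Θ.B Θ.V)))) := rfl

theorem pb_T_two (g : A) : Θ.pb (Θ.T 2) g = (1 / 720 : ℝ) • ((4 : ℝ) • Θ.br (Θ.v 3) g
    - (9 : ℝ) • (Θ.br (Θ.v 0) (Θ.br (Θ.v 1) g) + Θ.br g (Θ.br (Θ.v 0) (Θ.v 1))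
      - Θ.br (Θ.v 1) (Θ.br (Θ.v 0) g))
    + (3 : ℝ) • (Θ.br (Θ.br (Θ.v 0) (Θ.v 1)) g
      + Θ.D ((1 / 2 : ℝ) • Θ.br g (Θ.br (Θ.v 0) (Θ.v 0)))
      - (1 / 2 : ℝ) • Θ.br (Θ.D g) (Θ.br (Θ.v 0) (Θ.v 0)))) := by
  simp only [T, B, map_smul, map_add, map_sub, LinearMap.smul_apply, LinearMap.add_apply,
    LinearMap.sub_apply, v, Function.iterate_succ, Function.iterate_zero, Function.comp, id,
    pb_DDDDV, pb_br_DD, pb_D _ (Θ.br Θ.V (Θ.D Θ.V)), pb_br_D]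

theorem f2_two : Θ.f2 2 = (1 / 2 : ℝ) • (Θ.D (Θ.f2 1) + Θ.pb (Θ.T 1) (Θ.f1 1)) := rfl

theorem f2_three : Θ.f2 3 = (1 / 3 : ℝ) • (Θ.D (Θ.f2 2) +
    (1 / 2 : ℝ) • Θ.br (Θ.f1 1) (Θ.f1 1) + Θ.pb (Θ.T 1) (Θ.f1 2)) := rfl

theorem f2_four : Θ.f2 4 = (1 / 4 : ℝ) • (Θ.D (Θ.f2 3) + Θ.br (Θ.f1 1) (Θ.f1 2)
    + Θ.pb (Θ.T 1) (Θ.f1 3)) := rfl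

theorem f3_two : Θ.f3 2 = (1 / 2 : ℝ) • (Θ.D (Θ.f3 1) + Θ.pb (Θ.T 1) (Θ.f2 1)
    + Θ.pb (Θ.T 2) (Θ.f1 1)) := rfl

theorem G_three : Θ.f1 1 = Θ.G 3 := rfl

theorem G_four : Θ.f1 2 = Θ.G 4 := f1_two Θ

set_option linter.unusedSimpArgs false

/-- Setting t = ε = τ, the coefficient of τᵏ collects `f1 (k - 2)`, `f2 (k - 4)` and `f3 (k - 6)`.
This identity and the next three are verified by expanding both sides into nested brackets of the
DᵏV, ordering the arguments by symmetry where necessary, and comparing coefficients. -/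
theorem G_five : Θ.f1 3 + Θ.f2 1 = Θ.G 5 := by
  simp only [G, B, f2_four, f2_three, f2_two, f3_two, show Θ.f2 1 = Θ.T 2 from rfl,
    show Θ.f3 1 = Θ.T 3 from rfl, pb_T_one, T_two, T_three, f1_one, f1_two, f1_three,
    f1_four, f1_five, f1_six, Function.iterate_succ, Function.iterate_zero, Function.comp, id,
    V_eq, D_v, D_br, map_add, map_sub, map_smul, LinearMap.add_apply, LinearMap.sub_apply,
    LinearMap.smul_apply, Nat.reduceAdd, zero_add]
  module

theorem G_six : Θ.f1 4 + Θ.f2 2 = Θ.G 6 := by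
  simp only [G, B, f2_four, f2_three, f2_two, f3_two, show Θ.f2 1 = Θ.T 2 from rfl,
    show Θ.f3 1 = Θ.T 3 from rfl, pb_T_one, T_two, T_three, f1_one, f1_two, f1_three,
    f1_four, f1_five, f1_six, Function.iterate_succ, Function.iterate_zero, Function.comp, id,
    V_eq, D_v, D_br, map_add, map_sub, map_smul, LinearMap.add_apply, LinearMap.sub_apply,
    LinearMap.smul_apply, Nat.reduceAdd, zero_add]
  simp only [Θ.br_comm]
  module

theorem G_seven : Θ.f1 5 + Θ.f2 3 + Θ.f3 1 = Θ.G 7 := by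
  simp only [G, B, f2_four, f2_three, f2_two, f3_two, show Θ.f2 1 = Θ.T 2 from rfl,
    show Θ.f3 1 = Θ.T 3 from rfl, pb_T_one, T_two, T_three, f1_one, f1_two, f1_three,
    f1_four, f1_five, f1_six, Function.iterate_succ, Function.iterate_zero, Function.comp, id,
    V_eq, D_v, D_br, map_add, map_sub, map_smul, LinearMap.add_apply, LinearMap.sub_apply,
    LinearMap.smul_apply, Nat.reduceAdd, zero_add]
  simp only [Θ.br_comm]
  module

theorem G_eight : Θ.f1 6 + Θ.f2 4 + Θ.f3 2 = Θ.G 8 := by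
  -- `pb (T 2)` must be evaluated before `T_two` rewrites its argument: there is no rule for pb of
  -- ⟨DV, DV⟩.
  rw [f3_two, pb_T_two]
  simp only [G, B, f2_four, f2_three, f2_two, show Θ.f2 1 = Θ.T 2 from rfl,
    show Θ.f3 1 = Θ.T 3 from rfl, pb_T_one, T_two, T_three, f1_one, f1_two, f1_three,
    f1_four, f1_five, f1_six, Function.iterate_succ, Function.iterate_zero, Function.comp, id,
    V_eq, D_v, D_br, map_add, map_sub, map_smul, LinearMap.add_apply, LinearMap.sub_apply,
    LinearMap.smul_apply, Nat.reduceAdd, zero_add]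
  simp only [Θ.br_comm]
  module

end BracketData

end

/-! ### Smooth functions on phase space as a model of the algebra -/

section

variable {n : ℕ}

/-- The algebra of smooth functions on phase space. -/
def smoothFun (n : ℕ) : Subalgebra ℝ (Phase n → ℝ) where
  carrier := {f | ContDiff ℝ ∞ f}
  mul_mem' := fun {f g} (hf : ContDiff ℝ ∞ f) (hg : ContDiff ℝ ∞ g) => ContDiff.mul hf hg
  add_mem' := fun {f g} (hf : ContDiff ℝ ∞ f) (hg : ContDiff ℝ ∞ g) => ContDiff.add hf hg
  algebraMap_mem' c := (contDiff_const : ContDiff ℝ ∞ fun _ : Phase n => c)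

namespace smoothFun

theorem contDiff (f : smoothFun n) : ContDiff ℝ ∞ f.1 := f.2

/-- A smooth function as an element of the algebra. -/
def mk (f : Phase n → ℝ) (hf : ContDiff ℝ ∞ f) : smoothFun n := ⟨f, hf⟩

/-- The derivative in a constant direction. -/
def der (v : Phase n) : Derivation ℝ (smoothFun n) (smoothFun n) :=
  Derivation.mk'
    { toFun := fun f => ⟨dirD v f.1, contDiff_dirD v f.2⟩
      map_add' := fun f g => by
        ext z
        have hf := (contDiff f).differentiable (by simp) z
        have hg := (contDiff g).differentiable (by simp) z
        have h : fderiv ℝ (f.1 + g.1) z = fderiv ℝ f.1 z + fderiv ℝ g.1 z := fderiv_add hf hg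
        change fderiv ℝ (f.1 + g.1) z v = _
        rw [h]
        rfl
      map_smul' := fun c f => by
        ext z
        have hf := (contDiff f).differentiable (by simp) z
        have h : fderiv ℝ (c • f.1) z = c • fderiv ℝ f.1 z := fderiv_const_smul hf c
        change fderiv ℝ (c • f.1) z v = _
        rw [h]
        rfl }
    fun f g => by
      ext z
      have hf := (contDiff f).differentiable (by simp) z
      have hg := (contDiff g).differentiable (by simp) z
      have h : fderiv ℝ (f.1 * g.1) z = f.1 z • fderiv ℝ g.1 z + g.1 z • fderiv ℝ f.1 z :=
        fderiv_mul hf hg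
      change fderiv ℝ (f.1 * g.1) z v = _
      rw [h]
      rfl

theorem der_comm (v w : Phase n) (f : smoothFun n) : der v (der w f) = der w (der v f) :=
  Subtype.ext (dirD_comm v w f.2)

/-- `∂/∂q^a`. -/
def dq (a : Fin n) : Derivation ℝ (smoothFun n) (smoothFun n) := der (unitV a, 0)

/-- `∂/∂p_a`. -/
def dp (a : Fin n) : Derivation ℝ (smoothFun n) (smoothFun n) := der (0, unitV a)

/-- The momentum `p_a`. -/
def mom (a : Fin n) : smoothFun n :=
  mk (fun z => z.2 a) ((contDiff_apply ℝ ℝ a).comp contDiff_snd)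

/-- A function of the positions. -/
def ofPos (V : Coord n → ℝ) (hV : ContDiff ℝ ∞ V) : smoothFun n :=
  mk (fun z => V z.1) (hV.comp contDiff_fst)

theorem hasFDerivAt_mom (a : Fin n) (z : Phase n) : HasFDerivAt (fun z : Phase n => z.2 a)
    ((ContinuousLinearMap.proj (R := ℝ) (φ := fun _ : Fin n => ℝ) a).comp
      (ContinuousLinearMap.snd ℝ (Coord n) (Coord n))) z :=
  ((ContinuousLinearMap.proj (R := ℝ) (φ := fun _ : Fin n => ℝ) a).comp
      (ContinuousLinearMap.snd ℝ (Coord n) (Coord n))).hasFDerivAt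

theorem dq_mom (a b : Fin n) : dq a (mom b) = 0 := by
  ext z
  change fderiv ℝ (fun z : Phase n => z.2 b) z (unitV a, 0) = 0
  rw [(hasFDerivAt_mom b z).fderiv]
  rfl

theorem dp_mom (a b : Fin n) : dp a (mom b) = if a = b then 1 else 0 := by
  have h : ∀ z : Phase n, (dp a (mom b)).1 z = if a = b then 1 else 0 := by
    intro z
    change fderiv ℝ (fun z : Phase n => z.2 b) z (0, unitV a) = _
    rw [(hasFDerivAt_mom b z).fderiv]
    simp [unitV, Pi.single_apply, eq_comm]
  ext z
  refine (h z).trans ?_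
  split <;> rfl

theorem dp_ofPos (a : Fin n) (V : Coord n → ℝ) (hV : ContDiff ℝ ∞ V) : dp a (ofPos V hV) = 0 := by
  ext z
  change fderiv ℝ (fun z : Phase n => V z.1) z (0, unitV a) = 0
  have h := HasFDerivAt.comp z (hV.differentiable (by simp) z.1).hasFDerivAt
    (hasFDerivAt_fst (𝕜 := ℝ) (p := z))
  rw [Function.comp_def] at h
  rw [h.fderiv]
  simp

theorem dq_comm (a b : Fin n) (f : smoothFun n) : dq a (dq b f) = dq b (dq a f) :=
  der_comm _ _ _

theorem dp_dq (a b : Fin n) (f : smoothFun n) : dp a (dq b f) = dq b (dp a f) :=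
  der_comm _ _ _

section
variable (M : Matrix (Fin n) (Fin n) ℝ)

/-- The gradient with raised index, `∂ᵃ f`. -/
def up (f : smoothFun n) (a : Fin n) : smoothFun n := ∑ b, M a b • dq b f

/-- The operator `⟨f, ·⟩`. -/
def grad (f : smoothFun n) : Derivation ℝ (smoothFun n) (smoothFun n) := ∑ a, up M f a • dq a

/-- The operator `D`. -/
def opDer : Derivation ℝ (smoothFun n) (smoothFun n) := ∑ a, (∑ b, M b a • mom b) • dq a

theorem sum_derivation_apply (c : Fin n → smoothFun n)
    (δ : Fin n → Derivation ℝ (smoothFun n) (smoothFun n)) (f : smoothFun n) :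
    (∑ a, c a • δ a) f = ∑ a, c a * δ a f := by
  rw [← Derivation.coeFnAddMonoidHom_apply, map_sum, Finset.sum_apply]
  rfl

theorem grad_apply (f g : smoothFun n) : grad M f g = ∑ a, up M f a * dq a g :=
  sum_derivation_apply _ _ _

theorem opDer_apply (f : smoothFun n) : opDer M f = ∑ a, (∑ b, M b a • mom b) * dq a f :=
  sum_derivation_apply _ _ _

variable {M}

theorem grad_comm (hM : M.IsSymm) (f g : smoothFun n) : grad M f g = grad M g f := by
  simp only [grad_apply, up, Finset.sum_mul]
  rw [Finset.sum_comm]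
  refine Finset.sum_congr rfl fun b _ => Finset.sum_congr rfl fun a _ => ?_
  rw [smul_mul_assoc, smul_mul_assoc, mul_comm, hM.apply]

theorem dq_opDer (c : Fin n) (f : smoothFun n) : dq c (opDer M f) = opDer M (dq c f) := by
  simp only [opDer_apply, map_sum, Derivation.leibniz, Derivation.map_smul, dq_mom, smul_zero,
    Finset.sum_const_zero, smul_eq_mul, mul_zero, add_zero, dq_comm c]

theorem up_opDer (f : smoothFun n) (a : Fin n) : up M (opDer M f) a = opDer M (up M f a) := by
  simp only [up, map_sum, Derivation.map_smul, dq_opDer]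

theorem opDer_grad (f g : smoothFun n) :
    opDer M (grad M f g) = grad M (opDer M f) g + grad M f (opDer M g) := by
  simp only [grad_apply, map_sum, Derivation.leibniz, smul_eq_mul, up_opDer, dq_opDer,
    ← Finset.sum_add_distrib]
  refine Finset.sum_congr rfl fun a _ => ?_
  ring

/-- The derivative `(∂f/∂p_a) (∂g/∂q^a)`. -/
def pair (f g : smoothFun n) : smoothFun n := ∑ a, dp a f * dq a g

/-- The commutator of ∂/∂p_c with D is ∂ᶜ, because D is linear in p. The rules for `pair` rest on
this. -/
theorem dp_opDer (hM : M.IsSymm) (c : Fin n) (f : smoothFun n) :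
    dp c (opDer M f) = up M f c + opDer M (dp c f) := by
  simp only [opDer_apply, map_sum, Derivation.leibniz, Derivation.map_smul, dp_mom,
    smul_eq_mul, up, dp_dq, smul_ite, smul_zero, Finset.sum_ite_eq, Finset.mem_univ, if_true,
    Finset.sum_add_distrib]
  rw [add_comm]
  congr 1
  refine Finset.sum_congr rfl fun a _ => ?_
  rw [mul_smul_comm, mul_one, hM.apply]

theorem pair_opDer (hM : M.IsSymm) (f g : smoothFun n) :
    pair (opDer M f) g = grad M f g + opDer M (pair f g) - pair f (opDer M g) := by
  simp only [pair, grad_apply, dp_opDer hM, map_sum, Derivation.leibniz, smul_eq_mul, dq_opDer,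
    ← Finset.sum_add_distrib, ← Finset.sum_sub_distrib]
  refine Finset.sum_congr rfl fun a _ => ?_
  ring

/-- The Hessian of `h` along the gradients of `f` and `g`. -/
def hes (M : Matrix (Fin n) (Fin n) ℝ) (f h g : smoothFun n) : smoothFun n :=
  ∑ a, ∑ b, up M f a * up M g b * dq a (dq b h)

theorem hes_comm (f h g : smoothFun n) : hes M f h g = hes M g h f := by
  unfold hes
  rw [Finset.sum_comm]
  refine Finset.sum_congr rfl fun a _ => Finset.sum_congr rfl fun b _ => ?_
  rw [dq_comm]
  ring

theorem sum_grad_dq (f h g : smoothFun n) :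
    ∑ b, grad M f (dq b h) * up M g b = hes M f h g := by
  unfold hes
  rw [Finset.sum_comm]
  simp only [grad_apply, Finset.sum_mul]
  refine Finset.sum_congr rfl fun a _ => Finset.sum_congr rfl fun b _ => ?_
  ring

theorem sum_up_mul_dq (hM : M.IsSymm) (u : Fin n → smoothFun n) (g : smoothFun n) :
    ∑ a, (∑ b, M a b • u b) * dq a g = ∑ b, u b * up M g b := by
  simp only [up, Finset.sum_mul, Finset.mul_sum]
  rw [Finset.sum_comm]
  refine Finset.sum_congr rfl fun b _ => Finset.sum_congr rfl fun a _ => ?_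
  rw [smul_mul_assoc, mul_smul_comm, hM.apply]

theorem grad_grad (hM : M.IsSymm) (f h g : smoothFun n) :
    grad M f (grad M h g) = hes M f h g + hes M f g h := by
  rw [← sum_grad_dq, ← sum_grad_dq, ← Finset.sum_add_distrib]
  conv_lhs => rw [grad_comm hM h g]
  simp only [grad_apply M g h, map_sum, Derivation.leibniz, smul_eq_mul]
  rw [Finset.sum_add_distrib, Finset.sum_add_distrib]
  congr 1
  · exact Finset.sum_congr rfl fun a _ => mul_comm _ _
  · have h1 : ∀ a, grad M f (up M g a) = ∑ b, M a b • grad M f (dq b g) := fun a => by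
      simp only [up, map_sum, Derivation.map_smul]
    simp only [h1]
    rw [← sum_up_mul_dq hM]
    exact Finset.sum_congr rfl fun a _ => mul_comm _ _

/-- A Koszul-type formula: each iterated bracket is a sum of two Hessian terms (`grad_grad`), and in
the alternating sum the Hessians of f and g cancel. -/
theorem two_hes (hM : M.IsSymm) (f h g : smoothFun n) :
    hes M f h g + hes M f h g =
      grad M f (grad M h g) + grad M g (grad M f h) - grad M h (grad M f g) := by
  rw [grad_grad hM, grad_grad hM, grad_grad hM, hes_comm g h f, hes_comm g f h, hes_comm h g f]
  ring

theorem dp_grad {f : smoothFun n} (hf : ∀ a, dp a f = 0) (c : Fin n) (h : smoothFun n) :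
    dp c (grad M f h) = grad M f (dp c h) := by
  have h1 : ∀ a, dp c (up M f a) = 0 := fun a => by
    simp only [up, map_sum, Derivation.map_smul, dp_dq, hf, map_zero, smul_zero,
      Finset.sum_const_zero]
  simp only [grad_apply, map_sum, Derivation.leibniz, h1, dp_dq, smul_eq_mul,
    mul_zero, add_zero]

theorem grad_up (f h : smoothFun n) (c : Fin n) :
    grad M f (up M h c) = ∑ b, M c b • grad M f (dq b h) := by
  simp only [up, map_sum, Derivation.map_smul]

/-- As f does not depend on p, ∂/∂p_c passes through ⟨f, ·⟩ and turns Df into ∂ᶜf. -/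
theorem pair_grad_opDer (hM : M.IsSymm) {f : smoothFun n} (hf : ∀ a, dp a f = 0)
    (g : smoothFun n) : pair (grad M f (opDer M f)) g = hes M f f g := by
  simp only [pair, dp_grad hf, dp_opDer hM, hf, map_zero, add_zero, grad_up]
  rw [sum_up_mul_dq hM, sum_grad_dq]

theorem pair_grad_opDer_opDer (hM : M.IsSymm) {f : smoothFun n} (hf : ∀ a, dp a f = 0)
    (g : smoothFun n) : pair (grad M f (opDer M (opDer M f))) g =
      hes M f (opDer M f) g + hes M f (opDer M f) g := by
  have h1 : ∀ c, dp c (opDer M (opDer M f)) = up M (opDer M f) c + up M (opDer M f) c := fun c => by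
    rw [dp_opDer hM, dp_opDer hM, hf, map_zero, add_zero, ← up_opDer]
  simp only [pair, dp_grad hf, h1, map_add, grad_up, add_mul, Finset.sum_add_distrib]
  rw [sum_up_mul_dq hM, sum_grad_dq]

end

/-- The bracket as a bilinear map. -/
def brL (M : Matrix (Fin n) (Fin n) ℝ) : smoothFun n →ₗ[ℝ] smoothFun n →ₗ[ℝ] smoothFun n :=
  LinearMap.mk₂ ℝ (fun f g => grad M f g)
    (fun f f' g => by
      simp only [grad_apply, up, map_add, smul_add, Finset.sum_add_distrib, add_mul])
    (fun c f g => by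
      simp only [grad_apply, up, Derivation.map_smul, Finset.smul_sum, Finset.sum_mul, smul_mul_assoc,
        smul_comm c])
    (fun f g g' => map_add _ _ _) (fun c f g => Derivation.map_smul _ _ _)

/-- The derivative along momenta as a bilinear map. -/
def pairL : smoothFun n →ₗ[ℝ] smoothFun n →ₗ[ℝ] smoothFun n :=
  LinearMap.mk₂ ℝ (fun f g => pair f g)
    (fun f f' g => by simp only [pair, map_add, add_mul, Finset.sum_add_distrib])
    (fun c f g => by simp only [pair, Derivation.map_smul, smul_mul_assoc, Finset.smul_sum])
    (fun f g g' => by simp only [pair, map_add, mul_add, Finset.sum_add_distrib])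
    (fun c f g => by simp only [pair, Derivation.map_smul, mul_smul_comm, Finset.smul_sum])

/-- The operators of the effective kinetic energy on smooth functions on phase space. -/
def bracketData (M : Matrix (Fin n) (Fin n) ℝ) (hM : M.IsSymm) (V : Coord n → ℝ)
    (hV : ContDiff ℝ ∞ V) : BracketData (smoothFun n) where
  V := ofPos V hV
  D := (opDer M : smoothFun n →ₗ[ℝ] smoothFun n)
  br := brL M
  pb := pairL
  br_comm f g := grad_comm hM f g
  D_br f g := opDer_grad f g
  pb_V g := by
    change pair _ _ = _
    simp only [pair, dp_ofPos, zero_mul, Finset.sum_const_zero]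
  pb_D f g := pair_opDer hM f g
  pb_br_D g := by
    change pair (grad M _ (opDer M _)) g = (1 / 2 : ℝ) • grad M g (grad M _ _)
    rw [pair_grad_opDer hM fun a => dp_ofPos a V hV]
    have h := two_hes hM (ofPos V hV) (ofPos V hV) g
    rw [add_sub_cancel_left] at h
    rw [← h, ← two_smul ℝ, smul_smul]
    norm_num
  pb_br_DD g := by
    change pair (grad M _ (opDer M (opDer M _))) g = grad M _ (grad M (opDer M _) g)
      + grad M g (grad M _ (opDer M _)) - grad M (opDer M _) (grad M _ g)
    rw [pair_grad_opDer_opDer hM fun a => dp_ofPos a V hV, two_hes hM]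

end smoothFun

open smoothFun

/-- The restriction of a function on phase space to a fixed momentum. -/
def slice (p : Coord n) (f : smoothFun n) : Coord n → ℝ := fun q => f.1 (q, p)

theorem pd_slice (p : Coord n) (f : smoothFun n) (a : Fin n) (q : Coord n) :
    pd a (slice p f) q = (dq a f).1 (q, p) := by
  have h : HasFDerivAt (fun q : Coord n => ((q, p) : Phase n))
      ((ContinuousLinearMap.id ℝ (Coord n)).prod (0 : Coord n →L[ℝ] Coord n)) q :=
    (hasFDerivAt_id q).prodMk (hasFDerivAt_const _ _)
  exact pd_eq_of_comp f.2 h a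

theorem coe_sum_apply {ι : Type*} (s : Finset ι) (f : ι → smoothFun n) (z : Phase n) :
    (∑ i ∈ s, f i).1 z = ∑ i ∈ s, (f i).1 z := by
  have h : (∑ i ∈ s, f i).1 = ∑ i ∈ s, (f i).1 := AddSubmonoidClass.coe_finsetSum f s
  rw [h, Finset.sum_apply]

/-- The phase space operator does not differentiate in p, so it commutes with freezing the momentum.
This transfers operator words from the definitions to the algebra. -/
theorem opD_slice (M : Matrix (Fin n) (Fin n) ℝ) (p : Coord n) (f : smoothFun n) :
    opD M p (slice p f) = slice p (opDer M f) := by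
  funext q
  simp only [opD, slice, opDer_apply, coe_sum_apply, pd_slice]
  rw [Finset.sum_comm]
  refine Finset.sum_congr rfl fun b _ => ?_
  change _ = (∑ a, M a b • mom a).1 (q, p) * _
  rw [coe_sum_apply, Finset.sum_mul]
  refine Finset.sum_congr rfl fun a _ => ?_
  change p a * M a b * _ = M a b * p a * _
  ring

theorem opB_slice (M : Matrix (Fin n) (Fin n) ℝ) (hM : M.IsSymm) {V : Coord n → ℝ}
    (hV : ContDiff ℝ ∞ V) (p : Coord n) (f : smoothFun n) :
    opB M V (slice p f) = slice p (grad M (ofPos V hV) f) := by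
  funext q
  have hVs : V = slice p (ofPos V hV) := rfl
  have hVp : ∀ a, pd a V q = (dq a (ofPos V hV)).1 (q, p) := fun a => by
    rw [← pd_slice p]; rfl
  simp only [opB, slice, grad_apply, coe_sum_apply, pd_slice, hVp]
  rw [Finset.sum_comm]
  refine Finset.sum_congr rfl fun b _ => ?_
  change _ = (∑ a, M b a • dq a (ofPos V hV)).1 (q, p) * _
  rw [coe_sum_apply, Finset.sum_mul]
  refine Finset.sum_congr rfl fun a _ => ?_
  change _ * M a b * _ = M b a * _ * _
  rw [hM.apply]
  ring

theorem opB_pot (M : Matrix (Fin n) (Fin n) ℝ) (hM : M.IsSymm) {V : Coord n → ℝ}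
    (hV : ContDiff ℝ ∞ V) (p : Coord n) :
    opB M V V = slice p (grad M (ofPos V hV) (ofPos V hV)) :=
  opB_slice M hM hV p (ofPos V hV)

/-- The evaluation at a point. -/
def evalAt (z : Phase n) : smoothFun n →ₗ[ℝ] ℝ where
  toFun f := f.1 z
  map_add' _ _ := rfl
  map_smul' _ _ := rfl

section
variable (M : Matrix (Fin n) (Fin n) ℝ) (hM : M.IsSymm) {V : Coord n → ℝ}
  (hV : ContDiff ℝ ∞ V)

theorem slice_eq_evalAt (f : smoothFun n) (q p : Coord n) : slice p f q = evalAt (q, p) f := rfl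

theorem opD_pot (p : Coord n) : opD M p V = slice p (opDer M (ofPos V hV)) :=
  opD_slice M p (ofPos V hV)

theorem bracketData_D (f : smoothFun n) : (bracketData M hM V hV).D f = opDer M f := rfl

theorem bracketData_B (f : smoothFun n) :
    (bracketData M hM V hV).B f = grad M (ofPos V hV) f := rfl

theorem bracketData_V : (bracketData M hM V hV).V = ofPos V hV := rfl

theorem Tcoeff_eq {j : ℕ} (hj : j ≠ 0) (q p : Coord n) :
    Tcoeff M V j q p = evalAt (q, p) ((bracketData M hM V hV).T j) := by
  match j with
  | 1 | 2 | 3 =>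
    simp only [Tcoeff, BracketData.T, Function.iterate_succ, Function.iterate_zero, Function.comp,
      id, bracketData_D, bracketData_B, bracketData_V, map_add, map_sub, map_smul, smul_eq_mul,
      opD_pot M hV, opB_pot M hM hV p, opD_slice, opB_slice M hM hV, slice_eq_evalAt]
  | j + 4 => rfl

theorem Gcoeff_eq {k : ℕ} (hk : 3 ≤ k) (q P : Coord n) :
    Gcoeff M V k q P = evalAt (q, P) ((bracketData M hM V hV).G k) := by
  match k with
  | 3 | 4 | 5 | 6 | 7 | 8 =>
    simp only [Gcoeff, BracketData.G, Function.iterate_succ, Function.iterate_zero, Function.comp,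
      id, bracketData_D, bracketData_B, bracketData_V, map_add, map_sub, map_smul, smul_eq_mul,
      opD_pot M hV, opB_pot M hM hV P, opD_slice, opB_slice M hM hV, slice_eq_evalAt]
  | k + 9 => rfl

end

end

/-! ### The truncated solution of the Hamilton–Jacobi equation -/

section

namespace BracketData

variable {A : Type*} [AddCommGroup A] [Module ℝ A] (Θ : BracketData A)

/-- The solution of the Hamilton–Jacobi equation over the fraction `θ` of the time step `τ` is
`∑ i, τ ^ (i + 3) w i θ`. -/
def w (i : ℕ) (θ : ℝ) : A :=
  match i with
  | 0 => θ • Θ.f1 1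
  | 1 => θ ^ 2 • Θ.f1 2
  | 2 => θ ^ 3 • Θ.f1 3 + θ • Θ.f2 1
  | 3 => θ ^ 4 • Θ.f1 4 + θ ^ 2 • Θ.f2 2
  | 4 => θ ^ 5 • Θ.f1 5 + θ ^ 3 • Θ.f2 3 + θ • Θ.f3 1
  | 5 => θ ^ 6 • Θ.f1 6 + θ ^ 4 • Θ.f2 4 + θ ^ 2 • Θ.f3 2
  | _ => 0

/-- The derivative of `w i` in `θ`. -/
def w' (i : ℕ) (θ : ℝ) : A :=
  match i with
  | 0 => Θ.T 1
  | 1 => Θ.D (Θ.w 0 θ)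
  | 2 => Θ.D (Θ.w 1 θ) + Θ.T 2
  | 3 => Θ.D (Θ.w 2 θ) + Θ.pb (Θ.T 1) (Θ.w 0 θ)
  | 4 => Θ.D (Θ.w 3 θ) + (1 / 2 : ℝ) • Θ.br (Θ.w 0 θ) (Θ.w 0 θ) + Θ.pb (Θ.T 1) (Θ.w 1 θ)
    + Θ.T 3
  | 5 => Θ.D (Θ.w 4 θ) + Θ.br (Θ.w 0 θ) (Θ.w 1 θ) + Θ.pb (Θ.T 1) (Θ.w 2 θ)
    + Θ.pb (Θ.T 2) (Θ.w 0 θ)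
  | _ => 0

/-- `w'` is defined as the part of order τ^(i+3) of the right-hand side of the Hamilton–Jacobi
equation. The recursions for `f1`, `f2`, `f3` turn it into the termwise θ-derivative of `w`. -/
theorem w'_eq (i : ℕ) (θ : ℝ) : Θ.w' i θ =
    match i with
    | 0 => Θ.f1 1
    | 1 => (2 * θ) • Θ.f1 2
    | 2 => (3 * θ ^ 2) • Θ.f1 3 + Θ.f2 1
    | 3 => (4 * θ ^ 3) • Θ.f1 4 + (2 * θ) • Θ.f2 2
    | 4 => (5 * θ ^ 4) • Θ.f1 5 + (3 * θ ^ 2) • Θ.f2 3 + Θ.f3 1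
    | 5 => (6 * θ ^ 5) • Θ.f1 6 + (4 * θ ^ 3) • Θ.f2 4 + (2 * θ) • Θ.f3 2
    | _ => 0 := by
  have h2 : (2 : ℝ) • Θ.f1 2 = Θ.D (Θ.f1 1) := by rw [f1_two, f1_one, map_smul, D_v]; module
  have h3 : (3 : ℝ) • Θ.f1 3 = Θ.D (Θ.f1 2) := by rw [f1_three, f1_two, map_smul, D_v]; module
  have h4 : (4 : ℝ) • Θ.f1 4 = Θ.D (Θ.f1 3) := by rw [f1_four, f1_three, map_smul, D_v]; module
  have h5 : (5 : ℝ) • Θ.f1 5 = Θ.D (Θ.f1 4) := by rw [f1_five, f1_four, map_smul, D_v]; module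
  have h6 : (6 : ℝ) • Θ.f1 6 = Θ.D (Θ.f1 5) := by rw [f1_six, f1_five, map_smul, D_v]; module
  have k2 : (2 : ℝ) • Θ.f2 2 = Θ.D (Θ.f2 1) + Θ.pb (Θ.T 1) (Θ.f1 1) := by rw [f2_two]; module
  have k3 : (3 : ℝ) • Θ.f2 3 = Θ.D (Θ.f2 2) + (1 / 2 : ℝ) • Θ.br (Θ.f1 1) (Θ.f1 1)
      + Θ.pb (Θ.T 1) (Θ.f1 2) := by rw [f2_three]; module
  have k4 : (4 : ℝ) • Θ.f2 4 = Θ.D (Θ.f2 3) + Θ.br (Θ.f1 1) (Θ.f1 2)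
      + Θ.pb (Θ.T 1) (Θ.f1 3) := by rw [f2_four]; module
  have l2 : (2 : ℝ) • Θ.f3 2 = Θ.D (Θ.f3 1) + Θ.pb (Θ.T 1) (Θ.f2 1)
      + Θ.pb (Θ.T 2) (Θ.f1 1) := by rw [f3_two]; module
  have j1 : Θ.f1 1 = Θ.T 1 := rfl
  have j2 : Θ.f2 1 = Θ.T 2 := rfl
  have j3 : Θ.f3 1 = Θ.T 3 := rfl
  match i with
  | 0 => rfl
  | 1 => simp only [w', w, map_smul, ← h2]; module
  | 2 => simp only [w', w, map_smul, ← h3, j2]; module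
  | 3 =>
    simp only [w', w, map_smul, map_add, ← h4, mul_comm (2 : ℝ) θ, mul_smul θ, k2]
    module
  | 4 =>
    simp only [w', w, map_smul, map_add, LinearMap.smul_apply, ← h5, mul_comm (3 : ℝ),
      mul_smul _ (3 : ℝ), k3, j3]
    module
  | 5 =>
    simp only [w', w, map_smul, map_add, LinearMap.smul_apply, ← h6,
      mul_comm (4 : ℝ), mul_comm (2 : ℝ) θ, mul_smul _ (4 : ℝ), mul_smul _ (2 : ℝ), k4, l2]
    module
  | i + 6 => rfl

/-- No topology is given on A, so derivatives are tested with linear functionals; in the application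
ℓ is the evaluation at a point. -/
theorem hasDerivAt_w (ℓ : A →ₗ[ℝ] ℝ) (i : ℕ) (θ : ℝ) :
    HasDerivAt (fun θ => ℓ (Θ.w i θ)) (ℓ (Θ.w' i θ)) θ := by
  have hp : ∀ (k : ℕ) (c : ℝ), HasDerivAt (fun θ : ℝ => θ ^ k * c) (k * θ ^ (k - 1) * c) θ :=
    fun k c => (hasDerivAt_pow k θ).mul_const c
  have h1 : ∀ c : ℝ, HasDerivAt (fun θ : ℝ => θ * c) c θ := fun c => by
    simpa using (hasDerivAt_id θ).mul_const c
  rw [w'_eq]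
  match i with
  | 0 => simpa only [w, map_smul, smul_eq_mul] using h1 _
  | 1 => simpa [w] using hp 2 _
  | 2 => simpa [w] using (hp 3 _).fun_add (h1 _)
  | 3 => simpa [w] using (hp 4 _).fun_add (hp 2 _)
  | 4 => simpa [w] using ((hp 5 _).fun_add (hp 3 _)).fun_add (h1 _)
  | 5 => simpa [w] using ((hp 6 _).fun_add (hp 4 _)).fun_add (hp 2 _)
  | i + 6 => simpa [w] using hasDerivAt_const θ (0 : ℝ)

theorem w_one (i : ℕ) (hi : i < 6) : Θ.w i 1 = Θ.G (i + 3) := by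
  interval_cases i
  · simp [w, ← G_three]
  · simp [w, ← G_four]
  · simp [w, ← G_five]
  · simp [w, ← G_six]
  · simp [w, ← G_seven]
  · simp [w, ← G_eight]

theorem w_zero (i : ℕ) : Θ.w i 0 = 0 := by
  match i with
  | 0 | 1 | 2 | 3 | 4 | 5 => simp [w]
  | i + 6 => rfl

/-- The generating function without its exactly solvable part. -/
def sol (τ θ : ℝ) : A := ∑ i ∈ Finset.range 6, τ ^ (i + 3) • Θ.w i θ

/-- The derivative of `sol` in `θ`. -/
def sol' (τ θ : ℝ) : A := ∑ i ∈ Finset.range 6, τ ^ (i + 3) • Θ.w' i θ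

/-- The Hamilton–Jacobi equation for `sol`, up to terms of order `9`. -/
theorem sol_isBigO (ℓ : A →ₗ[ℝ] ℝ) (θ : ℝ) :
    (fun τ => ℓ (Θ.sol' τ θ) - τ * (ℓ (Θ.D (Θ.sol τ θ))
      + 1 / 2 * ℓ (Θ.br (Θ.sol τ θ) (Θ.sol τ θ))
      + τ ^ 2 * (ℓ (Θ.T 1) + ℓ (Θ.pb (Θ.T 1) (Θ.sol τ θ)))
      + τ ^ 4 * (ℓ (Θ.T 2) + ℓ (Θ.pb (Θ.T 2) (Θ.sol τ θ)))
      + τ ^ 6 * ℓ (Θ.T 3))) =O[𝓝 0] fun τ => τ ^ 9 := by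
  -- `τ ^ 5 • Y τ` is the tail of `sol` after its first two terms. R collects every product of total
  -- order at least 9, divided by τ⁹; all lower orders cancel and the difference is exactly -τ⁹R.
  set Y : ℝ → A := fun τ => Θ.w 2 θ + τ • Θ.w 3 θ + τ ^ 2 • Θ.w 4 θ + τ ^ 3 • Θ.w 5 θ with hY
  set R : ℝ → ℝ := fun τ => ℓ (Θ.D (Θ.w 5 θ))
      + 1 / 2 * (ℓ (Θ.br (Θ.w 1 θ) (Θ.w 1 θ)) + 2 * ℓ (Θ.br (Θ.w 0 θ) (Y τ))
        + 2 * τ * ℓ (Θ.br (Θ.w 1 θ) (Y τ)) + τ ^ 2 * ℓ (Θ.br (Y τ) (Y τ)))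
      + ℓ (Θ.pb (Θ.T 1) (Θ.w 3 θ + τ • Θ.w 4 θ + τ ^ 2 • Θ.w 5 θ))
      + ℓ (Θ.pb (Θ.T 2) (Θ.w 1 θ + τ • Y τ)) with hR
  have hcont : Continuous R := by
    simp only [hR, hY, map_add, map_smul, LinearMap.add_apply, LinearMap.smul_apply, smul_eq_mul]
    fun_prop
  have hO : (fun τ => τ ^ 9 * -R τ) =O[𝓝 0] fun τ : ℝ => τ ^ 9 := by
    have h1 : (fun τ => -R τ) =O[𝓝 0] fun _ => (1 : ℝ) := hcont.neg.continuousAt.isBigO_one ℝ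
    simpa using (isBigO_refl (fun τ : ℝ => τ ^ 9) (𝓝 0)).mul h1
  refine hO.congr_left fun τ => ?_
  have hs : Θ.sol τ θ = τ ^ 3 • Θ.w 0 θ + τ ^ 4 • Θ.w 1 θ + τ ^ 5 • Y τ := by
    simp only [sol, Finset.sum_range_succ, Finset.sum_range_zero, hY]
    module
  have hD : ℓ (Θ.D (Θ.sol τ θ)) = τ ^ 3 * ℓ (Θ.D (Θ.w 0 θ)) + τ ^ 4 * ℓ (Θ.D (Θ.w 1 θ))
      + τ ^ 5 * ℓ (Θ.D (Θ.w 2 θ)) + τ ^ 6 * ℓ (Θ.D (Θ.w 3 θ))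
      + τ ^ 7 * ℓ (Θ.D (Θ.w 4 θ)) + τ ^ 8 * ℓ (Θ.D (Θ.w 5 θ)) := by
    simp only [sol, Finset.sum_range_succ, Finset.sum_range_zero, map_add, map_smul, smul_eq_mul,
      zero_add]
  have hb : ℓ (Θ.br (Θ.sol τ θ) (Θ.sol τ θ)) = τ ^ 6 * ℓ (Θ.br (Θ.w 0 θ) (Θ.w 0 θ))
      + 2 * τ ^ 7 * ℓ (Θ.br (Θ.w 0 θ) (Θ.w 1 θ))
      + τ ^ 8 * (ℓ (Θ.br (Θ.w 1 θ) (Θ.w 1 θ)) + 2 * ℓ (Θ.br (Θ.w 0 θ) (Y τ))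
        + 2 * τ * ℓ (Θ.br (Θ.w 1 θ) (Y τ)) + τ ^ 2 * ℓ (Θ.br (Y τ) (Y τ))) := by
    rw [hs]
    simp only [map_add, map_smul, LinearMap.add_apply, LinearMap.smul_apply, smul_eq_mul,
      Θ.br_comm (Y τ) (Θ.w 0 θ), Θ.br_comm (Y τ) (Θ.w 1 θ), Θ.br_comm (Θ.w 1 θ) (Θ.w 0 θ)]
    ring
  have hp : ∀ x, ℓ (Θ.pb x (Θ.sol τ θ)) = τ ^ 3 * ℓ (Θ.pb x (Θ.w 0 θ))
      + τ ^ 4 * ℓ (Θ.pb x (Θ.w 1 θ)) + τ ^ 5 * ℓ (Θ.pb x (Y τ)) := by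
    intro x
    simp only [hs, map_add, map_smul, smul_eq_mul]
  have hpY : ℓ (Θ.pb (Θ.T 1) (Y τ)) = ℓ (Θ.pb (Θ.T 1) (Θ.w 2 θ))
      + τ * ℓ (Θ.pb (Θ.T 1) (Θ.w 3 θ + τ • Θ.w 4 θ + τ ^ 2 • Θ.w 5 θ)) := by
    simp only [hY, map_add, map_smul, smul_eq_mul]
    ring
  have hsol : ℓ (Θ.sol' τ θ) = τ ^ 3 * ℓ (Θ.T 1) + τ ^ 4 * ℓ (Θ.D (Θ.w 0 θ))
      + τ ^ 5 * (ℓ (Θ.D (Θ.w 1 θ)) + ℓ (Θ.T 2))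
      + τ ^ 6 * (ℓ (Θ.D (Θ.w 2 θ)) + ℓ (Θ.pb (Θ.T 1) (Θ.w 0 θ)))
      + τ ^ 7 * (ℓ (Θ.D (Θ.w 3 θ)) + 1 / 2 * ℓ (Θ.br (Θ.w 0 θ) (Θ.w 0 θ))
        + ℓ (Θ.pb (Θ.T 1) (Θ.w 1 θ)) + ℓ (Θ.T 3))
      + τ ^ 8 * (ℓ (Θ.D (Θ.w 4 θ)) + ℓ (Θ.br (Θ.w 0 θ) (Θ.w 1 θ))
        + ℓ (Θ.pb (Θ.T 1) (Θ.w 2 θ)) + ℓ (Θ.pb (Θ.T 2) (Θ.w 0 θ))) := by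
    simp only [sol', w', Finset.sum_range_succ, Finset.sum_range_zero, map_add, map_smul,
      smul_eq_mul, zero_add]
  have hp2 : ℓ (Θ.pb (Θ.T 2) (Θ.w 1 θ + τ • Y τ)) = ℓ (Θ.pb (Θ.T 2) (Θ.w 1 θ))
      + τ * ℓ (Θ.pb (Θ.T 2) (Y τ)) := by
    simp only [map_add, map_smul, smul_eq_mul]
  rw [hsol, hD, hb, hp, hp, hpY]
  simp only [hR, hp2]
  ring

end BracketData

end

/-! ### The residual for the effective kinetic energy -/

section

variable {n : ℕ}

open smoothFun

theorem dp_slice (f : smoothFun n) (q P v : Coord n) :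
    fderiv ℝ (fun p : Coord n => f.1 (q, p)) P v = ∑ a, v a * evalAt (q, P) (dp a f) := by
  have h1 : HasFDerivAt f.1 (fderiv ℝ f.1 (q, P)) (q, P) :=
    ((smoothFun.contDiff f).differentiable (by simp) _).hasFDerivAt
  have h2 : HasFDerivAt (fun p : Coord n => ((q, p) : Phase n))
      (ContinuousLinearMap.inr ℝ (Coord n) (Coord n)) P := hasFDerivAt_prodMk_right q P
  have h3 := (HasFDerivAt.comp P h1 h2).fderiv
  rw [Function.comp_def] at h3
  rw [h3]
  exact (sum_mul_apply_unitV ((fderiv ℝ f.1 (q, P)).toLinearMap ∘ₗ LinearMap.inr ℝ _ _) v).symm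

/-- The first order Taylor formula. -/
theorem taylor_isBigO {E : Type*} [NormedAddCommGroup E] [NormedSpace ℝ E] {f : E → ℝ}
    (hf : ContDiff ℝ ∞ f) (x : E) :
    (fun v => f (x + v) - f x - fderiv ℝ f x v) =O[𝓝 0] fun v => ‖v‖ ^ 2 := by
  have hd : ContDiff ℝ ∞ (fderiv ℝ f) := hf.fderiv_right (m := ∞) (by simp)
  obtain ⟨L, s, hs, hL⟩ := (hd.contDiffAt (x := x)).of_le
    (m := 1) (by simp) |>.exists_lipschitzOnWith
  obtain ⟨r, hr, hrs⟩ := Metric.mem_nhds_iff.1 hs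
  refine IsBigO.of_bound L ?_
  filter_upwards [Metric.ball_mem_nhds (0 : E) hr] with v hv
  rw [mem_ball_zero_iff] at hv
  have hb : ∀ y ∈ Metric.closedBall x ‖v‖, ‖fderiv ℝ f y - fderiv ℝ f x‖ ≤ L * ‖v‖ := by
    intro y hy
    rw [mem_closedBall_iff_norm] at hy
    have hy' : y ∈ s := hrs (by rw [mem_ball_iff_norm]; linarith)
    have hx' : x ∈ s := hrs (Metric.mem_ball_self hr)
    exact (hL.norm_sub_le hy' hx').trans (by gcongr)
  have h := (convex_closedBall x ‖v‖).norm_image_sub_le_of_norm_fderiv_le'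
    (fun y _ => hf.differentiable (by simp) y) hb (x := x) (y := x + v)
    (Metric.mem_closedBall_self (norm_nonneg v)) (by simp)
  rw [add_sub_cancel_left] at h
  rw [norm_pow, norm_norm, pow_two, ← mul_assoc]
  exact h

theorem kinetic_add {M : Matrix (Fin n) (Fin n) ℝ} (hM : M.IsSymm) (P δ : Coord n) :
    kinetic M (P + δ) = kinetic M P + ∑ a, (∑ b, M b a * P b) * δ a + kinetic M δ := by
  have h1 : ∑ a, (∑ b, M b a * P b) * δ a = ∑ a, ∑ b, P a * M a b * δ b := by
    rw [Finset.sum_comm]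
    refine Finset.sum_congr rfl fun a _ => ?_
    rw [Finset.sum_mul]
    exact Finset.sum_congr rfl fun b _ => by ring
  have h2 : ∑ a, (∑ b, M b a * P b) * δ a = ∑ a, ∑ b, δ a * M a b * P b := by
    refine Finset.sum_congr rfl fun a _ => ?_
    rw [Finset.sum_mul]
    exact Finset.sum_congr rfl fun b _ => by rw [hM.apply]; ring
  have h3 : ∑ a, (∑ b, M b a * P b) * δ a
      = 1 / 2 * ∑ a, ∑ b, P a * M a b * δ b + 1 / 2 * ∑ a, ∑ b, δ a * M a b * P b := by
    rw [← h1, ← h2]; ring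
  rw [h3]
  unfold kinetic
  rw [← mul_add, ← mul_add, ← mul_add]
  simp only [← Finset.sum_add_distrib]
  congr 1
  refine Finset.sum_congr rfl fun a _ => Finset.sum_congr rfl fun b _ => ?_
  simp only [Pi.add_apply]
  ring

theorem evalAt_sum_mul {ι : Type*} (s : Finset ι) (f g : ι → smoothFun n) (z : Phase n) :
    evalAt z (∑ i ∈ s, f i * g i) = ∑ i ∈ s, evalAt z (f i) * evalAt z (g i) := by
  rw [map_sum]
  rfl

/-- The gradient in the positions. -/
def qGrad (f : smoothFun n) (z : Phase n) : Coord n := fun a => evalAt z (dq a f)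

section
variable (M : Matrix (Fin n) (Fin n) ℝ) (hM : M.IsSymm)

theorem sum_mom_qGrad (f : smoothFun n) (q P : Coord n) :
    ∑ a, (∑ b, M b a * P b) * qGrad f (q, P) a = evalAt (q, P) (opDer M f) := by
  rw [opDer_apply, evalAt_sum_mul]
  refine Finset.sum_congr rfl fun a _ => ?_
  rw [map_sum]
  rfl

include hM in
theorem kinetic_qGrad (f : smoothFun n) (z : Phase n) :
    kinetic M (qGrad f z) = 1 / 2 * evalAt z (brL M f f) := by
  change _ = 1 / 2 * evalAt z (grad M f f)
  rw [grad_apply, evalAt_sum_mul, kinetic, Finset.sum_comm]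
  congr 1
  refine Finset.sum_congr rfl fun a _ => ?_
  rw [up, map_sum, Finset.sum_mul]
  refine Finset.sum_congr rfl fun b _ => ?_
  rw [map_smul, smul_eq_mul, hM.apply]
  simp only [qGrad]
  ring

theorem evalAt_pairL (f g : smoothFun n) (z : Phase n) :
    evalAt z (pairL f g) = ∑ a, qGrad g z a * evalAt z (dp a f) := by
  change evalAt z (pair f g) = _
  rw [pair, evalAt_sum_mul]
  exact Finset.sum_congr rfl fun a _ => mul_comm _ _

/-- The effective kinetic energy with all the terms up to `T_6`. -/
def fullT (Θ : BracketData (smoothFun n)) (τ : ℝ) (q p : Coord n) : ℝ :=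
  kinetic M p + τ ^ 2 * evalAt (q, p) (Θ.T 1) + τ ^ 4 * evalAt (q, p) (Θ.T 2)
    + τ ^ 6 * evalAt (q, p) (Θ.T 3)

theorem contDiff_kinetic : ContDiff ℝ ∞ (kinetic M) := by
  unfold kinetic
  fun_prop

theorem contDiff_evalAt (f : smoothFun n) : ContDiff ℝ ∞ fun z : Phase n => evalAt z f := f.2

theorem smoothParam_fullT (Θ : BracketData (smoothFun n)) : SmoothParam (fullT M Θ) := by
  have hz : ContDiff ℝ ∞ fun x : ℝ × Coord n × Coord n => (x.2.1, x.2.2) := contDiff_snd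
  have h : ∀ f : smoothFun n,
      ContDiff ℝ ∞ fun x : ℝ × Coord n × Coord n => evalAt (x.2.1, x.2.2) f :=
    fun f => (contDiff_evalAt f).comp hz
  have hk : ContDiff ℝ ∞ fun x : ℝ × Coord n × Coord n => kinetic M x.2.2 :=
    (contDiff_kinetic M).comp contDiff_snd.snd
  exact ((hk.add ((contDiff_fst.pow 2).mul (h _))).add ((contDiff_fst.pow 4).mul (h _))).add
    ((contDiff_fst.pow 6).mul (h _))

theorem qGrad_sol_isBigO (Θ : BracketData (smoothFun n)) (θ : ℝ) (z : Phase n) :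
    (fun τ => qGrad (Θ.sol τ θ) z) =O[𝓝 0] fun τ => τ ^ 3 := by
  refine isBigO_pi.2 fun a => ?_
  set R : ℝ → ℝ := fun τ => ∑ i ∈ Finset.range 6, τ ^ i * evalAt z (dq a (Θ.w i θ)) with hR
  have hcont : Continuous R := by fun_prop
  have h1 : R =O[𝓝 0] fun _ => (1 : ℝ) := hcont.continuousAt.isBigO_one ℝ
  have h2 : (fun τ => τ ^ 3 * R τ) =O[𝓝 0] fun τ : ℝ => τ ^ 3 := by
    simpa using (isBigO_refl (fun τ : ℝ => τ ^ 3) (𝓝 0)).mul h1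
  refine h2.congr_left fun τ => ?_
  simp only [qGrad, BracketData.sol, map_sum, Derivation.map_smul, map_smul, smul_eq_mul, hR,
    Finset.mul_sum]
  exact Finset.sum_congr rfl fun i _ => by ring

theorem tendsto_qGrad_sol (Θ : BracketData (smoothFun n)) (θ : ℝ) (z : Phase n) :
    Tendsto (fun τ => qGrad (Θ.sol τ θ) z) (𝓝 0) (𝓝 0) := by
  refine (qGrad_sol_isBigO Θ θ z).trans_tendsto ?_
  have h : Continuous fun τ : ℝ => τ ^ 3 := by fun_prop
  simpa using h.tendsto 0

/-- The first order expansion of a function at the momentum `P + ∇f` for `f = sol`. -/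
theorem evalAt_shift_isBigO (Θ : BracketData (smoothFun n)) (f : smoothFun n) (θ : ℝ)
    (q P : Coord n) :
    (fun τ => evalAt (q, P + qGrad (Θ.sol τ θ) (q, P)) f - evalAt (q, P) f
      - evalAt (q, P) (pairL f (Θ.sol τ θ))) =O[𝓝 0] fun τ => τ ^ 6 := by
  have hs : ContDiff ℝ ∞ fun p : Coord n => f.1 (q, p) :=
    (smoothFun.contDiff f).comp (contDiff_const.prodMk contDiff_id)
  have h1 := (taylor_isBigO hs P).comp_tendsto (tendsto_qGrad_sol Θ θ (q, P))
  have h2 := ((qGrad_sol_isBigO Θ θ (q, P)).norm_left).pow 2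
  refine ((h1.trans h2).congr_left fun τ => ?_).congr_right fun τ => by ring
  simp only [Function.comp, dp_slice, evalAt_pairL]
  rfl

theorem evalAt_shift_isBigO_one (Θ : BracketData (smoothFun n)) (f : smoothFun n) (θ : ℝ)
    (q P : Coord n) :
    (fun τ => evalAt (q, P + qGrad (Θ.sol τ θ) (q, P)) f - evalAt (q, P) f)
      =O[𝓝 0] fun τ => τ ^ 3 := by
  have hs : ContDiff ℝ ∞ fun p : Coord n => f.1 (q, p) :=
    (smoothFun.contDiff f).comp (contDiff_const.prodMk contDiff_id)
  have h1 := (hs.differentiable (by simp) P).isBigO_sub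
  have ht : Tendsto (fun τ => P + qGrad (Θ.sol τ θ) (q, P)) (𝓝 0) (𝓝 P) := by
    simpa using (tendsto_qGrad_sol Θ θ (q, P)).const_add P
  have h2 := h1.comp_tendsto ht
  refine (h2.trans (((qGrad_sol_isBigO Θ θ (q, P))).congr_left fun τ => ?_)).congr_left
    fun τ => rfl
  simp [Function.comp]

variable {V : Coord n → ℝ} (hV : ContDiff ℝ ∞ V)

/-- The Hamilton–Jacobi equation for `fullT`, up to terms of order `9`. -/
theorem fullT_isBigO (θ : ℝ) (q P : Coord n) :
    (fun τ => τ * kinetic M P + evalAt (q, P) ((bracketData M hM V hV).sol' τ θ)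
      - τ * fullT M (bracketData M hM V hV) τ q
        (P + qGrad ((bracketData M hM V hV).sol τ θ) (q, P))) =O[𝓝 0] fun τ => τ ^ 9 := by
  set Θ := bracketData M hM V hV with hΘ
  have hpow : ∀ k, 9 ≤ k → (fun τ : ℝ => τ ^ k) =O[𝓝 0] fun τ => τ ^ 9 := by
    intro k hk
    obtain ⟨j, rfl⟩ := Nat.exists_eq_add_of_le hk
    have hc : ContinuousAt (fun τ : ℝ => τ ^ j) 0 := by fun_prop
    simpa [pow_add] using (isBigO_refl (fun τ : ℝ => τ ^ 9) (𝓝 0)).mul (hc.isBigO_one ℝ)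
  have h1 := Θ.sol_isBigO (evalAt (q, P)) θ
  -- The neglected Taylor terms of T_2, T_4 and T_6 have orders 3 + 6, 5 + 6 and 7 + 3, all at least
  -- 9.
  have h2 := ((isBigO_refl (fun τ : ℝ => τ ^ 3) (𝓝 0)).mul
    (evalAt_shift_isBigO Θ (Θ.T 1) θ q P))
  have h3 := ((isBigO_refl (fun τ : ℝ => τ ^ 5) (𝓝 0)).mul
    (evalAt_shift_isBigO Θ (Θ.T 2) θ q P))
  have h4 := ((isBigO_refl (fun τ : ℝ => τ ^ 7) (𝓝 0)).mul
    (evalAt_shift_isBigO_one Θ (Θ.T 3) θ q P))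
  simp only [← pow_add] at h2 h3 h4
  have h5 := ((h1.sub (h2.trans (hpow _ (by norm_num)))).sub
    (h3.trans (hpow _ (by norm_num)))).sub (h4.trans (hpow _ (by norm_num)))
  refine h5.congr_left fun τ => ?_
  rw [fullT, kinetic_add hM, sum_mom_qGrad, kinetic_qGrad M hM]
  have e1 : Θ.D (Θ.sol τ θ) = opDer M (Θ.sol τ θ) := rfl
  have e2 : Θ.br = brL M := rfl
  have e3 : Θ.pb = pairL := rfl
  rw [e1, e2, e3]
  ring

end

section
variable (M : Matrix (Fin n) (Fin n) ℝ) (Θ : BracketData (smoothFun n)) (N : ℕ)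
  (s : ℝ → Coord n → Coord n → ℝ)

/-- The generating function of the fraction `θ` of the move step, without the part that generates
the identity, divided by `τ`. -/
def interpG (x : Ext n) : ℝ :=
  x.2.1.1 * kinetic M x.2.2
    + ∑ i ∈ Finset.range 6, x.1 ^ (i + 2) * evalAt (x.2.1.2, x.2.2) (Θ.w i x.2.1.1)
    -- The remainder is switched on linearly in θ, so that the generating function is q·P at θ = 0.
    -- The outer factor `τ` in `interpF` raises the power to N + 1.
    + x.2.1.1 * x.1 ^ N * s x.1 x.2.1.2 x.2.2

/-- The generating function of the fraction `θ` of the move step. -/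
def interpF (x : Ext n) : ℝ :=
  ∑ a, x.2.1.2 a * x.2.2 a + x.1 * interpG M Θ N s x

theorem contDiff_evalAt_w (i : ℕ) :
    ContDiff ℝ ∞ fun x : Ext n => evalAt (x.2.1.2, x.2.2) (Θ.w i x.2.1.1) := by
  have hθ : ContDiff ℝ ∞ fun x : Ext n => x.2.1.1 := contDiff_snd.fst.fst
  have h : ∀ f : smoothFun n, ContDiff ℝ ∞ fun x : Ext n => evalAt (x.2.1.2, x.2.2) f :=
    fun f => (contDiff_evalAt f).comp (contDiff_snd.fst.snd.prodMk contDiff_snd.snd)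
  have hm : ∀ (k : ℕ) (f : smoothFun n),
      ContDiff ℝ ∞ fun x : Ext n => x.2.1.1 ^ k * evalAt (x.2.1.2, x.2.2) f :=
    fun k f => (hθ.pow k).mul (h f)
  have h1 : ∀ f : smoothFun n,
      ContDiff ℝ ∞ fun x : Ext n => x.2.1.1 * evalAt (x.2.1.2, x.2.2) f :=
    fun f => hθ.mul (h f)
  match i with
  | 0 => simpa only [BracketData.w, map_add, map_smul, smul_eq_mul] using h1 _
  | 1 => simpa only [BracketData.w, map_add, map_smul, smul_eq_mul] using hm 2 _
  | 2 => simpa only [BracketData.w, map_add, map_smul, smul_eq_mul] using (hm 3 _).add (h1 _)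
  | 3 => simpa only [BracketData.w, map_add, map_smul, smul_eq_mul] using (hm 4 _).add (hm 2 _)
  | 4 =>
    simpa only [BracketData.w, map_add, map_smul, smul_eq_mul] using
      ((hm 5 _).add (hm 3 _)).add (h1 _)
  | 5 =>
    simpa only [BracketData.w, map_add, map_smul, smul_eq_mul] using
      ((hm 6 _).add (hm 4 _)).add (hm 2 _)
  | i + 6 => simpa only [BracketData.w, map_zero] using contDiff_const

variable {s}

theorem contDiff_interpG (hs : SmoothParam s) : ContDiff ℝ ∞ (interpG M Θ N s) := by
  have hθ : ContDiff ℝ ∞ fun x : Ext n => x.2.1.1 := contDiff_snd.fst.fst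
  have hs' : ContDiff ℝ ∞ fun x : Ext n => s x.1 x.2.1.2 x.2.2 :=
    ContDiff.comp hs (contDiff_fst.prodMk (contDiff_snd.fst.snd.prodMk contDiff_snd.snd))
  refine ((hθ.mul ((contDiff_kinetic M).comp contDiff_snd.snd)).add ?_).add
    ((hθ.mul (contDiff_fst.pow N)).mul hs')
  exact ContDiff.sum fun i _ => (contDiff_fst.pow _).mul (contDiff_evalAt_w Θ i)

theorem contDiff_interpF (hs : SmoothParam s) : ContDiff ℝ ∞ (interpF M Θ N s) := by
  have hqP : ContDiff ℝ ∞ fun x : Ext n => ∑ a, x.2.1.2 a * x.2.2 a :=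
    ContDiff.sum fun a _ => by fun_prop
  exact hqP.add (contDiff_fst.mul (contDiff_interpG M Θ N hs))

theorem interpF_eq (τ θ : ℝ) (q P : Coord n) : interpF M Θ N s (τ, (θ, q), P) =
    ∑ a, q a * P a + θ * (τ * kinetic M P) + evalAt (q, P) (Θ.sol τ θ)
      + θ * (τ ^ (N + 1) * s τ q P) := by
  have h : evalAt (q, P) (Θ.sol τ θ)
      = τ * ∑ i ∈ Finset.range 6, τ ^ (i + 2) * evalAt (q, P) (Θ.w i θ) := by
    simp only [BracketData.sol, map_sum, map_smul, smul_eq_mul, Finset.mul_sum]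
    exact Finset.sum_congr rfl fun i _ => by ring
  rw [h]
  simp only [interpF, interpG]
  ring

theorem gradQ_interpF (hs : SmoothParam s) (τ θ : ℝ) (q P : Coord n) :
    gradQ (interpF M Θ N s) (τ, (θ, q), P) = P + qGrad (Θ.sol τ θ) (q, P)
      + τ ^ (N + 1) • fun a => θ * pd a (fun q => s τ q P) q := by
  funext a
  rw [← pd_slice_Q (contDiff_interpF M Θ N hs)]
  simp only [interpF_eq]
  have h1 : HasFDerivAt (fun q : Coord n => ∑ a, q a * P a)
      (∑ a, P a • ContinuousLinearMap.proj (R := ℝ) (φ := fun _ : Fin n => ℝ) a) q :=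
    HasFDerivAt.fun_sum fun a _ => (hasFDerivAt_apply a q).mul_const (P a)
  have h2 : DifferentiableAt ℝ (fun q => evalAt (q, P) (Θ.sol τ θ)) q :=
    (((contDiff_evalAt (Θ.sol τ θ)).comp
      (contDiff_id.prodMk contDiff_const)).differentiable (by simp)) q
  have h3 : DifferentiableAt ℝ (fun q => s τ q P) q :=
    ((ContDiff.comp hs (contDiff_const.prodMk
      (contDiff_id.prodMk contDiff_const))).differentiable (by simp)) q
  have h4 := (((h1.add_const (θ * (τ * kinetic M P))).fun_add h2.hasFDerivAt).fun_add
    ((h3.hasFDerivAt.const_mul (τ ^ (N + 1))).const_mul θ)).fderiv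
  have h5 : fderiv ℝ (fun q => evalAt (q, P) (Θ.sol τ θ)) q (Pi.single a 1)
      = qGrad (Θ.sol τ θ) (q, P) a := pd_slice P (Θ.sol τ θ) a q
  unfold pd
  rw [h4]
  simp [Pi.single_apply, h5]
  ring

theorem dirT_interpF (hs : SmoothParam s) (τ θ : ℝ) (q P : Coord n) :
    dirD dirT (interpF M Θ N s) (τ, (θ, q), P) = τ * kinetic M P
      + evalAt (q, P) (Θ.sol' τ θ) + τ ^ (N + 1) * s τ q P := by
  have h1 : HasFDerivAt (interpF M Θ N s) (fderiv ℝ (interpF M Θ N s) (τ, (θ, q), P))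
      (τ, (θ, q), P) := ((contDiff_interpF M Θ N hs).differentiable (by simp) _).hasFDerivAt
  have h2 : HasDerivAt (fun θ : ℝ => ((τ, (θ, q), P) : Ext n)) dirT θ :=
    (hasDerivAt_const θ τ).prodMk
      (((hasDerivAt_id θ).prodMk (hasDerivAt_const θ q)).prodMk (hasDerivAt_const θ P))
  have h3 := h1.comp_hasDerivAt θ h2
  have h4 : (interpF M Θ N s ∘ fun θ : ℝ => ((τ, (θ, q), P) : Ext n)) = fun θ =>
      ∑ a, q a * P a + θ * (τ * kinetic M P) + evalAt (q, P) (Θ.sol τ θ)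
      + θ * (τ ^ (N + 1) * s τ q P) := funext fun θ => interpF_eq M Θ N τ θ q P
  have h5 : HasDerivAt (fun θ => evalAt (q, P) (Θ.sol τ θ)) (evalAt (q, P) (Θ.sol' τ θ)) θ := by
    simp only [BracketData.sol, BracketData.sol', map_sum, map_smul, smul_eq_mul]
    exact HasDerivAt.fun_sum fun i _ => (Θ.hasDerivAt_w (evalAt (q, P)) i θ).const_mul _
  have hid : ∀ c : ℝ, HasDerivAt (fun θ : ℝ => θ * c) c θ := fun c => by
    simpa using (hasDerivAt_id θ).mul_const c
  have h6 := (((hid (τ * kinetic M P)).const_add (∑ a, q a * P a)).fun_add h5).fun_add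
    (hid (τ ^ (N + 1) * s τ q P))
  rw [h4] at h3
  exact h3.unique h6

end

theorem isBigO_pow_mul_of_continuous {E : Type*} [NormedAddCommGroup E] [NormedSpace ℝ E]
    {f : ℝ → E} (hf : ContinuousAt f 0) (k : ℕ) :
    (fun τ => τ ^ k • f τ) =O[𝓝 0] fun τ : ℝ => τ ^ k := by
  simpa using (isBigO_refl (fun τ : ℝ => τ ^ k) (𝓝 0)).smul (hf.isBigO_one ℝ)

/-- Besides the error of `fullT_isBigO` there are three contributions, each O(τ^{N+1}): the
θ-derivative of the remainder of F, the shift of the momentum by its q-gradient, and τ^N σ, which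
the equation multiplies by `τ`. -/
theorem residual_interpF_isBigO (M : Matrix (Fin n) (Fin n) ℝ) (hM : M.IsSymm)
    {V : Coord n → ℝ} (hV : ContDiff ℝ ∞ V) {N : ℕ} (hN : N ≤ 8)
    {σ s : ℝ → Coord n → Coord n → ℝ} (hσ : SmoothParam σ) (hs : SmoothParam s) (θ : ℝ)
    (q P : Coord n) :
    (fun τ => residual
      (fun τ q p => fullT M (bracketData M hM V hV) τ q p + τ ^ N * σ τ q p)
      (interpF M (bracketData M hM V hV) N s) (τ, (θ, q), P)) =O[𝓝 0] fun τ => τ ^ (N + 1) := by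
  set Θ := bracketData M hM V hV with hΘ
  set δ : ℝ → Coord n := fun τ => qGrad (Θ.sol τ θ) (q, P) with hδ
  set c : ℝ → Coord n := fun τ a => θ * pd a (fun q => s τ q P) q with hc
  have hδ0 : Tendsto δ (𝓝 0) (𝓝 0) := tendsto_qGrad_sol Θ θ (q, P)
  have hccont : Continuous c := by
    refine continuous_pi fun a => continuous_const.mul ?_
    simp only [pd_param_q hs]
    have h1 : Continuous (fderiv ℝ fun x : ℝ × Coord n × Coord n => s x.1 x.2.1 x.2.2) :=
      ContDiff.continuous_fderiv hs (by simp)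
    exact (h1.comp (continuous_id.prodMk continuous_const)).clm_apply continuous_const
  have hcO : (fun τ => τ ^ (N + 1) • c τ) =O[𝓝 0] fun τ : ℝ => τ ^ (N + 1) :=
    isBigO_pow_mul_of_continuous hccont.continuousAt _
  have hc0 : Tendsto (fun τ => τ ^ (N + 1) • c τ) (𝓝 0) (𝓝 0) := by
    have h1 : Continuous fun τ => τ ^ (N + 1) • c τ := by fun_prop
    simpa using h1.tendsto 0
  have hp1 : Tendsto (fun τ => P + δ τ) (𝓝 0) (𝓝 P) := by simpa using hδ0.const_add P
  have hp2 : Tendsto (fun τ => P + δ τ + τ ^ (N + 1) • c τ) (𝓝 0) (𝓝 P) := by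
    simpa using hp1.add hc0
  have h1 : (fun τ => τ * kinetic M P + evalAt (q, P) (Θ.sol' τ θ)
      - τ * fullT M Θ τ q (P + δ τ)) =O[𝓝 0] fun τ : ℝ => τ ^ (N + 1) := by
    refine (fullT_isBigO M hM hV θ q P).trans ?_
    obtain ⟨j, hj⟩ := Nat.exists_eq_add_of_le (show N + 1 ≤ 9 by omega)
    have h2 : Continuous fun τ : ℝ => τ ^ j := by fun_prop
    have := isBigO_pow_mul_of_continuous h2.continuousAt (N + 1)
    rw [hj]
    simpa only [pow_add, smul_eq_mul] using this
  have h2 : (fun τ => fullT M Θ τ q (P + δ τ + τ ^ (N + 1) • c τ) - fullT M Θ τ q (P + δ τ))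
      =O[𝓝 0] fun τ : ℝ => τ ^ (N + 1) := by
    have h3 := (((smoothParam_fullT M Θ).contDiffAt (x := ((0 : ℝ), q, P))).hasStrictFDerivAt
      (by simp)).isBigO_sub
    have h4 : Tendsto (fun τ => (((τ, q, P + δ τ + τ ^ (N + 1) • c τ) : ℝ × Coord n × Coord n),
        ((τ, q, P + δ τ) : ℝ × Coord n × Coord n))) (𝓝 0)
        (𝓝 (((0, q, P) : ℝ × Coord n × Coord n), ((0, q, P) : ℝ × Coord n × Coord n))) :=
      (tendsto_id.prodMk_nhds (tendsto_const_nhds.prodMk_nhds hp2)).prodMk_nhds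
        (tendsto_id.prodMk_nhds (tendsto_const_nhds.prodMk_nhds hp1))
    have h5 := h3.comp_tendsto h4
    refine h5.trans (IsBigO.trans (IsBigO.of_norm_right ?_) hcO)
    refine IsBigO.of_bound 1 (Eventually.of_forall fun τ => ?_)
    simp [Function.comp, Prod.norm_def]
  have h3 : (fun τ => τ ^ (N + 1) • s τ q P) =O[𝓝 0] fun τ : ℝ => τ ^ (N + 1) := by
    refine isBigO_pow_mul_of_continuous (f := fun τ => s τ q P) ?_ _
    have h4 : Continuous fun τ : ℝ => ((τ, q, P) : ℝ × Coord n × Coord n) := by fun_prop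
    exact ((ContDiff.continuous hs).comp h4).continuousAt
  have h4 : (fun τ => τ ^ (N + 1) • σ τ q (P + δ τ + τ ^ (N + 1) • c τ))
      =O[𝓝 0] fun τ : ℝ => τ ^ (N + 1) := by
    have h5 : Tendsto (fun τ => σ τ q (P + δ τ + τ ^ (N + 1) • c τ)) (𝓝 0) (𝓝 (σ 0 q P)) :=
      ((ContDiff.continuous hσ).tendsto (0, q, P)).comp
        (tendsto_id.prodMk_nhds (tendsto_const_nhds.prodMk_nhds hp2))
    simpa using (isBigO_refl (fun τ : ℝ => τ ^ (N + 1)) (𝓝 0)).smul (h5.isBigO_one ℝ)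
  have h5 : (fun τ => τ * (fullT M Θ τ q (P + δ τ + τ ^ (N + 1) • c τ)
      - fullT M Θ τ q (P + δ τ))) =O[𝓝 0] fun τ : ℝ => τ ^ (N + 1) := by
    have h6 : (fun τ : ℝ => τ) =O[𝓝 0] fun _ => (1 : ℝ) := continuousAt_id.isBigO_one ℝ
    simpa using h6.mul h2
  refine (((h1.add h3).sub h5).sub h4).congr_left fun τ => ?_
  simp only [residual, dirT_interpF M Θ N hs, gradQ_interpF M Θ N hs, smul_eq_mul, hδ, hc]
  ring

end

/-! ### Assembly of the existence statement -/

section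

variable {n : ℕ}

open smoothFun

theorem smoothParam_of_smooth {A : Coord n → Coord n → ℝ} (hA : Smooth A) :
    SmoothParam fun _ => A :=
  ContDiff.comp hA contDiff_snd

theorem SmoothParam.pow_mul {S : ℝ → Coord n → Coord n → ℝ} (hS : SmoothParam S) (k : ℕ) :
    SmoothParam fun τ q p => τ ^ k * S τ q p :=
  (contDiff_fst.pow k).mul hS

theorem SmoothParam.add {S S' : ℝ → Coord n → Coord n → ℝ} (hS : SmoothParam S)
    (hS' : SmoothParam S') : SmoothParam fun τ q p => S τ q p + S' τ q p :=
  ContDiff.add hS hS'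

theorem SmoothParam.sub {S S' : ℝ → Coord n → Coord n → ℝ} (hS : SmoothParam S)
    (hS' : SmoothParam S') : SmoothParam fun τ q p => S τ q p - S' τ q p :=
  ContDiff.sub hS hS'

theorem SmoothParam.sum {ι : Type*} {s : Finset ι} {S : ι → ℝ → Coord n → Coord n → ℝ}
    (hS : ∀ i ∈ s, SmoothParam (S i)) : SmoothParam fun τ q p => ∑ i ∈ s, S i τ q p :=
  ContDiff.sum hS

theorem smoothParam_genFun {A : ℕ → Coord n → Coord n → ℝ} {N : ℕ}
    {S : ℝ → Coord n → Coord n → ℝ} (hA : ∀ k ≤ N, Smooth (A k)) (hS : SmoothParam S) :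
    SmoothParam (genFun A N S) :=
  (SmoothParam.sum fun k hk => (smoothParam_of_smooth
    (hA k (by rw [Finset.mem_range] at hk; omega))).pow_mul k).add (hS.pow_mul (N + 1))

section
variable (M : Matrix (Fin n) (Fin n) ℝ) (hM : M.IsSymm) {V : Coord n → ℝ} (hV : ContDiff ℝ ∞ V)
include hM hV

theorem smooth_Gcoeff (k : ℕ) : Smooth (Gcoeff M V k) := by
  rcases Nat.lt_or_ge k 3 with hk | hk
  · interval_cases k
    · exact ContDiff.sum fun a _ => by fun_prop
    · exact (contDiff_kinetic M).comp contDiff_snd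
    · exact contDiff_const
  · have h : (fun x : Coord n × Coord n => Gcoeff M V k x.1 x.2)
        = fun x => evalAt x ((bracketData M hM V hV).G k) :=
      funext fun x => Gcoeff_eq M hM hV hk x.1 x.2
    unfold Smooth
    rw [h]
    exact contDiff_evalAt _

theorem smooth_Tcoeff (j : ℕ) : Smooth (Tcoeff M V j) := by
  rcases eq_or_ne j 0 with rfl | hj
  · exact (contDiff_kinetic M).comp contDiff_snd
  · have h : (fun x : Coord n × Coord n => Tcoeff M V j x.1 x.2)
        = fun x => evalAt x ((bracketData M hM V hV).T j) :=
      funext fun x => Tcoeff_eq M hM hV hj x.1 x.2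
    unfold Smooth
    rw [h]
    exact contDiff_evalAt _

/-- The T_{2j} with j > m come with powers divisible by τ^(2m+2), hence by τ^N. They can be added to
reach the full sum and subtracted inside σ, which reduces all m to one Hamiltonian. -/
theorem exists_Teff_eq {m : ℕ} (hm : m ≤ 3) {N : ℕ} (hN : N ≤ 2 * m + 2)
    {S : ℝ → Coord n → Coord n → ℝ} (hS : SmoothParam S) :
    ∃ σ, SmoothParam σ ∧ Teff M V m S =
      fun τ q p => fullT M (bracketData M hM V hV) τ q p + τ ^ N * σ τ q p := by
  refine ⟨fun τ q p => τ ^ (2 * m + 2 - N) * (S τ q p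
    - ∑ j ∈ Finset.Ico (m + 1) 4, τ ^ (2 * (j - (m + 1))) * Tcoeff M V j q p), ?_, ?_⟩
  · exact (hS.sub (SmoothParam.sum fun j _ =>
      (smoothParam_of_smooth (smooth_Tcoeff M hM hV j)).pow_mul _)).pow_mul _
  · funext τ q p
    have h1 : fullT M (bracketData M hM V hV) τ q p
        = ∑ j ∈ Finset.range 4, τ ^ (2 * j) * Tcoeff M V j q p := by
      simp only [Finset.sum_range_succ, Finset.sum_range_zero, fullT,
        Tcoeff_eq M hM hV one_ne_zero, Tcoeff_eq M hM hV two_ne_zero,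
        Tcoeff_eq M hM hV three_ne_zero]
      simp [Tcoeff]
    have h2 : ∑ j ∈ Finset.range 4, τ ^ (2 * j) * Tcoeff M V j q p
        = ∑ j ∈ Finset.range (m + 1), τ ^ (2 * j) * Tcoeff M V j q p
          + τ ^ (2 * m + 2) * ∑ j ∈ Finset.Ico (m + 1) 4,
            τ ^ (2 * (j - (m + 1))) * Tcoeff M V j q p := by
      rw [← Finset.sum_range_add_sum_Ico _ (show m + 1 ≤ 4 by omega), Finset.mul_sum]
      congr 1
      refine Finset.sum_congr rfl fun j hj => ?_
      rw [← mul_assoc, ← pow_add]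
      congr 2
      rw [Finset.mem_Ico] at hj
      omega
    rw [h1, h2, ← mul_assoc, ← pow_add, show N + (2 * m + 2 - N) = 2 * m + 2 by omega, Teff]
    ring

/-- Likewise the G_k with N < k ≤ 8 are added to the sum and compensated in the remainder. -/
theorem exists_genFun_eq {N : ℕ} (hN : N ≤ 8) {S : ℝ → Coord n → Coord n → ℝ}
    (hS : SmoothParam S) : ∃ s, SmoothParam s ∧ genFun (Gcoeff M V) N S =
      fun τ q P => interpF M (bracketData M hM V hV) N s (τ, (1, q), P) := by
  refine ⟨fun τ q p => S τ q p
    - ∑ k ∈ Finset.Ico (N + 1) 9, τ ^ (k - (N + 1)) * Gcoeff M V k q p, ?_, ?_⟩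
  · exact hS.sub (SmoothParam.sum fun k _ =>
      (smoothParam_of_smooth (smooth_Gcoeff M hM hV k)).pow_mul _)
  · funext τ q P
    rw [interpF_eq]
    have h1 : ∑ a, q a * P a + 1 * (τ * kinetic M P)
        + evalAt (q, P) ((bracketData M hM V hV).sol τ 1)
        = ∑ k ∈ Finset.range 9, τ ^ k * Gcoeff M V k q P := by
      have h3 : evalAt (q, P) ((bracketData M hM V hV).sol τ 1)
          = ∑ i ∈ Finset.range 6, τ ^ (i + 3) * Gcoeff M V (i + 3) q P := by
        simp only [BracketData.sol, map_sum, map_smul, smul_eq_mul]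
        refine Finset.sum_congr rfl fun i hi => ?_
        rw [BracketData.w_one _ i (Finset.mem_range.1 hi), Gcoeff_eq M hM hV (by omega)]
      have g0 : Gcoeff M V 0 q P = ∑ a, q a * P a := rfl
      have g1 : Gcoeff M V 1 q P = kinetic M P := rfl
      have g2 : Gcoeff M V 2 q P = 0 := rfl
      rw [h3]
      simp only [Finset.sum_range_succ, Finset.sum_range_zero, Nat.reduceAdd, zero_add]
      rw [g0, g1, g2]
      ring
    have h2 : ∑ k ∈ Finset.range 9, τ ^ k * Gcoeff M V k q P
        = ∑ k ∈ Finset.range (N + 1), τ ^ k * Gcoeff M V k q P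
          + τ ^ (N + 1) * ∑ k ∈ Finset.Ico (N + 1) 9, τ ^ (k - (N + 1)) * Gcoeff M V k q P := by
      rw [← Finset.sum_range_add_sum_Ico _ (show N + 1 ≤ 9 by omega), Finset.mul_sum]
      congr 1
      refine Finset.sum_congr rfl fun j hj => ?_
      rw [← mul_assoc, ← pow_add]
      congr 2
      rw [Finset.mem_Ico] at hj
      omega
    rw [h1, h2, genFun]
    ring

theorem realizesFlow_genFun {m : ℕ} (hm : m ≤ 3) {N : ℕ} (hN : N ≤ 2 * m + 2)
    {S S' : ℝ → Coord n → Coord n → ℝ} (hS : SmoothParam S) (hS' : SmoothParam S') :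
    RealizesFlow (Teff M V m S) (genFun (Gcoeff M V) N S') N := by
  obtain ⟨σ, hσ, hT⟩ := exists_Teff_eq M hM hV hm hN hS
  obtain ⟨s, hs, hG⟩ := exists_genFun_eq M hM hV (show N ≤ 8 by omega) hS'
  rw [hT, hG]
  refine realizesFlow_of_residual ((smoothParam_fullT M _).add (hσ.pow_mul N))
    (contDiff_interpG M (bracketData M hM V hV) N hs) (fun x => rfl) (fun τ q P => ?_)
    (residual_interpF_isBigO M hM hV (by omega) hσ hs)
  simp [interpG, BracketData.w_zero]

end

/-! ### Uniqueness of the coefficients -/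

section uniqueness

/-- If two generating functions realize the same flow to order `N`, their gradients differ by
`O(τ^{N+1})` along a curve through any given point. -/
theorem exists_curve_of_realizesFlow {H F G : ℝ → Coord n → Coord n → ℝ} {N : ℕ}
    (hFs : SmoothParam F) (hF : RealizesFlow H F N) (hG : RealizesFlow H G N) (q p : Coord n) :
    ∃ y : ℝ → Coord n, Tendsto y (𝓝 0) (𝓝 p) ∧ ∀ a,
      ((fun τ => pd a (fun q => F τ q (y τ)) q - pd a (fun q => G τ q (y τ)) q)
        =O[𝓝 0] fun τ => τ ^ (N + 1)) ∧
      ((fun τ => pd a (fun P => F τ q P) (y τ) - pd a (fun P => G τ q P) (y τ))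
        =O[𝓝 0] fun τ => τ ^ (N + 1)) := by
  obtain ⟨W₁, τ₁, C₁, Φ, hW₁, hK₁, hτ₁, hs₁, hΦ⟩ := hF {(q, p)} isCompact_singleton 1 one_pos
  obtain ⟨W₂, τ₂, C₂, Ψ, hW₂, hK₂, hτ₂, hs₂, hΨ⟩ := hG {(q, p)} isCompact_singleton 1 one_pos
  rw [Set.singleton_subset_iff] at hK₁ hK₂
  -- At `τ = 0` the error bound is zero, so Φ 0 fixes (q, p); joint smoothness then gives
  -- convergence of Φ τ (q, p) to (q, p).
  have hlim : ∀ {W : Set (Phase n)} {τ₀ C : ℝ} {Φ : ℝ → Phase n → Phase n}, IsOpen W →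
      (q, p) ∈ W → 0 < τ₀ →
      ContDiffOn ℝ ∞ (fun x : ℝ × Phase n => Φ x.1 x.2) (Set.Ioo (-τ₀) τ₀ ×ˢ W) →
      ((∃ γ, IsHamSolution (H 0) 0 (q, p) γ) ∧
          ∀ γ, IsHamSolution (H 0) 0 (q, p) γ → ‖Φ 0 (q, p) - γ 0‖ ≤ C * |0| ^ (N + 1)) →
      Tendsto (fun τ => Φ τ (q, p)) (𝓝 0) (𝓝 (q, p)) := by
    intro W τ₀ C Φ hW hK hτ hs h
    obtain ⟨⟨γ, hγ⟩, h⟩ := h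
    have h1 := h γ hγ
    rw [hγ.1, abs_zero, zero_pow (by omega), mul_zero] at h1
    have h2 : Φ 0 (q, p) = (q, p) := sub_eq_zero.1 (norm_le_zero_iff.1 h1)
    have h3 : ContinuousAt (fun x : ℝ × Phase n => Φ x.1 x.2) (0, (q, p)) :=
      hs.continuousOn.continuousAt ((isOpen_Ioo.prod hW).mem_nhds ⟨⟨by linarith, hτ⟩, hK⟩)
    have h4 : Tendsto (fun τ : ℝ => (τ, ((q, p) : Phase n))) (𝓝 0) (𝓝 (0, (q, p))) :=
      tendsto_id.prodMk_nhds tendsto_const_nhds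
    have h5 := h3.tendsto.comp h4
    rw [h2] at h5
    exact h5
  have hΦ0 := hlim hW₁ hK₁ hτ₁ hs₁ ((hΦ 0 (by simpa using hτ₁)).2.2 _ hK₁)
  have hΨ0 := hlim hW₂ hK₂ hτ₂ hs₂ ((hΨ 0 (by simpa using hτ₂)).2.2 _ hK₂)
  have hnear : ∀ᶠ τ : ℝ in 𝓝 0, |τ| < τ₁ ∧ |τ| < τ₂ := by
    have : Tendsto (fun τ : ℝ => |τ|) (𝓝 0) (𝓝 0) := by simpa using continuous_abs.tendsto (0 : ℝ)
    exact (this.eventually (gt_mem_nhds hτ₁)).and (this.eventually (gt_mem_nhds hτ₂))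
  have hdiff : (fun τ => Φ τ (q, p) - Ψ τ (q, p)) =O[𝓝 0] fun τ : ℝ => τ ^ (N + 1) := by
    refine IsBigO.of_bound (C₁ + C₂) ?_
    filter_upwards [hnear] with τ hτ
    obtain ⟨⟨γ, hγ⟩, h1⟩ := (hΦ τ hτ.1).2.2 _ hK₁
    have h2 := h1 γ hγ
    have h3 := ((hΨ τ hτ.2).2.2 _ hK₂).2 γ hγ
    rw [norm_pow, Real.norm_eq_abs]
    calc ‖Φ τ (q, p) - Ψ τ (q, p)‖
        = ‖(Φ τ (q, p) - γ τ) - (Ψ τ (q, p) - γ τ)‖ := by congr 1; abel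
      _ ≤ _ := norm_sub_le _ _
      _ ≤ C₁ * |τ| ^ (N + 1) + C₂ * |τ| ^ (N + 1) := add_le_add h2 h3
      _ = _ := by ring
  have hdiff1 : (fun τ => (Φ τ (q, p)).1 - (Ψ τ (q, p)).1) =O[𝓝 0] fun τ : ℝ => τ ^ (N + 1) :=
    (isBigO_prod_left.1 hdiff).1
  have hdiff2 : (fun τ => (Φ τ (q, p)).2 - (Ψ τ (q, p)).2) =O[𝓝 0] fun τ : ℝ => τ ^ (N + 1) :=
    (isBigO_prod_left.1 hdiff).2
  have hΦ2 : Tendsto (fun τ => (Φ τ (q, p)).2) (𝓝 0) (𝓝 p) := (continuous_snd.tendsto _).comp hΦ0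
  have hΨ2 : Tendsto (fun τ => (Ψ τ (q, p)).2) (𝓝 0) (𝓝 p) := (continuous_snd.tendsto _).comp hΨ0
  set Fu := fun x : ℝ × Coord n × Coord n => F x.1 x.2.1 x.2.2 with hFu
  have hder : ContDiff ℝ ∞ (fderiv ℝ Fu) := ContDiff.fderiv_right hFs (m := ∞) (by simp)
  -- The relations for F and G hold at the same (q, p) but at different new momenta. These differ by
  -- O(τ^{N+1}), and the gradient of F is locally Lipschitz, so both can be compared at the momentum
  -- given by Ψ.
  have hshift : ∀ e, (fun τ => fderiv ℝ Fu (τ, q, (Ψ τ (q, p)).2) e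
      - fderiv ℝ Fu (τ, q, (Φ τ (q, p)).2) e) =O[𝓝 0] fun τ : ℝ => τ ^ (N + 1) := by
    intro e
    have he : ContDiff ℝ ∞ fun x => fderiv ℝ Fu x e := hder.clm_apply contDiff_const
    have h3 := ((he.contDiffAt (x := ((0 : ℝ), q, p))).hasStrictFDerivAt (by simp)).isBigO_sub
    have h4 : Tendsto (fun τ => (((τ, q, (Ψ τ (q, p)).2) : ℝ × Coord n × Coord n),
        ((τ, q, (Φ τ (q, p)).2) : ℝ × Coord n × Coord n))) (𝓝 0)
        (𝓝 (((0, q, p) : ℝ × Coord n × Coord n), ((0, q, p) : ℝ × Coord n × Coord n))) :=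
      (tendsto_id.prodMk_nhds (tendsto_const_nhds.prodMk_nhds hΨ2)).prodMk_nhds
        (tendsto_id.prodMk_nhds (tendsto_const_nhds.prodMk_nhds hΦ2))
    refine (h3.comp_tendsto h4).trans (IsBigO.trans ?_ hdiff2)
    refine IsBigO.of_bound 1 (Eventually.of_forall fun τ => ?_)
    simp [Function.comp, Prod.norm_def, norm_sub_rev]
  refine ⟨fun τ => (Ψ τ (q, p)).2, hΨ2, fun a => ⟨?_, ?_⟩⟩
  · refine (hshift (0, unitV a, 0)).congr' ?_ (EventuallyEq.refl _ _)
    filter_upwards [hnear] with τ hτ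
    have h1 := ((((hΦ τ hτ.1).1 _ hK₁ _).2 rfl).1).1 a
    have h2 := ((((hΨ τ hτ.2).1 _ hK₂ _).2 rfl).1).1 a
    rw [← h2, h1, pd_param_q hFs, pd_param_q hFs]
  · refine ((hshift (0, 0, unitV a)).add ((isBigO_pi.1 hdiff1) a)).congr' ?_
      (EventuallyEq.refl _ _)
    filter_upwards [hnear] with τ hτ
    have h1 := ((((hΦ τ hτ.1).1 _ hK₁ _).2 rfl).1).2 a
    have h2 := ((((hΨ τ hτ.2).1 _ hK₂ _).2 rfl).1).2 a
    simp only [Pi.sub_apply]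
    rw [← h2, h1, pd_param_p hFs, pd_param_p hFs]
    ring

/-- Divide by τ^k and let `τ` tend to 0. As the evaluation point moves with `τ`, the lower
coefficients have to vanish identically and not just at the limit point. -/
theorem eq_zero_of_sum_isBigO {Y : Type*} [TopologicalSpace Y] {N : ℕ} {b : ℕ → Y → ℝ}
    (hb : ∀ k ≤ N, Continuous (b k)) {y : ℝ → Y} {y₀ : Y} (hy : Tendsto y (𝓝 0) (𝓝 y₀))
    (h : (fun τ => ∑ k ∈ Finset.range (N + 1), τ ^ k * b k (y τ)) =O[𝓝 0]
      fun τ : ℝ => τ ^ (N + 1)) {k : ℕ} (hk : k ≤ N) (h0 : ∀ j < k, ∀ x, b j x = 0) :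
    b k y₀ = 0 := by
  have hpow : ∀ j, k + 1 ≤ j → (fun τ : ℝ => τ ^ j) =O[𝓝 0] fun τ : ℝ => τ ^ (k + 1) := by
    intro j hj
    obtain ⟨i, rfl⟩ := Nat.exists_eq_add_of_le hj
    have hc : ContinuousAt (fun τ : ℝ => τ ^ i) 0 := by fun_prop
    simpa [pow_add] using isBigO_pow_mul_of_continuous hc (k + 1)
  have hlim : ∀ j ≤ N, Tendsto (fun τ => b j (y τ)) (𝓝 0) (𝓝 (b j y₀)) := fun j hj =>
    ((hb j hj).tendsto y₀).comp hy
  have h1 : (fun τ => ∑ j ∈ (Finset.range (N + 1)).erase k, τ ^ j * b j (y τ)) =O[𝓝 0]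
      fun τ : ℝ => τ ^ (k + 1) := by
    refine IsBigO.fun_sum fun j hj => ?_
    rw [Finset.mem_erase, Finset.mem_range] at hj
    rcases lt_or_gt_of_ne hj.1 with hlt | hgt
    · simp only [h0 j hlt, mul_zero]
      exact isBigO_zero _ _
    · have h2 : (fun τ => τ ^ j * b j (y τ)) =O[𝓝 0] fun τ : ℝ => τ ^ j := by
        simpa using (isBigO_refl (fun τ : ℝ => τ ^ j) (𝓝 0)).mul
          ((hlim j (by omega)).isBigO_one ℝ)
      exact h2.trans (hpow j hgt)
  have h2 : (fun τ => τ ^ k * b k (y τ)) =O[𝓝 0] fun τ : ℝ => τ ^ (k + 1) := by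
    refine ((h.trans (hpow (N + 1) (by omega))).sub h1).congr_left fun τ => ?_
    rw [← Finset.add_sum_erase _ _ (Finset.mem_range.2 (show k < N + 1 by omega))]
    ring
  have h3 : (fun τ => b k (y τ)) =O[𝓝[≠] 0] fun τ : ℝ => τ := by
    have h4 := (h2.mono (nhdsWithin_le_nhds (s := {0}ᶜ))).mul
      (isBigO_refl (fun τ : ℝ => (τ ^ k)⁻¹) (𝓝[≠] 0))
    refine h4.congr' ?_ ?_ <;> filter_upwards [self_mem_nhdsWithin] with τ hτ
    · have : τ ≠ 0 := hτ
      field_simp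
    · have : τ ≠ 0 := hτ
      field_simp
      ring
  have h5 : Tendsto (fun τ => b k (y τ)) (𝓝[≠] 0) (𝓝 0) :=
    h3.trans_tendsto (tendsto_id.mono_left nhdsWithin_le_nhds)
  exact tendsto_nhds_unique ((hlim k hk).mono_left nhdsWithin_le_nhds) h5

theorem pd_sub_genFun {A B : ℕ → Coord n → ℝ} {S S' : Coord n → ℝ} {N : ℕ}
    (hA : ∀ k ≤ N, ContDiff ℝ ∞ (A k)) (hB : ∀ k ≤ N, ContDiff ℝ ∞ (B k))
    (hS : ContDiff ℝ ∞ S) (hS' : ContDiff ℝ ∞ S') (τ : ℝ) (a : Fin n) (x : Coord n) :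
    pd a (fun q => ∑ k ∈ Finset.range (N + 1), τ ^ k * A k q + τ ^ (N + 1) * S q) x
      - pd a (fun q => ∑ k ∈ Finset.range (N + 1), τ ^ k * B k q + τ ^ (N + 1) * S' q) x
    = ∑ k ∈ Finset.range (N + 1), τ ^ k * pd a (fun q => A k q - B k q) x
      + τ ^ (N + 1) * pd a (fun q => S q - S' q) x := by
  have key : ∀ {A : ℕ → Coord n → ℝ} {S : Coord n → ℝ}, (∀ k ≤ N, ContDiff ℝ ∞ (A k)) →
      ContDiff ℝ ∞ S →
      pd a (fun q => ∑ k ∈ Finset.range (N + 1), τ ^ k * A k q + τ ^ (N + 1) * S q) x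
        = ∑ k ∈ Finset.range (N + 1), τ ^ k * pd a (A k) x + τ ^ (N + 1) * pd a S x := by
    intro A S hA hS
    have h1 : HasFDerivAt (fun q => ∑ k ∈ Finset.range (N + 1), τ ^ k * A k q)
        (∑ k ∈ Finset.range (N + 1), τ ^ k • fderiv ℝ (A k) x) x :=
      HasFDerivAt.fun_sum fun k hk => (((hA k (by
        rw [Finset.mem_range] at hk; omega)).differentiable (by simp) x).hasFDerivAt).const_mul _
    have h2 := (h1.fun_add
      (((hS.differentiable (by simp) x).hasFDerivAt).const_mul (τ ^ (N + 1)))).fderiv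
    unfold pd
    rw [h2]
    simp
  have hsub : ∀ {f g : Coord n → ℝ}, ContDiff ℝ ∞ f → ContDiff ℝ ∞ g →
      pd a (fun q => f q - g q) x = pd a f x - pd a g x := by
    intro f g hf hg
    have h := ((hf.differentiable (by simp) x).hasFDerivAt.fun_sub
      (hg.differentiable (by simp) x).hasFDerivAt).fderiv
    unfold pd
    rw [h]
    rfl
  rw [key hA hS, key hB hS', hsub hS hS']
  have h3 : ∑ k ∈ Finset.range (N + 1), τ ^ k * pd a (fun q => A k q - B k q) x
      = ∑ k ∈ Finset.range (N + 1), (τ ^ k * pd a (A k) x - τ ^ k * pd a (B k) x) := by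
    refine Finset.sum_congr rfl fun k hk => ?_
    have hk' : k ≤ N := by rw [Finset.mem_range] at hk; omega
    rw [hsub (hA k hk') (hB k hk'), mul_sub]
  rw [h3, Finset.sum_sub_distrib]
  ring

theorem coeff_unique {H : ℝ → Coord n → Coord n → ℝ} {A B : ℕ → Coord n → Coord n → ℝ}
    {S S' : ℝ → Coord n → Coord n → ℝ} {N : ℕ} (hA : ∀ k ≤ N, Smooth (A k))
    (hB : ∀ k ≤ N, Smooth (B k)) (hS : SmoothParam S) (hS' : SmoothParam S')
    (h1 : RealizesFlow H (genFun A N S) N) (h2 : RealizesFlow H (genFun B N S') N) :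
    ∀ k ≤ N, ∃ c : ℝ, ∀ q P, A k q P = B k q P + c := by
  have hSd : SmoothParam fun τ q p => S τ q p - S' τ q p := hS.sub hS'
  have hd : ∀ k ≤ N, SmoothParam fun _ q p => A k q p - B k q p := fun k hk =>
    (smoothParam_of_smooth (hA k hk)).sub (smoothParam_of_smooth (hB k hk))
  have hslq : ∀ {f : ℝ → Coord n → Coord n → ℝ}, SmoothParam f → ∀ τ P,
      ContDiff ℝ ∞ fun q => f τ q P := fun {f} hf τ P => by
    have h : ContDiff ℝ ∞ fun q : Coord n => ((τ, q, P) : ℝ × Coord n × Coord n) := by fun_prop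
    exact ContDiff.comp (g := fun x : ℝ × Coord n × Coord n => f x.1 x.2.1 x.2.2) hf h
  have hslp : ∀ {f : ℝ → Coord n → Coord n → ℝ}, SmoothParam f → ∀ τ q,
      ContDiff ℝ ∞ fun P => f τ q P := fun {f} hf τ q => by
    have h : ContDiff ℝ ∞ fun P : Coord n => ((τ, q, P) : ℝ × Coord n × Coord n) := by fun_prop
    exact ContDiff.comp (g := fun x : ℝ × Coord n × Coord n => f x.1 x.2.1 x.2.2) hf h
  have hcq : ∀ {f : ℝ → Coord n → Coord n → ℝ}, SmoothParam f → ∀ q a,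
      Continuous fun x : ℝ × Coord n => pd a (fun q => f x.1 q x.2) q := by
    intro f hf q a
    simp only [pd_param_q hf]
    have h : Continuous (fderiv ℝ fun x : ℝ × Coord n × Coord n => f x.1 x.2.1 x.2.2) :=
      ContDiff.continuous_fderiv hf (by simp)
    exact (h.comp (continuous_fst.prodMk (continuous_const.prodMk continuous_snd))).clm_apply
      continuous_const
  have hcp : ∀ {f : ℝ → Coord n → Coord n → ℝ}, SmoothParam f → ∀ q a,
      Continuous fun x : ℝ × Coord n => pd a (fun P => f x.1 q P) x.2 := by
    intro f hf q a
    simp only [pd_param_p hf]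
    have h : Continuous (fderiv ℝ fun x : ℝ × Coord n × Coord n => f x.1 x.2.1 x.2.2) :=
      ContDiff.continuous_fderiv hf (by simp)
    exact (h.comp (continuous_fst.prodMk (continuous_const.prodMk continuous_snd))).clm_apply
      continuous_const
  have hrem : ∀ {c : ℝ × Coord n → ℝ}, Continuous c → ∀ {y : ℝ → Coord n} {p : Coord n},
      Tendsto y (𝓝 0) (𝓝 p) →
      (fun τ => τ ^ (N + 1) * c (τ, y τ)) =O[𝓝 0] fun τ : ℝ => τ ^ (N + 1) := by
    intro c hc y p hy
    have h := (hc.tendsto (0, p)).comp (tendsto_id.prodMk_nhds hy)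
    simpa using (isBigO_refl (fun τ : ℝ => τ ^ (N + 1)) (𝓝 0)).mul (h.isBigO_one ℝ)
  -- Strong induction on k over all points simultaneously, as `eq_zero_of_sum_isBigO` demands.
  have hzero : ∀ k ≤ N, ∀ q p a, pd a (fun q => A k q p - B k q p) q = 0 ∧
      pd a (fun p => A k q p - B k q p) p = 0 := by
    intro k
    induction k using Nat.strong_induction_on with
    | _ k ih =>
      intro hk q p a
      obtain ⟨y, hy, hO⟩ := exists_curve_of_realizesFlow (smoothParam_genFun hA hS) h1 h2 q p
      obtain ⟨hO1, hO2⟩ := hO a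
      constructor
      · refine eq_zero_of_sum_isBigO (b := fun k P => pd a (fun q => A k q P - B k q P) q)
          (fun j hj => (hcq (hd j hj) q a)
            |>.comp (f := fun x : Coord n => ((0 : ℝ), x)) (by fun_prop))
          hy ?_ hk fun j hj x => (ih j hj (by omega) q x a).1
        refine (hO1.sub (hrem (hcq hSd q a) hy)).congr_left fun τ => ?_
        have := pd_sub_genFun (fun k hk => hslq (smoothParam_of_smooth (hA k hk)) 0 (y τ))
          (fun k hk => hslq (smoothParam_of_smooth (hB k hk)) 0 (y τ))
          (hslq hS τ (y τ)) (hslq hS' τ (y τ)) τ a q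
        simp only [genFun]
        rw [this]
        ring
      · refine eq_zero_of_sum_isBigO (b := fun k P => pd a (fun P => A k q P - B k q P) P)
          (fun j hj => (hcp (hd j hj) q a)
            |>.comp (f := fun x : Coord n => ((0 : ℝ), x)) (by fun_prop))
          hy ?_ hk fun j hj x => (ih j hj (by omega) q x a).2
        refine (hO2.sub (hrem (hcp hSd q a) hy)).congr_left fun τ => ?_
        have := pd_sub_genFun (fun k hk => hslp (smoothParam_of_smooth (hA k hk)) 0 q)
          (fun k hk => hslp (smoothParam_of_smooth (hB k hk)) 0 q)
          (hslp hS τ q) (hslp hS' τ q) τ a (y τ)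
        simp only [genFun]
        rw [this]
        ring
  intro k hk
  set f : Phase n → ℝ := fun z => A k z.1 z.2 - B k z.1 z.2 with hfdef
  have hfs : ContDiff ℝ ∞ f := ContDiff.sub (hA k hk) (hB k hk)
  have hfz : ∀ z, fderiv ℝ f z = 0 := by
    intro z
    have h3 : HasFDerivAt f (fderiv ℝ f z) z := (hfs.differentiable (by simp) z).hasFDerivAt
    have hq : ∀ a, fderiv ℝ f z (unitV a, 0) = 0 := by
      intro a
      have h4 : HasFDerivAt (fun q : Coord n => ((q, z.2) : Phase n))
        (ContinuousLinearMap.inl ℝ (Coord n) (Coord n)) z.1 := hasFDerivAt_prodMk_left z.1 z.2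
      exact (pd_eq_of_comp hfs h4 a).symm.trans (hzero k hk z.1 z.2 a).1
    have hp : ∀ a, fderiv ℝ f z (0, unitV a) = 0 := by
      intro a
      have h4 : HasFDerivAt (fun p : Coord n => ((z.1, p) : Phase n))
        (ContinuousLinearMap.inr ℝ (Coord n) (Coord n)) z.2 := hasFDerivAt_prodMk_right z.1 z.2
      exact (pd_eq_of_comp hfs h4 a).symm.trans (hzero k hk z.1 z.2 a).2
    rw [ContinuousLinearMap.ext_iff]
    rintro ⟨u, v⟩
    have h5 := sum_mul_apply_unitV ((fderiv ℝ f z).toLinearMap ∘ₗ LinearMap.inl ℝ _ _) u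
    have h6 := sum_mul_apply_unitV ((fderiv ℝ f z).toLinearMap ∘ₗ LinearMap.inr ℝ _ _) v
    simp [hq] at h5
    simp [hp] at h6
    have h7 : ((u, v) : Phase n) = (u, 0) + (0, v) := by simp
    rw [h7, map_add, ← h5, ← h6]
    simp
  refine ⟨f 0, fun q P => ?_⟩
  have h8 := is_const_of_fderiv_eq_zero (hfs.differentiable (by simp)) hfz (q, P) 0
  rw [← h8]
  simp [hfdef]

end uniqueness

end

end MoveStep

end

theorem mainTheorem4 {n : ℕ} (M : Matrix (Fin n) (Fin n) ℝ) (hM : M.IsSymm)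
    (V : MoveStep.Coord n → ℝ) (hV : ContDiff ℝ (∞ : WithTop ℕ∞) V)
    (m : ℕ) (hm : m ≤ 3) (N : ℕ) (hN : N ≤ 2 * m + 2)
    (S : ℝ → MoveStep.Coord n → MoveStep.Coord n → ℝ) (hS : MoveStep.SmoothParam S) :
    (∀ S' : ℝ → MoveStep.Coord n → MoveStep.Coord n → ℝ, MoveStep.SmoothParam S' →
      MoveStep.RealizesFlow (MoveStep.Teff M V m S)
        (MoveStep.genFun (MoveStep.Gcoeff M V) N S') N) ∧
    (∀ (A : ℕ → MoveStep.Coord n → MoveStep.Coord n → ℝ)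
      (S' : ℝ → MoveStep.Coord n → MoveStep.Coord n → ℝ),
      (∀ k ≤ N, MoveStep.Smooth (A k)) → MoveStep.SmoothParam S' →
      MoveStep.RealizesFlow (MoveStep.Teff M V m S) (MoveStep.genFun A N S') N →
      ∀ k ≤ N, ∃ c : ℝ, ∀ q P : MoveStep.Coord n, A k q P = MoveStep.Gcoeff M V k q P + c) := by
  refine ⟨fun S' hS' => MoveStep.realizesFlow_genFun M hM hV hm hN hS hS',
    fun A S' hA hS' h => ?_⟩
  -- The comparison function is the one from the existence part, taken with the same remainder S';
  -- any smooth remainder would serve.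
  exact MoveStep.coeff_unique hA (fun k _ => MoveStep.smooth_Gcoeff M hM hV k) hS' hS' h
    (MoveStep.realizesFlow_genFun M hM hV hm hN hS hS')
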